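/- Let $m\ge 3$ and let $(L,g)$ be a CS/AC manifold of dimension $m$ with $s$ CS ends and $l$ AC ends: $L$ is a connected smooth $m$-manifold, $g$ is a smooth Riemannian metric on $L$, and $L$ is the union of a compact set and of $s+l$ pairwise disjoint open ends $S_i$ such that for each $i$ there are a compact connected Riemannian $(m-1)$-manifold $(\Sigma_i,g_i')$ and a diffeomorphism $$\phi_i:\Sigma_i\times(0,\epsilon_i]\to \overline{S_i}\ \text{ (CS ends)},\qquad \phi_i:\Sigma_i\times[R_i,\infty)\to\overline{S_i}\ \text{ (AC ends)},$$ mapping $\Sigma_i\times(0,\epsilon_i)$, respectively $\Sigma_i\times(R_i,\infty)$, onto $S_i$, and such that for some rate $\nu_i>0$ (CS ends), respectively $\nu_i<0$ (AC ends), and all $k\ge0$, one has $|\tilde\nabla^k(\phi_i^*g-\tilde g_i)|_{\tilde g_i}=O(r^{\nu_i-k})$ as $r\to0$, respectively $r\to\infty$. Here $\theta\in\Sigma_i$, $r$ is the second coordinate, $\tilde g_i=dr^2+r^2g_i'$, and $\tilde\nabla$ is the Levi-Civita connection of $\tilde g_i$. For $\beta\in\mathbb R^{s+l}$ let $C^\infty_\beta(L)$,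 respectively $C^\infty_\beta(\Lambda^1)$, be the space of smooth functions, respectively smooth 1-forms, $\sigma$ on $L$ such that $|\nabla^j\sigma|_g=O(r^{\beta_i-j})$ along the end $S_i$ (as $r\to0$ on CS ends, as $r\to\infty$ on AC ends), for all $i$ and all $j\ge0$. Write $\beta=(\mu,\lambda)$ with $\mu\in\mathbb R^s$ the weights on the CS ends and $\lambda\in\mathbb R^l$ the weights on the AC ends; inequalities and the subtraction of $1$ are componentwise. Let $H^1(L;\mathbb R)$ be the space of smooth closed 1-forms modulo $d(C^\infty(L))$. (a) Let $\tilde H^1_c$ be the image of the compactly supported cohomology $H^1_c(L;\mathbb R)$ in $H^1(L;\mathbb R)$. Let $\tilde H_{0,\infty}$ be a vector space of compactly supported smooth closed 1-forms on $L$ such that $\alpha\mapsto[\alpha]$ is an isomorphism $\tilde H_{0,\infty}\to\tilde H^1_c$. For $i=1,\dots,s+l$ let $f_i\in C^\infty(L)$ satisfy $f_i\equiv1$ on $S_i$ and $f_i\equiv0$ on the other ends, with $\sum_i f_i\equiv1$, and let $E_{0,\infty}$ be the span of the $f_i$. Then $\tilde H_{0,\infty}$ is finite-dimensional and, for all $\mu>0$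 and $\lambda<0$, there is an (internal) direct sum decomposition $$\{\text{closed 1-forms in } C^\infty_{(\mu-1,\lambda-1)}(\Lambda^1)\}=\tilde H_{0,\infty}\oplus d(E_{0,\infty})\oplus d(C^\infty_{(\mu,\lambda)}(L)).$$ (b) Let $H^1_{c,\bullet}(L;\mathbb R)$ be the space of smooth closed 1-forms that vanish near the singularities (that is, for all sufficiently small $r$ on every CS end) modulo the differentials of smooth functions that vanish near the singularities, and let $\tilde H^1_{c,\bullet}$ be its image in $H^1(L;\mathbb R)$. Let $\tilde H_{0,\bullet}$ be a vector space of smooth closed 1-forms on $L$ that vanish near the singularities and are translation-invariant outside a compact subset of $L$ (that is, outside a compact subset each of them equals, on each end, the pull-back $\pi^*\eta$ of a smooth 1-form $\eta$ on $\Sigma_i$ by the projection $\pi$ of the end to $\Sigma_i$), and such that $\alpha\mapsto[\alpha]$ is an isomorphism $\tilde H_{0,\bullet}\to\tilde H^1_{c,\bullet}$. For each of the $s$ CS ends $S_i$ let $f_i\in C^\infty(L)$ satisfy $f_i\equiv1$ on $S_i$ and $f_i\equiv0$ on all other ends, CS and AC, and let $E_0$ be the span of these $s$ functions. Then $\tilde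 H_{0,\bullet}$ is finite-dimensional and, for all $\mu>0$ and $\lambda>0$, the sum $E_0+C^\infty_{(\mu,\lambda)}(L)$ is direct and there is an (internal) direct sum decomposition $$\{\text{closed 1-forms in } C^\infty_{(\mu-1,\lambda-1)}(\Lambda^1)\}=\tilde H_{0,\bullet}\oplus d\big(E_0\oplus C^\infty_{(\mu,\lambda)}(L)\big).$$ -/

import Mathlib

open scoped Manifold ContDiff Topology
open Set
set_option maxSynthPendingDepth 3
noncomputable section
namespace Conifold

section Local
variable {E : Type*} [NormedAddCommGroup E] [NormedSpace ℝ E]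

/-- The Christoffel symbols of the first kind of a field `G` of bilinear forms on `E`, that is
`½ (D_v G(w,z) + D_w G(v,z) - D_z G(v,w))`; see `koszul_apply`. -/
def koszul (G : E → E →L[ℝ] E →L[ℝ] ℝ) (u : E) : E →L[ℝ] E →L[ℝ] E →L[ℝ] ℝ :=
  (1 / 2 : ℝ) • (fderiv ℝ G u + (fderiv ℝ G u).flip
    - (ContinuousLinearMap.flipₗᵢ ℝ E E ℝ : (E →L[ℝ] E →L[ℝ] ℝ) →L[ℝ] (E →L[ℝ] E →L[ℝ] ℝ)).comp
        (fderiv ℝ G u).flip)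

theorem koszul_apply (G : E → E →L[ℝ] E →L[ℝ] ℝ) (u v w z : E) :
    koszul G u v w z =
      1 / 2 * (fderiv ℝ G u v w z + fderiv ℝ G u w v z - fderiv ℝ G u z v w) := by
  simp [koszul]

/-- The Levi-Civita connection coefficients `Γ(v,w) = ∇_v w` (for constant fields `v`, `w`) of a
nondegenerate symmetric `G`: the vector with `G(Γ(v,w), z) = ½ (D_v G(w,z) + D_w G(v,z) - D_z G(v,w))`
for all `z`; see `christoffel_spec`. -/
def christoffel (G : E → E →L[ℝ] E →L[ℝ] ℝ) (u : E) : E →L[ℝ] E →L[ℝ] E :=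
  (ContinuousLinearMap.compL ℝ E (E →L[ℝ] ℝ) E (G u).inverse).comp (koszul G u)

theorem christoffel_spec (G : E → E →L[ℝ] E →L[ℝ] ℝ) (u : E) (hG : (G u).IsInvertible)
    (v w z : E) : G u (christoffel G u v w) z = koszul G u v w z := by
  obtain ⟨e, he⟩ := hG
  simp [christoffel, ← he]

/-- The derivation action of an endomorphism `A` on covariant `k`-tensors,
`(v₁,…,v_k) ↦ ∑ i, T(v₁,…,A vᵢ,…,v_k)`; see `endAct_apply`. -/
def endAct (E : Type*) [NormedAddCommGroup E] [NormedSpace ℝ E] (k : ℕ) : (E →L[ℝ] E) →L[ℝ] (E [×k]→L[ℝ] ℝ) →L[ℝ] (E [×k]→L[ℝ] ℝ) :=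
  ((ContinuousMultilinearMap.compContinuousLinearMapContinuousMultilinear ℝ
      (fun _ : Fin k => E) (fun _ : Fin k => E) ℝ).linearDeriv
        (fun _ => ContinuousLinearMap.id ℝ E)).comp
    (ContinuousLinearMap.pi fun _ => ContinuousLinearMap.id ℝ (E →L[ℝ] E))

theorem endAct_apply (k : ℕ) (A : E →L[ℝ] E) (T : E [×k]→L[ℝ] ℝ) (v : Fin k → E) :
    endAct E k A T v = ∑ i, T (Function.update v i (A (v i))) := by
  simp only [endAct, ContinuousLinearMap.comp_apply, ContinuousMultilinearMap.linearDeriv_apply,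
    sum_apply]
  refine Finset.sum_congr rfl fun i _ => ?_
  change T _ = T _
  congr 1
  funext j
  by_cases h : j = i
  · subst h; simp
  · simp [h]

/-- The Levi-Civita covariant derivative `∇T` of a covariant `k`-tensor field `T` on (an open subset of)
`E`, with the differentiation direction in the first slot; see `covDeriv_apply`. -/
def covDeriv (G : E → E →L[ℝ] E →L[ℝ] ℝ) {k : ℕ} (T : E → E [×k]→L[ℝ] ℝ) (u : E) :
    E [×(k + 1)]→L[ℝ] ℝ :=
  ContinuousLinearMap.uncurryLeft
    (fderiv ℝ T u - ((endAct E k).flip (T u)).comp (christoffel G u))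

theorem covDeriv_apply (G : E → E →L[ℝ] E →L[ℝ] ℝ) {k : ℕ} (T : E → E [×k]→L[ℝ] ℝ) (u : E)
    (v : Fin (k + 1) → E) :
    covDeriv G T u v = fderiv ℝ T u (v 0) (Fin.tail v) -
      ∑ i, T u (Function.update (Fin.tail v) i (christoffel G u (v 0) (Fin.tail v i))) := by
  simp [covDeriv, endAct_apply]

theorem covDeriv_congr {G : E → E →L[ℝ] E →L[ℝ] ℝ} {U : Set E} {k : ℕ} (hU : IsOpen U) {T S : E → E [×k]→L[ℝ] ℝ} (h : EqOn T S U) :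
    EqOn (covDeriv G T) (covDeriv G S) U := by
  intro u hu
  have : T =ᶠ[𝓝 u] S := Filter.eventuallyEq_of_mem (hU.mem_nhds hu) h
  simp only [covDeriv, this.fderiv_eq, h hu]

/-- The iterated covariant derivative `∇ʲT`. -/
def iterCov (G : E → E →L[ℝ] E →L[ℝ] ℝ) {k : ℕ} (T : E → E [×k]→L[ℝ] ℝ) :
    (j : ℕ) → E → E [×(k + j)]→L[ℝ] ℝ
  | 0 => T
  | j + 1 => covDeriv G (iterCov G T j)

/-- `|T|_B ≤ C`, for the operator norm of the covariant tensor `T` with respect to the scalar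
product `B`. On tensors of a fixed rank over a space of fixed dimension this norm and the Euclidean
tensor norm bound each other up to a constant factor, so all growth conditions stated with it
are the usual ones. -/
def NormLE (B : E →L[ℝ] E →L[ℝ] ℝ) {k : ℕ} (T : E [×k]→L[ℝ] ℝ) (C : ℝ) : Prop :=
  ∀ v : Fin k → E, |T v| ≤ C * ∏ i, √(B (v i) (v i))

/-- `G` is a smooth field of nondegenerate bilinear forms on `U`. -/
structure SmoothNondeg (G : E → E →L[ℝ] E →L[ℝ] ℝ) (U : Set E) : Prop where
  smooth : ContDiffOn ℝ ∞ G U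
  inv : ∀ u ∈ U, (G u).IsInvertible

variable [CompleteSpace E] {G : E → E →L[ℝ] E →L[ℝ] ℝ} {U : Set E} {k : ℕ}

theorem contDiffOn_christoffel (hU : IsOpen U) (hG : SmoothNondeg G U) :
    ContDiffOn ℝ ∞ (christoffel G) U := by
  have h1 : ContDiffOn ℝ ∞ (fderiv ℝ G) U := hG.smooth.fderiv_of_isOpen hU (by simp)
  have h2 : ContDiffOn ℝ ∞ (fun u => (fderiv ℝ G u).flip) U :=
    (ContinuousLinearMap.flipₗᵢ ℝ E E (E →L[ℝ] ℝ)).contDiff.comp_contDiffOn h1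
  have h3 : ContDiffOn ℝ ∞ (koszul G) U :=
    ((h1.add h2).sub (contDiffOn_const.clm_comp h2)).const_smul (1 / 2 : ℝ)
  have h4 : ContDiffOn ℝ ∞ (fun u => (G u).inverse) U := by
    intro u hu
    exact ((hG.inv u hu).contDiffAt_map_inverse).comp_contDiffWithinAt u (hG.smooth u hu)
  exact ((ContinuousLinearMap.compL ℝ E (E →L[ℝ] ℝ) E).contDiff.comp_contDiffOn h4).clm_comp h3

theorem contDiffOn_covDeriv (hU : IsOpen U) (hG : SmoothNondeg G U) {T : E → E [×k]→L[ℝ] ℝ}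
    (hT : ContDiffOn ℝ ∞ T U) : ContDiffOn ℝ ∞ (covDeriv G T) U := by
  have h1 : ContDiffOn ℝ ∞ (fderiv ℝ T) U := hT.fderiv_of_isOpen hU (by simp)
  have h2 := ((endAct E k).flip.contDiff.comp_contDiffOn hT).clm_comp
    (contDiffOn_christoffel hU hG)
  exact (continuousMultilinearCurryLeftEquiv ℝ (fun _ : Fin (k + 1) => E)
    ℝ).symm.contDiff.comp_contDiffOn (h1.sub h2)

theorem contDiffOn_iterCov (hU : IsOpen U) (hG : SmoothNondeg G U) {T : E → E [×k]→L[ℝ] ℝ}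
    (hT : ContDiffOn ℝ ∞ T U) (j : ℕ) : ContDiffOn ℝ ∞ (iterCov G T j) U := by
  induction j with
  | zero => exact hT
  | succ j ih => exact contDiffOn_covDeriv hU hG ih

theorem iterCov_add (hU : IsOpen U) (hG : SmoothNondeg G U) {T S : E → E [×k]→L[ℝ] ℝ}
    (hT : ContDiffOn ℝ ∞ T U) (hS : ContDiffOn ℝ ∞ S U) (j : ℕ) :
    EqOn (iterCov G (T + S) j) (iterCov G T j + iterCov G S j) U := by
  induction j with
  | zero => exact fun u _ => rfl
  | succ j ih =>
    intro u hu
    have hd : ∀ {R : E → E [×k]→L[ℝ] ℝ}, ContDiffOn ℝ ∞ R U →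
        DifferentiableAt ℝ (iterCov G R j) u := fun hR =>
      ((contDiffOn_iterCov hU hG hR j).contDiffAt (hU.mem_nhds hu)).differentiableAt (by simp)
    change covDeriv G (iterCov G (T + S) j) u = _
    rw [covDeriv_congr hU ih hu]
    ext v
    change _ = covDeriv G (iterCov G T j) u v + covDeriv G (iterCov G S j) u v
    simp only [covDeriv_apply, fderiv_add (hd hT) (hd hS), Pi.add_apply,
      add_apply, Finset.sum_add_distrib]
    ring

theorem iterCov_smul (hU : IsOpen U) (hG : SmoothNondeg G U) {T : E → E [×k]→L[ℝ] ℝ}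
    (hT : ContDiffOn ℝ ∞ T U) (c : ℝ) (j : ℕ) :
    EqOn (iterCov G (c • T) j) (c • iterCov G T j) U := by
  induction j with
  | zero => exact fun u _ => rfl
  | succ j ih =>
    intro u hu
    have hd : DifferentiableAt ℝ (iterCov G T j) u :=
      ((contDiffOn_iterCov hU hG hT j).contDiffAt (hU.mem_nhds hu)).differentiableAt (by simp)
    change covDeriv G (iterCov G (c • T) j) u = _
    rw [covDeriv_congr hU ih hu]
    ext v
    change _ = c * covDeriv G (iterCov G T j) u v
    simp only [covDeriv_apply, fderiv_const_smul hd, Pi.smul_apply,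
      smul_apply, smul_eq_mul,
      ← Finset.mul_sum]
    ring

end Local

section Manifold
open Bundle
variable {E : Type*} [NormedAddCommGroup E] [NormedSpace ℝ E] {H : Type*} [TopologicalSpace H]
  (I : ModelWithCorners ℝ E H) {M : Type*} [TopologicalSpace M] [ChartedSpace H M]

/-- (Not necessarily continuous) 1-forms. -/
abbrev OneForm (M : Type*) [TopologicalSpace M] [ChartedSpace H M] := (x : M) → TangentSpace I x →L[ℝ] ℝ
/-- Fields of bilinear forms on the tangent spaces. -/
abbrev BilinField (M : Type*) [TopologicalSpace M] [ChartedSpace H M] := (x : M) → TangentSpace I x →L[ℝ] TangentSpace I x →L[ℝ] ℝ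

/-- The derivative at `u` of the inverse of the chart at `x₀`. -/
def chartFrame (x₀ : M) (u : E) : E →L[ℝ] TangentSpace I ((extChartAt I x₀).symm u) :=
  mfderiv 𝓘(ℝ, E) I (extChartAt I x₀).symm u

/-- The function `f` in the chart at `x₀`. -/
def chartFun (f : M → ℝ) (x₀ : M) (u : E) : ℝ := f ((extChartAt I x₀).symm u)

variable {I}
/-- The 1-form `α` in the chart at `x₀`. -/
def chartForm (α : OneForm I M) (x₀ : M) (u : E) : E →L[ℝ] ℝ :=
  (α ((extChartAt I x₀).symm u)).comp (chartFrame I x₀ u)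

/-- The bilinear form field `h` in the chart at `x₀`. -/
def chartBilin (h : BilinField I M) (x₀ : M) (u : E) : E →L[ℝ] E →L[ℝ] ℝ :=
  (ContinuousLinearMap.precomp ℝ (chartFrame I x₀ u)).comp
    ((h ((extChartAt I x₀).symm u)).comp (chartFrame I x₀ u))

theorem chartBilin_apply (h : BilinField I M) (x₀ : M) (u v w : E) :
    chartBilin h x₀ u v w =
      h ((extChartAt I x₀).symm u) (chartFrame I x₀ u v) (chartFrame I x₀ u w) := rfl

/-- `α` is a smooth section of the cotangent bundle. -/
def IsSmoothForm [IsManifold I 1 M] (α : OneForm I M) : Prop :=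
  ContMDiff I (I.prod 𝓘(ℝ, E →L[ℝ] ℝ)) ∞
    (fun x => TotalSpace.mk' (E →L[ℝ] ℝ) (E := fun x : M => TangentSpace I x →L[ℝ] ℝ) x (α x))

variable [IsManifold I ∞ M] [I.Boundaryless]

theorem contMDiffOn_chartFrame (x₀ : M) (v : E) :
    ContMDiffOn 𝓘(ℝ, E) I.tangent ∞ (fun u => TotalSpace.mk' E (E := fun x : M => TangentSpace I x)
      ((extChartAt I x₀).symm u) (chartFrame I x₀ u v)) (extChartAt I x₀).target := by
  have h := (contMDiffOn_extChartAt_symm (I := I) (n := ∞) x₀)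
  have h1 := h.contMDiffOn_tangentMapWithin (m := ∞) (by simp)
    (isOpen_extChartAt_target x₀).uniqueMDiffOn
  have h2 : ContMDiffOn 𝓘(ℝ, E) 𝓘(ℝ, E).tangent ∞ (fun u : E => (⟨u, v⟩ : TangentBundle 𝓘(ℝ, E) E))
    (extChartAt I x₀).target := by
    exact contMDiffOn_vectorSpace_iff_contDiffOn.2 contDiffOn_const
  refine (h1.comp h2 (fun u hu => hu)).congr fun u hu => ?_
  simp only [tangentMapWithin, Function.comp, chartFrame]
  rw [mfderivWithin_of_isOpen (isOpen_extChartAt_target x₀) hu]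
  rfl

theorem contDiffOn_chartForm [FiniteDimensional ℝ E] {α : OneForm I M} (hα : IsSmoothForm α) (x₀ : M) :
    ContDiffOn ℝ ∞ (chartForm α x₀) (extChartAt I x₀).target := by
  rw [contDiffOn_clm_apply]
  intro v
  rw [← contMDiffOn_iff_contDiffOn]
  have h := contMDiffOn_extChartAt_symm (I := I) (n := ∞) x₀
  have h1 := (ContMDiff.comp_contMDiffOn hα h)
  have h2 := ContMDiffOn.clm_bundle_apply (F₁ := E) (F₂ := ℝ) (E₁ := fun x : M => TangentSpace I x)
    (E₂ := Bundle.Trivial M ℝ) h1 (contMDiffOn_chartFrame x₀ v)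
  intro u hu
  have := h2 u hu
  rw [contMDiffWithinAt_totalSpace] at this
  exact this.2

theorem contDiffOn_chartBilin [FiniteDimensional ℝ E]
    (g : ContMDiffRiemannianMetric I ∞ E (fun x : M => TangentSpace I x)) (x₀ : M) :
    ContDiffOn ℝ ∞ (chartBilin g.inner x₀) (extChartAt I x₀).target := by
  rw [contDiffOn_clm_apply]
  intro v
  rw [contDiffOn_clm_apply]
  intro w
  rw [← contMDiffOn_iff_contDiffOn]
  have h := contMDiffOn_extChartAt_symm (I := I) (n := ∞) x₀
  have h1 := (ContMDiff.comp_contMDiffOn g.contMDiff h)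
  have h2 := ContMDiffOn.clm_bundle_apply₂ (F₁ := E) (F₂ := E) (F₃ := ℝ)
    (E₁ := fun x : M => TangentSpace I x) (E₂ := fun x : M => TangentSpace I x)
    (E₃ := Bundle.Trivial M ℝ) h1 (contMDiffOn_chartFrame x₀ v) (contMDiffOn_chartFrame x₀ w)
  intro u hu
  have := h2 u hu
  rw [contMDiffWithinAt_totalSpace] at this
  exact this.2

theorem chartFrame_injective (x₀ : M) {u : E} (hu : u ∈ (extChartAt I x₀).target) :
    Function.Injective (chartFrame I x₀ u) := by
  have h := isInvertible_mfderivWithin_extChartAt_symm (I := I) (x := x₀) hu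
  rw [I.range_eq_univ, mfderivWithin_univ] at h
  obtain ⟨e, he⟩ := h
  intro a b hab
  apply e.injective
  have : ∀ c, e c = chartFrame I x₀ u c := fun c => by
    rw [chartFrame, ← he]; rfl
  exact (this a).trans (hab.trans (this b).symm)

theorem smoothNondeg_chartBilin [FiniteDimensional ℝ E]
    (g : ContMDiffRiemannianMetric I ∞ E (fun x : M => TangentSpace I x)) (x₀ : M) :
    SmoothNondeg (chartBilin g.inner x₀) (extChartAt I x₀).target where
  smooth := contDiffOn_chartBilin g x₀
  inv := by
    intro u hu
    have hinj : Function.Injective (chartBilin g.inner x₀ u).toLinearMap := by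
      rw [← LinearMap.ker_eq_bot, LinearMap.ker_eq_bot']
      intro v hv
      by_contra hne
      have h1 : chartFrame I x₀ u v ≠ 0 := fun h0 =>
        hne (chartFrame_injective x₀ hu (h0.trans (map_zero _).symm))
      have h2 := g.pos _ _ h1
      have h3 : chartBilin g.inner x₀ u v v = 0 := by
        change (chartBilin g.inner x₀ u).toLinearMap v v = 0
        rw [hv]; rfl
      rw [chartBilin_apply] at h3
      exact h2.ne' h3
    have hdim : Module.finrank ℝ E = Module.finrank ℝ (E →L[ℝ] ℝ) := by
      rw [← (LinearMap.toContinuousLinearMap (𝕜 := ℝ) (E := E) (F' := ℝ)).finrank_eq]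
      exact (Subspace.dual_finrank_eq (K := ℝ) (V := E)).symm
    let e := (LinearEquiv.ofInjectiveOfFinrankEq _ hinj hdim).toContinuousLinearEquiv
    exact ⟨e, by ext v w; rfl⟩

/-- A number as a covariant tensor of rank 0. -/
def tensor0 (c : ℝ) : E [×0]→L[ℝ] ℝ := (continuousMultilinearCurryFin0 ℝ E ℝ).symm c
/-- A covector as a covariant tensor of rank 1. -/
def tensor1 (a : E →L[ℝ] ℝ) : E [×1]→L[ℝ] ℝ := (continuousMultilinearCurryFin1 ℝ E ℝ).symm a
/-- A bilinear form as a covariant tensor of rank 2. -/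
def tensor2 (B : E →L[ℝ] E →L[ℝ] ℝ) : E [×2]→L[ℝ] ℝ :=
  ContinuousLinearMap.uncurryLeft
    (((continuousMultilinearCurryFin1 ℝ E ℝ).symm.toContinuousLinearEquiv :
      (E →L[ℝ] ℝ) →L[ℝ] (E [×1]→L[ℝ] ℝ)).comp B)

theorem tensor0_apply (c : ℝ) (v : Fin 0 → E) : tensor0 c v = c := rfl
theorem tensor1_apply (a : E →L[ℝ] ℝ) (v : Fin 1 → E) : tensor1 a v = a (v 0) := rfl
theorem tensor2_apply (B : E →L[ℝ] E →L[ℝ] ℝ) (v : Fin 2 → E) :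
    tensor2 B v = B (v 0) (v 1) := rfl

theorem contDiffOn_tensor0_chartFun (f : C^∞⟮I, M; ℝ⟯) (x₀ : M) :
    ContDiffOn ℝ ∞ (fun u => tensor0 (E := E) (chartFun I f x₀ u)) (extChartAt I x₀).target := by
  have h : ContDiffOn ℝ ∞ (chartFun I f x₀) (extChartAt I x₀).target := by
    rw [← contMDiffOn_iff_contDiffOn]
    exact f.contMDiff.comp_contMDiffOn (contMDiffOn_extChartAt_symm x₀)
  exact (continuousMultilinearCurryFin0 ℝ E ℝ).symm.contDiff.comp_contDiffOn h

theorem contDiffOn_tensor1_chartForm [FiniteDimensional ℝ E] {α : OneForm I M}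
    (hα : IsSmoothForm α) (x₀ : M) :
    ContDiffOn ℝ ∞ (fun u => tensor1 (chartForm α x₀ u)) (extChartAt I x₀).target :=
  (continuousMultilinearCurryFin1 ℝ E ℝ).symm.contDiff.comp_contDiffOn (contDiffOn_chartForm hα x₀)

/-- `|∇ʲT|_g ≤ C` at the point `x`, where the tensor field is given by its representation `T` in the
chart at `x`; `∇` and the norm are those of `g`. -/
def CovBound (g : BilinField I M) (x : M) {k : ℕ} (T : E → E [×k]→L[ℝ] ℝ) (j : ℕ) (C : ℝ) :
    Prop :=
  NormLE (chartBilin g x (extChartAt I x x)) (iterCov (chartBilin g x) T j (extChartAt I x x)) C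

theorem CovBound.add [FiniteDimensional ℝ E]
    {g : ContMDiffRiemannianMetric I ∞ E (fun x : M => TangentSpace I x)} {x : M} {k : ℕ}
    {T S : E → E [×k]→L[ℝ] ℝ} (hT : ContDiffOn ℝ ∞ T (extChartAt I x).target)
    (hS : ContDiffOn ℝ ∞ S (extChartAt I x).target) {j : ℕ} {C D : ℝ}
    (h1 : CovBound g.inner x T j C) (h2 : CovBound g.inner x S j D) :
    CovBound g.inner x (T + S) j (C + D) := by
  intro v
  have := FiniteDimensional.complete ℝ E
  rw [iterCov_add (isOpen_extChartAt_target x) (smoothNondeg_chartBilin g x) hT hS j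
    (mem_extChartAt_target x), add_mul]
  exact (abs_add_le _ _).trans (add_le_add (h1 v) (h2 v))

theorem CovBound.smul [FiniteDimensional ℝ E]
    {g : ContMDiffRiemannianMetric I ∞ E (fun x : M => TangentSpace I x)} {x : M} {k : ℕ}
    {T : E → E [×k]→L[ℝ] ℝ} (hT : ContDiffOn ℝ ∞ T (extChartAt I x).target) {j : ℕ} {C : ℝ}
    (h1 : CovBound g.inner x T j C) (c : ℝ) : CovBound g.inner x (c • T) j (|c| * C) := by
  intro v
  have := FiniteDimensional.complete ℝ E
  rw [iterCov_smul (isOpen_extChartAt_target x) (smoothNondeg_chartBilin g x) hT c j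
    (mem_extChartAt_target x)]
  change |c * _| ≤ _
  rw [abs_mul, mul_assoc]
  exact mul_le_mul_of_nonneg_left (h1 v) (abs_nonneg c)

theorem CovBound.zero [FiniteDimensional ℝ E]
    {g : ContMDiffRiemannianMetric I ∞ E (fun x : M => TangentSpace I x)} {x : M} {k : ℕ}
    (j : ℕ) : CovBound g.inner x (0 : E → E [×k]→L[ℝ] ℝ) j 0 := by
  intro v
  have := FiniteDimensional.complete ℝ E
  have h := iterCov_smul (isOpen_extChartAt_target x) (smoothNondeg_chartBilin g x)
    (T := (0 : E → E [×k]→L[ℝ] ℝ)) contDiffOn_const 0 j (mem_extChartAt_target x)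
  rw [smul_zero] at h
  rw [h]
  simp

variable (I M) in
/-- The space of smooth 1-forms. -/
def smoothForms : Submodule ℝ (OneForm I M) where
  carrier := {α | IsSmoothForm α}
  zero_mem' := contMDiff_zeroSection ℝ (fun x : M => TangentSpace I x →L[ℝ] ℝ)
  add_mem' ha hb := ContMDiff.add_section ha hb
  smul_mem' _ _ ha := ContMDiff.const_smul_section ha

/-- `dα = 0`, in every chart. -/
def IsClosedForm (α : OneForm I M) : Prop :=
  ∀ x₀ : M, ∀ u ∈ (extChartAt I x₀).target, ∀ v w : E,
    fderiv ℝ (chartForm α x₀) u v w = fderiv ℝ (chartForm α x₀) u w v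

variable (I M) in
/-- The space of smooth closed 1-forms. -/
def closedForms [FiniteDimensional ℝ E] : Submodule ℝ (OneForm I M) where
  carrier := {α | α ∈ smoothForms I M ∧ IsClosedForm α}
  zero_mem' := by
    refine ⟨zero_mem _, fun x₀ u _ v w => ?_⟩
    have : chartForm (0 : OneForm I M) x₀ = fun _ => 0 := rfl
    simp [this]
  add_mem' := by
    rintro a b ⟨ha, ha'⟩ ⟨hb, hb'⟩
    refine ⟨add_mem ha hb, fun x₀ u hu v w => ?_⟩
    have hd : ∀ {c : OneForm I M}, c ∈ smoothForms I M →
        DifferentiableAt ℝ (chartForm c x₀) u := fun hc =>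
      ((contDiffOn_chartForm hc x₀).contDiffAt
        ((isOpen_extChartAt_target x₀).mem_nhds hu)).differentiableAt (by simp)
    have : chartForm (a + b) x₀ = chartForm a x₀ + chartForm b x₀ := rfl
    rw [this, fderiv_add (hd ha) (hd hb)]
    simp only [add_apply, ha' x₀ u hu v w, hb' x₀ u hu v w]
  smul_mem' := by
    rintro c a ⟨ha, ha'⟩
    refine ⟨Submodule.smul_mem _ c ha, fun x₀ u hu v w => ?_⟩
    have hd : DifferentiableAt ℝ (chartForm a x₀) u :=
      ((contDiffOn_chartForm ha x₀).contDiffAt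
        ((isOpen_extChartAt_target x₀).mem_nhds hu)).differentiableAt (by simp)
    have : chartForm (c • a) x₀ = c • chartForm a x₀ := rfl
    rw [this, fderiv_const_smul hd]
    simp only [smul_apply, ha' x₀ u hu v w]

variable (I M) in
/-- The differential `f ↦ df` on smooth functions. -/
def extD : C^∞⟮I, M; ℝ⟯ →ₗ[ℝ] OneForm I M where
  toFun f x := mvfderiv I f x
  map_add' f h := by
    funext x
    exact mvfderiv_add (f.contMDiff.mdifferentiableAt (by simp))
      (h.contMDiff.mdifferentiableAt (by simp))
  map_smul' c f := by
    funext x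
    have h1 : MDifferentiableAt I 𝓘(ℝ, ℝ) (fun _ : M => c) x := mdifferentiableAt_const
    have h2 : MDifferentiableAt I 𝓘(ℝ, ℝ) f x := f.contMDiff.mdifferentiableAt (by simp)
    have h3 := mvfderiv_smul h1 h2
    rw [mvfderiv_const] at h3
    ext v
    have h4 := congrArg (fun a => a v) h3
    simp at h4
    exact h4

variable (I) in
/-- 1-forms that vanish eventually along the filter `F`. For `F = cocompact M` these are the forms
with compact support. -/
def vanishingForms (F : Filter M) : Submodule ℝ (OneForm I M) where
  carrier := {α | ∀ᶠ x in F, α x = 0}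
  zero_mem' := Filter.Eventually.of_forall fun _ => rfl
  add_mem' ha hb := by
    filter_upwards [ha, hb] with x h1 h2
    simp [h1, h2]
  smul_mem' c _ ha := by
    filter_upwards [ha] with x h1
    simp [h1]

variable (I) in
/-- Smooth functions that vanish eventually along the filter `F`. -/
def vanishingFunctions (F : Filter M) : Submodule ℝ C^∞⟮I, M; ℝ⟯ where
  carrier := {f | ∀ᶠ x in F, f x = 0}
  zero_mem' := Filter.Eventually.of_forall fun _ => rfl
  add_mem' ha hb := by
    filter_upwards [ha, hb] with x h1 h2
    simp [h1, h2]
  smul_mem' c _ ha := by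
    filter_upwards [ha] with x h1
    simp [h1]

variable [FiniteDimensional ℝ E]

variable (I M) in
/-- `H¹(M; ℝ)`: smooth closed 1-forms modulo `d(C^∞(M))`. -/
abbrev H1 : Type _ :=
  closedForms I M ⧸ (LinearMap.range (extD I M)).submoduleOf (closedForms I M)

variable (I) in
/-- Smooth closed 1-forms that vanish eventually along `F`. -/
def closedVanishing (F : Filter M) : Submodule ℝ (OneForm I M) :=
  closedForms I M ⊓ vanishingForms I F

variable (I) in
/-- First cohomology with supports: smooth closed 1-forms vanishing eventually along `F`, modulo
differentials of smooth functions vanishing eventually along `F`. For `F = cocompact M` this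
is `H¹_c(M; ℝ)`. -/
abbrev H1Supp (F : Filter M) : Type _ :=
  closedVanishing I F ⧸
    ((vanishingFunctions I F).map (extD I M)).submoduleOf (closedVanishing I F)

variable (I) in
/-- The natural map from cohomology with supports to cohomology. -/
def gamma (F : Filter M) : H1Supp I F →ₗ[ℝ] H1 I M :=
  Submodule.mapQ _ _ (Submodule.inclusion (inf_le_left : closedVanishing I F ≤ closedForms I M))
    (by
      rintro ⟨a, ha⟩ ⟨f, -, hf⟩
      exact ⟨f, hf⟩)

/-- `V` consists of smooth closed 1-forms and `α ↦ [α]` is an isomorphism from `V` onto the image of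
the cohomology with supports in `H¹(M; ℝ)`. -/
def Represents (V : Submodule ℝ (OneForm I M)) (F : Filter M) : Prop :=
  ∃ h : V ≤ closedForms I M,
    Function.Injective ((Submodule.mkQ _).comp (Submodule.inclusion h) : V →ₗ[ℝ] H1 I M) ∧
    LinearMap.range ((Submodule.mkQ _).comp (Submodule.inclusion h) : V →ₗ[ℝ] H1 I M) =
      LinearMap.range (gamma I F)

end Manifold

section Conifolds
open Bundle

variable {n : ℕ}

/-- Pull-back of a bilinear form field by a map. -/
def pullbackBilin {E E₁ H H₁ : Type*} [NormedAddCommGroup E] [NormedSpace ℝ E] [TopologicalSpace H]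
    [NormedAddCommGroup E₁] [NormedSpace ℝ E₁] [TopologicalSpace H₁] (I₁ : ModelWithCorners ℝ E₁ H₁)
    (I : ModelWithCorners ℝ E H) {N M : Type*} [TopologicalSpace N] [ChartedSpace H₁ N]
    [TopologicalSpace M] [ChartedSpace H M] (φ : N → M) (h : BilinField I M) : BilinField I₁ N :=
  fun p => (ContinuousLinearMap.precomp ℝ (mfderiv I₁ I φ p)).comp
    ((h (φ p)).comp (mfderiv I₁ I φ p))

/-- A smooth Riemannian metric on a manifold of dimension `n`. -/
abbrev Metric (n : ℕ) (M : Type*) [TopologicalSpace M] [ChartedSpace (EuclideanSpace ℝ (Fin n)) M]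
    [IsManifold (𝓡 n) ∞ M] :=
  ContMDiffRiemannianMetric (𝓡 n) ∞ (EuclideanSpace ℝ (Fin n)) (fun x : M => TangentSpace (𝓡 n) x)

/-- The conical metric `dr² + r² g'` over `Σ × (0, ∞)`, written on `Σ × ℝ` and only used for
`r > 0`. -/
def coneMetric {S : Type*} [TopologicalSpace S] [ChartedSpace (EuclideanSpace ℝ (Fin n)) S]
    [IsManifold (𝓡 n) ∞ S] (g' : Metric n S) : BilinField ((𝓡 n).prod 𝓘(ℝ, ℝ)) (S × ℝ) := fun p =>
  (mvfderiv ((𝓡 n).prod 𝓘(ℝ, ℝ)) (Prod.snd : S × ℝ → ℝ) p).smulRight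
      (mvfderiv ((𝓡 n).prod 𝓘(ℝ, ℝ)) (Prod.snd : S × ℝ → ℝ) p)
    + p.2 ^ 2 • pullbackBilin ((𝓡 n).prod 𝓘(ℝ, ℝ)) (𝓡 n) (Prod.fst : S × ℝ → S) g'.inner p

variable {s l : ℕ}

/-- The direction in which the radius `r` runs out along an end: `r → 0` on the `s` CS ends,
`r → ∞` on the `l` AC ends. -/
def endFilter : Fin s ⊕ Fin l → Filter ℝ
  | .inl _ => 𝓝[>] 0
  | .inr _ => Filter.atTop

/-- The radii of the points of an open end: `(0, b)` on CS ends, `(b, ∞)` on AC ends. -/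
def openRadii (b : ℝ) : Fin s ⊕ Fin l → Set ℝ
  | .inl _ => Ioo 0 b
  | .inr _ => Ioi b

/-- The radii of the points of a closed end: `(0, b]` on CS ends, `[b, ∞)` on AC ends. -/
def closedRadii (b : ℝ) : Fin s ⊕ Fin l → Set ℝ
  | .inl _ => Ioc 0 b
  | .inr _ => Ici b

/-- The structure of a CS/AC manifold with `s` CS ends and `l` AC ends and with links `Lk i` on the
Riemannian manifold `(L, g)`. -/
structure CSACStructure {L : Type*} [TopologicalSpace L]
    [ChartedSpace (EuclideanSpace ℝ (Fin (n + 1))) L] [IsManifold (𝓡 (n + 1)) ∞ L]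
    (g : Metric (n + 1) L)
    (Lk : Fin s ⊕ Fin l → Type*) [∀ i, TopologicalSpace (Lk i)]
    [∀ i, ChartedSpace (EuclideanSpace ℝ (Fin n)) (Lk i)] [∀ i, IsManifold (𝓡 n) ∞ (Lk i)] where
  /-- the metric on the link -/
  linkMetric : ∀ i, Metric n (Lk i)
  /-- the radius at which the end begins -/
  b : Fin s ⊕ Fin l → ℝ
  b_pos : ∀ i, 0 < b i
  /-- the convergence rate -/
  rate : Fin s ⊕ Fin l → ℝ
  rate_pos : ∀ i : Fin s, 0 < rate (.inl i)
  rate_neg : ∀ i : Fin l, rate (.inr i) < 0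
  /-- the diffeomorphism from `Σᵢ × (0, b]`, respectively `Σᵢ × [b, ∞)`, onto the closed end -/
  φ : ∀ i, Lk i × ℝ → L
  /-- its inverse -/
  ψ : ∀ i, L → Lk i × ℝ
  smooth_φ : ∀ i, ContMDiffOn ((𝓡 n).prod 𝓘(ℝ, ℝ)) (𝓡 (n + 1)) ∞ (φ i)
    (univ ×ˢ closedRadii (b i) i)
  smooth_ψ : ∀ i, ContMDiffOn (𝓡 (n + 1)) ((𝓡 n).prod 𝓘(ℝ, ℝ)) ∞ (ψ i)
    (φ i '' (univ ×ˢ closedRadii (b i) i))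
  left_inv : ∀ i, LeftInvOn (ψ i) (φ i) (univ ×ˢ closedRadii (b i) i)
  closure_end : ∀ i,
    closure (φ i '' (univ ×ˢ openRadii (b i) i)) = φ i '' (univ ×ˢ closedRadii (b i) i)
  disjoint_ends : Pairwise fun i j =>
    Disjoint (φ i '' (univ ×ˢ openRadii (b i) i)) (φ j '' (univ ×ˢ openRadii (b j) j))
  compact_core : IsCompact (⋃ i, φ i '' (univ ×ˢ openRadii (b i) i))ᶜ
  /-- `|∇̃ᵏ(φ*g - g̃)|_g̃ = O(r^(νᵢ - k))` along the end, for all `k` -/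
  asymptotic : ∀ i, ∀ k : ℕ, ∃ C : ℝ, ∀ᶠ r in endFilter i, ∀ θ : Lk i,
    CovBound (coneMetric (linkMetric i)) (θ, r)
      (fun u => tensor2 (chartBilin
        (pullbackBilin ((𝓡 n).prod 𝓘(ℝ, ℝ)) (𝓡 (n + 1)) (φ i) g.inner
          - coneMetric (linkMetric i)) (θ, r) u))
      k (C * r ^ (rate i - k))

namespace CSACStructure

variable {L : Type*} [TopologicalSpace L]
    [ChartedSpace (EuclideanSpace ℝ (Fin (n + 1))) L] [IsManifold (𝓡 (n + 1)) ∞ L]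
    {g : Metric (n + 1) L}
    {Lk : Fin s ⊕ Fin l → Type*} [∀ i, TopologicalSpace (Lk i)]
    [∀ i, ChartedSpace (EuclideanSpace ℝ (Fin n)) (Lk i)] [∀ i, IsManifold (𝓡 n) ∞ (Lk i)]
    (X : CSACStructure g Lk)

/-- The (open) end `Sᵢ`. -/
def endSet (i : Fin s ⊕ Fin l) : Set L := X.φ i '' (univ ×ˢ openRadii (X.b i) i)

/-- The weighted space `C^∞_β(L)`: smooth functions with `|∇ʲf| = O(r^(βᵢ - j))` along each end, for
all `j`. -/
def weightedFunctions (β : Fin s ⊕ Fin l → ℝ) : Submodule ℝ C^∞⟮𝓡 (n + 1), L; ℝ⟯ where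
  carrier := {f | ∀ i, ∀ j : ℕ, ∃ C : ℝ, ∀ᶠ r in endFilter i, ∀ θ : Lk i,
    CovBound g.inner (X.φ i (θ, r))
      (fun u => tensor0 (chartFun (𝓡 (n + 1)) f (X.φ i (θ, r)) u)) j (C * r ^ (β i - j))}
  zero_mem' i j := ⟨0, Filter.Eventually.of_forall fun r θ => by
    rw [zero_mul]
    exact CovBound.zero (g := g) (k := 0) j⟩
  add_mem' {a c} ha hc i j := by
    obtain ⟨C, hC⟩ := ha i j
    obtain ⟨D, hD⟩ := hc i j
    refine ⟨C + D, ?_⟩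
    filter_upwards [hC, hD] with r h1 h2 θ
    rw [add_mul]
    exact (h1 θ).add (contDiffOn_tensor0_chartFun a _) (contDiffOn_tensor0_chartFun c _) (h2 θ)
  smul_mem' c a ha i j := by
    obtain ⟨C, hC⟩ := ha i j
    refine ⟨|c| * C, ?_⟩
    filter_upwards [hC] with r h1 θ
    rw [mul_assoc]
    exact (h1 θ).smul (contDiffOn_tensor0_chartFun a _) c

/-- The weighted space `C^∞_β(Λ¹)`: smooth 1-forms with `|∇ʲα| = O(r^(βᵢ - j))` along each end, for
all `j`. -/
def weightedForms (β : Fin s ⊕ Fin l → ℝ) : Submodule ℝ (OneForm (𝓡 (n + 1)) L) where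
  carrier := {α | α ∈ smoothForms (𝓡 (n + 1)) L ∧
    ∀ i, ∀ j : ℕ, ∃ C : ℝ, ∀ᶠ r in endFilter i, ∀ θ : Lk i,
      CovBound g.inner (X.φ i (θ, r))
        (fun u => tensor1 (chartForm α (X.φ i (θ, r)) u)) j (C * r ^ (β i - j))}
  zero_mem' := ⟨zero_mem _, fun i j => ⟨0, Filter.Eventually.of_forall fun r θ => by
    rw [zero_mul]
    exact CovBound.zero (g := g) (k := 1) j⟩⟩
  add_mem' := by
    rintro a c ⟨ha', ha⟩ ⟨hc', hc⟩
    refine ⟨add_mem ha' hc', fun i j => ?_⟩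
    obtain ⟨C, hC⟩ := ha i j
    obtain ⟨D, hD⟩ := hc i j
    refine ⟨C + D, ?_⟩
    filter_upwards [hC, hD] with r h1 h2 θ
    rw [add_mul]
    exact (h1 θ).add (contDiffOn_tensor1_chartForm ha' _) (contDiffOn_tensor1_chartForm hc' _)
      (h2 θ)
  smul_mem' := by
    rintro c a ⟨ha', ha⟩
    refine ⟨Submodule.smul_mem _ c ha', fun i j => ?_⟩
    obtain ⟨C, hC⟩ := ha i j
    refine ⟨|c| * C, ?_⟩
    filter_upwards [hC] with r h1 θ
    rw [mul_assoc]
    exact (h1 θ).smul (contDiffOn_tensor1_chartForm ha' _) c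

/-- The filter of neighbourhoods in `L` of the set of singular points: the sets that contain all
points of all CS ends whose radius is small enough. -/
def nearSingularities : Filter L :=
  ⨆ i : Fin s, Filter.map (X.φ (.inl i)) (⊤ ×ˢ 𝓝[>] 0)

/-- Outside a compact subset of `L`, `α` is on each end the pull-back `π*η` of a smooth 1-form `η` on
the link. -/
def TranslationInvariant (α : OneForm (𝓡 (n + 1)) L) : Prop :=
  ∀ i, ∃ η ∈ smoothForms (𝓡 n) (Lk i), ∀ᶠ r in endFilter i, ∀ θ : Lk i,
    (α (X.φ i (θ, r))).comp (mfderiv ((𝓡 n).prod 𝓘(ℝ, ℝ)) (𝓡 (n + 1)) (X.φ i) (θ, r)) =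
      (η θ).comp (mfderiv ((𝓡 n).prod 𝓘(ℝ, ℝ)) (𝓡 n) (Prod.fst : Lk i × ℝ → Lk i) (θ, r))

/-- `f` is identically 1 on the end `Sᵢ` and identically 0 on the other ends. -/
def IsEndFunction (i : Fin s ⊕ Fin l) (f : C^∞⟮𝓡 (n + 1), L; ℝ⟯) : Prop :=
  (∀ x ∈ X.endSet i, f x = 1) ∧ ∀ k, k ≠ i → ∀ x ∈ X.endSet k, f x = 0

end CSACStructure

/-- `W` is the internal direct sum of the subspaces `A i`. -/
def IsInternalSum {ι V : Type*} [AddCommGroup V] [Module ℝ V] (W : Submodule ℝ V)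
    (A : ι → Submodule ℝ V) : Prop :=
  iSupIndep A ∧ ⨆ i, A i = W

end Conifolds
end Conifold
end
open Conifold

/-! Existence of the decomposition. Let `α` be closed with `|α| = O(r^(β - 1))` along an end where
`r^β → 0`. Integrating along the rays, starting from the tip or from infinity, gives a primitive of
size `O(r^β)`: the radial derivative is `O(r^(β - 1))`, so each ray has a limit, and the oscillation
over the link is `O(r · r^(β - 1))`, so neighbouring rays have the same limit
(`exists_prim_end_of_decay`). Cutting these primitives off and adding them gives a global `G` such
that `α - dG` vanishes far along the ends in question. Hence `α - dG = v + dh` with `v` in the space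
of representatives. There `dh = 0`, so `h` is a constant on each of these ends because links are
connected, and subtracting the combination `e` of the `f_i` with these constants leaves `w = h - e +
G`, which equals `G` near the end. The derivatives of `w` need no estimate of their own: `dw = α - v
- de`, and all three terms have the required weight (`mem_weightedFunctions_iff`). On AC ends with
positive weight no normalisation is needed, since integrating `dw` outwards from a fixed slice gives
`w = O(r^λ)` (`bound_of_formBound`).

Independence. An exact representative is zero. If `e + w` has zero differential it is constant, as
`L` is connected; `w` tends to zero along every end in the decaying case, so `e` has the same
coefficient on all ends and is a multiple of `∑ f_i = 1`.

In the growing case the representatives must themselves lie in the weighted space: a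
translation-invariant form satisfies `|∇ʲα| = O(r^(-1 - j))` (`formWeight_of_invariant`). Measure
the radius in units of `t` and multiply the metric by `t⁻²`. In these coordinates the form does not
depend on `t`, while the metric has bounded jets and is uniformly coercive because it is asymptotic
to a cone, so all covariant derivatives are bounded at radius 1. Undoing the scaling of a tensor of
rank `1 + j` gives the factor `t^(-1 - j)`, and compactness of the link makes the bound uniform.

Finite-dimensionality follows from that of `H¹`. A compact core is covered by finitely many small
sets on which closed forms are exact; the class of a form is determined by the constants by which
the local primitives differ, and a form exact near the core is exact because primitives extend
outwards along the ends (`exact_of_exact_core`). -/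

noncomputable section
namespace Conifold

/-! ### Naturality of the Levi-Civita derivative under conformal pull-back with constant factor -/

section Naturality
variable {E E' : Type*} [NormedAddCommGroup E] [NormedSpace ℝ E] [NormedAddCommGroup E']
  [NormedSpace ℝ E']

/-- `Φ` maps `U` to `U'`, and the pull-back of the symmetric form field `G'` by `Φ` is `c • G`. -/
structure ConformalPullback (G : E → E →L[ℝ] E →L[ℝ] ℝ) (U : Set E)
    (G' : E' → E' →L[ℝ] E' →L[ℝ] ℝ) (U' : Set E') (Φ : E → E') (c : ℝ) : Prop where
  isOpen : IsOpen U
  isOpen' : IsOpen U'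
  smooth : ContDiffOn ℝ ∞ Φ U
  mapsTo : MapsTo Φ U U'
  surj : ∀ u ∈ U, Function.Surjective (fderiv ℝ Φ u)
  nondeg : SmoothNondeg G U
  nondeg' : SmoothNondeg G' U'
  symm' : ∀ u ∈ U', ∀ v w, G' u v w = G' u w v
  eq : ∀ u ∈ U, ∀ v w, G' (Φ u) (fderiv ℝ Φ u v) (fderiv ℝ Φ u w) = c * G u v w

namespace ConformalPullback
variable {G : E → E →L[ℝ] E →L[ℝ] ℝ} {U : Set E} {G' : E' → E' →L[ℝ] E' →L[ℝ] ℝ} {U' : Set E'}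
  {Φ : E → E'} {c : ℝ}

theorem hasFDerivAt (h : ConformalPullback G U G' U' Φ c) {u : E} (hu : u ∈ U) :
    HasFDerivAt Φ (fderiv ℝ Φ u) u :=
  ((h.smooth.contDiffAt (h.isOpen.mem_nhds hu)).differentiableAt (by simp)).hasFDerivAt

theorem hasFDerivAt_fderiv (h : ConformalPullback G U G' U' Φ c) {u : E} (hu : u ∈ U) :
    HasFDerivAt (fderiv ℝ Φ) (fderiv ℝ (fderiv ℝ Φ) u) u :=
  (((h.smooth.fderiv_of_isOpen h.isOpen (m := ∞) (by simp)).contDiffAt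
    (h.isOpen.mem_nhds hu)).differentiableAt (by simp)).hasFDerivAt

theorem second_symm (h : ConformalPullback G U G' U' Φ c) {u : E} (hu : u ∈ U) (v w : E) :
    fderiv ℝ (fderiv ℝ Φ) u v w = fderiv ℝ (fderiv ℝ Φ) u w v :=
  ((h.smooth.contDiffAt (h.isOpen.mem_nhds hu)).isSymmSndFDerivAt
    (by simpa using ENat.LEInfty.out)).eq v w

/-- The product rule applied to the identity `eq`, differentiated in the direction `z` with `v` and
`w` fixed. -/
theorem fderiv_eq (h : ConformalPullback G U G' U' Φ c) {u : E} (hu : u ∈ U) (z v w : E) :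
    c * fderiv ℝ G u z v w =
      fderiv ℝ G' (Φ u) (fderiv ℝ Φ u z) (fderiv ℝ Φ u v) (fderiv ℝ Φ u w)
      + G' (Φ u) (fderiv ℝ (fderiv ℝ Φ) u z v) (fderiv ℝ Φ u w)
      + G' (Φ u) (fderiv ℝ Φ u v) (fderiv ℝ (fderiv ℝ Φ) u z w) := by
  have hG : HasFDerivAt G (fderiv ℝ G u) u :=
    ((h.nondeg.smooth.contDiffAt (h.isOpen.mem_nhds hu)).differentiableAt (by simp)).hasFDerivAt
  have hG' : HasFDerivAt G' (fderiv ℝ G' (Φ u)) (Φ u) :=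
    ((h.nondeg'.smooth.contDiffAt
      (h.isOpen'.mem_nhds (h.mapsTo hu))).differentiableAt (by simp)).hasFDerivAt
  have h1 := ((hG'.comp u (h.hasFDerivAt hu)).clm_apply
    ((h.hasFDerivAt_fderiv hu).clm_apply (hasFDerivAt_const v u))).clm_apply
    ((h.hasFDerivAt_fderiv hu).clm_apply (hasFDerivAt_const w u))
  have h2 := ((hG.clm_apply (hasFDerivAt_const v u)).clm_apply
    (hasFDerivAt_const w u)).const_mul c
  have h3 := h1.congr_of_eventuallyEq (f₁ := fun y => c * G y v w) (by
    filter_upwards [h.isOpen.mem_nhds hu] with y hy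
    exact (h.eq y hy v w).symm)
  have h4 := congrArg (fun A => A z) (h2.unique h3)
  simp at h4
  rw [h4]
  ring

/-- Of the six terms containing second derivatives of `Φ`, four cancel in pairs by the symmetry of
`D²Φ` and of `G'`; the remaining two are equal. -/
theorem koszul_eq (h : ConformalPullback G U G' U' Φ c) {u : E} (hu : u ∈ U) (v w z : E) :
    c * koszul G u v w z =
      koszul G' (Φ u) (fderiv ℝ Φ u v) (fderiv ℝ Φ u w) (fderiv ℝ Φ u z)
      + G' (Φ u) (fderiv ℝ (fderiv ℝ Φ) u v w) (fderiv ℝ Φ u z) := by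
  rw [koszul_apply, koszul_apply]
  have h1 := h.fderiv_eq hu v w z
  have h2 := h.fderiv_eq hu w v z
  have h3 := h.fderiv_eq hu z v w
  rw [h.second_symm hu w v] at h2
  rw [h.second_symm hu z v, h.second_symm hu z w] at h3
  have h5 := h.symm' _ (h.mapsTo hu) (fderiv ℝ Φ u w) (fderiv ℝ (fderiv ℝ Φ) u v z)
  linear_combination (1 / 2) * (h1 + h2 - h3) + (1 / 2) * h5

/-- The classical transformation law. A constant conformal factor drops out, because it multiplies
the metric and its first derivatives alike. Testing against `dΦ z` suffices as `dΦ` is onto and `G'`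
is nondegenerate. -/
theorem christoffel_eq (h : ConformalPullback G U G' U' Φ c) {u : E} (hu : u ∈ U) (v w : E) :
    fderiv ℝ Φ u (christoffel G u v w) =
      christoffel G' (Φ u) (fderiv ℝ Φ u v) (fderiv ℝ Φ u w)
      + fderiv ℝ (fderiv ℝ Φ) u v w := by
  have hinj : Function.Injective (G' (Φ u)) := by
    obtain ⟨e, he⟩ := h.nondeg'.inv _ (h.mapsTo hu)
    rw [← he]; exact e.injective
  apply hinj
  ext z'
  obtain ⟨z, rfl⟩ := h.surj u hu z'
  rw [h.eq u hu, christoffel_spec G u (h.nondeg.inv u hu), map_add, add_apply,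
    christoffel_spec G' _ (h.nondeg'.inv _ (h.mapsTo hu)), h.koszul_eq hu]

/-- The terms in `D²Φ` that come from differentiating the arguments `dΦ vᵢ` cancel the inhomogeneous
terms in the transformation law of the Christoffel symbols. -/
theorem covDeriv_eq (h : ConformalPullback G U G' U' Φ c) {k : ℕ} {T : E → E [×k]→L[ℝ] ℝ}
    {T' : E' → E' [×k]→L[ℝ] ℝ} (hT' : ContDiffOn ℝ ∞ T' U')
    (hT : EqOn T (fun u => (T' (Φ u)).compContinuousLinearMap fun _ => fderiv ℝ Φ u) U) :
    EqOn (covDeriv G T)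
      (fun u => (covDeriv G' T' (Φ u)).compContinuousLinearMap fun _ => fderiv ℝ Φ u) U := by
  intro u hu
  have hT'' : HasFDerivAt T' (fderiv ℝ T' (Φ u)) (Φ u) :=
    ((hT'.contDiffAt
      (h.isOpen'.mem_nhds (h.mapsTo hu))).differentiableAt (by simp)).hasFDerivAt
  have h1 := (hT''.comp u (h.hasFDerivAt hu)).continuousMultilinearMapCompContinuousLinearMap
    (fun _ : Fin k => h.hasFDerivAt_fderiv hu)
  have h2 : fderiv ℝ T u = _ := (h1.congr_of_eventuallyEq
    (Filter.eventuallyEq_of_mem (h.isOpen.mem_nhds hu) hT)).fderiv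
  ext v
  rw [covDeriv_apply, h2, hT hu]
  simp only [ContinuousMultilinearMap.compContinuousLinearMap_apply, covDeriv_apply,
    ContinuousMultilinearMap.compContinuousLinearMapL_apply,
    ContinuousMultilinearMap.fderivCompContinuousLinearMap_apply, Function.comp_apply,
    add_apply, ContinuousLinearMap.comp_apply, ContinuousLinearMap.pi_apply]
  have h3 : ∀ i : Fin k, T' (Φ u) (fun j => fderiv ℝ Φ u
      (Function.update (Fin.tail v) i (christoffel G u (v 0) (Fin.tail v i)) j)) =
      T' (Φ u) (Function.update (fun j => fderiv ℝ Φ u (Fin.tail v j)) i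
        (christoffel G' (Φ u) (fderiv ℝ Φ u (v 0)) (fderiv ℝ Φ u (Fin.tail v i)))) +
      T' (Φ u) (Function.update (fun j => fderiv ℝ Φ u (Fin.tail v j)) i
        (fderiv ℝ (fderiv ℝ Φ) u (v 0) (Fin.tail v i))) := by
    intro i
    rw [← ContinuousMultilinearMap.map_update_add, ← h.christoffel_eq hu]
    congr 1
    funext j
    by_cases hj : j = i
    · subst hj; simp
    · simp [hj]
  simp only [h3, Finset.sum_add_distrib]
  have h4 : ∀ i : Fin k, T' (Φ u) (fun j => (Function.update (fun _ => fderiv ℝ Φ u) i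
      (fderiv ℝ (fderiv ℝ Φ) u (v 0)) j) (Fin.tail v j)) =
      T' (Φ u) (Function.update (fun j => fderiv ℝ Φ u (Fin.tail v j)) i
        (fderiv ℝ (fderiv ℝ Φ) u (v 0) (Fin.tail v i))) := by
    intro i
    congr 1
    funext j
    by_cases hj : j = i
    · subst hj; simp
    · simp [hj]
  simp only [h4]
  have h5 : (Fin.tail fun i => fderiv ℝ Φ u (v i)) = fun j => fderiv ℝ Φ u (Fin.tail v j) := rfl
  rw [h5]
  ring

theorem iterCov_eq [CompleteSpace E'] (h : ConformalPullback G U G' U' Φ c) {k : ℕ}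
    {T : E → E [×k]→L[ℝ] ℝ}
    {T' : E' → E' [×k]→L[ℝ] ℝ} (hT' : ContDiffOn ℝ ∞ T' U')
    (hT : EqOn T (fun u => (T' (Φ u)).compContinuousLinearMap fun _ => fderiv ℝ Φ u) U) (j : ℕ) :
    EqOn (iterCov G T j)
      (fun u => (iterCov G' T' j (Φ u)).compContinuousLinearMap fun _ => fderiv ℝ Φ u) U := by
  induction j with
  | zero => exact hT
  | succ j ih => exact h.covDeriv_eq (contDiffOn_iterCov h.isOpen' h.nondeg' hT' j) ih

/-- Invariance of the size of `∇ʲT`. -/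
theorem normLE_iff [CompleteSpace E'] (h : ConformalPullback G U G' U' Φ c) {k : ℕ}
    {T : E → E [×k]→L[ℝ] ℝ}
    {T' : E' → E' [×k]→L[ℝ] ℝ} (hT' : ContDiffOn ℝ ∞ T' U')
    (hT : EqOn T (fun u => (T' (Φ u)).compContinuousLinearMap fun _ => fderiv ℝ Φ u) U) (j : ℕ)
    {u : E} (hu : u ∈ U) (C : ℝ) :
    NormLE (G' (Φ u)) (iterCov G' T' j (Φ u)) C ↔ NormLE (c • G u) (iterCov G T j u) C := by
  have h1 : ∀ v : Fin (k + j) → E, iterCov G T j u v =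
      iterCov G' T' j (Φ u) (fun i => fderiv ℝ Φ u (v i)) := fun v => by
    rw [h.iterCov_eq hT' hT j hu]; rfl
  have h2 : ∀ v w, (c • G u) v w = G' (Φ u) (fderiv ℝ Φ u v) (fderiv ℝ Φ u w) := fun v w =>
    (h.eq u hu v w).symm
  constructor
  · intro H v
    rw [h1]
    simpa only [h2] using H fun i => fderiv ℝ Φ u (v i)
  · intro H v'
    choose v hv using fun i => h.surj u hu (v' i)
    have := H v
    simpa only [h1, h2, hv] using this

end ConformalPullback

/-- The tensors `∇ʲ(∇T)` and `∇ʲ⁺¹T` have ranks `k + 1 + j` and `k + (j + 1)`, which are equal but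
not definitionally so; heterogeneous equality carries the comparison through. -/
theorem covDeriv_heq (G : E → E →L[ℝ] E →L[ℝ] ℝ) {a b : ℕ} (hab : a = b) {T : E → E [×a]→L[ℝ] ℝ}
    {S : E → E [×b]→L[ℝ] ℝ} (h : HEq T S) : HEq (covDeriv G T) (covDeriv G S) := by
  subst hab
  cases h
  rfl

theorem iterCov_covDeriv_heq (G : E → E →L[ℝ] E →L[ℝ] ℝ) {k : ℕ} (T : E → E [×k]→L[ℝ] ℝ) (j : ℕ) :
    HEq (iterCov G (covDeriv G T) j) (iterCov G T (j + 1)) := by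
  induction j with
  | zero => rfl
  | succ j ih => exact covDeriv_heq G (by change k + 1 + j = k + (j + 1); omega) ih

theorem normLE_heq (B : E →L[ℝ] E →L[ℝ] ℝ) {a b : ℕ} (hab : a = b) {T : E → E [×a]→L[ℝ] ℝ}
    {S : E → E [×b]→L[ℝ] ℝ} (h : HEq T S) (u : E) (C : ℝ) :
    NormLE B (T u) C ↔ NormLE B (S u) C := by
  subst hab
  cases h
  rfl

theorem normLE_iterCov_covDeriv_iff (B : E →L[ℝ] E →L[ℝ] ℝ) (G : E → E →L[ℝ] E →L[ℝ] ℝ) {k : ℕ}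
    (T : E → E [×k]→L[ℝ] ℝ) (j : ℕ) (u : E) (C : ℝ) :
    NormLE B (iterCov G (covDeriv G T) j u) C ↔ NormLE B (iterCov G T (j + 1) u) C :=
  normLE_heq B (by omega) (iterCov_covDeriv_heq G T j) u C

theorem iterCov_eventuallyEq (G : E → E →L[ℝ] E →L[ℝ] ℝ) {k : ℕ} {T S : E → E [×k]→L[ℝ] ℝ} {u : E}
    (h : T =ᶠ[𝓝 u] S) (j : ℕ) : iterCov G T j =ᶠ[𝓝 u] iterCov G S j := by
  obtain ⟨V, hV, hVo, hu⟩ := eventually_nhds_iff.1 h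
  have : EqOn (iterCov G T j) (iterCov G S j) V := by
    induction j with
    | zero => exact hV
    | succ j ih => exact covDeriv_congr hVo ih
  exact Filter.eventuallyEq_of_mem (hVo.mem_nhds hu) this

end Naturality

/-! ### Uniform bounds on jets of families of functions -/

section Jets
variable {A E V W Z : Type*} [NormedAddCommGroup E] [NormedSpace ℝ E] [NormedAddCommGroup V]
  [NormedSpace ℝ V] [NormedAddCommGroup W] [NormedSpace ℝ W] [NormedAddCommGroup Z]
  [NormedSpace ℝ Z]

/-- The `N`-jets of the functions `F a`, smooth on `U a`, at the points `u a` are bounded,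
eventually in `a`. -/
structure JetsBdd (l : Filter A) (U : A → Set E) (u : A → E) (N : ℕ) (F : A → E → V) : Prop where
  isOpen : ∀ᶠ a in l, IsOpen (U a) ∧ u a ∈ U a
  smooth : ∀ᶠ a in l, ContDiffOn ℝ ∞ (F a) (U a)
  bdd : ∀ k ≤ N, ∃ C, ∀ᶠ a in l, ‖iteratedFDeriv ℝ k (F a) (u a)‖ ≤ C

namespace JetsBdd
variable {l : Filter A} {U : A → Set E} {u : A → E} {N : ℕ} {F : A → E → V} {F' : A → E → W}

theorem mono (h : JetsBdd l U u N F) {M : ℕ} (hM : M ≤ N) : JetsBdd l U u M F :=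
  ⟨h.isOpen, h.smooth, fun k hk => h.bdd k (hk.trans hM)⟩

theorem congr (h : JetsBdd l U u N F) {H : A → E → V} (hF : ∀ᶠ a in l, EqOn (H a) (F a) (U a)) :
    JetsBdd l U u N H where
  isOpen := h.isOpen
  smooth := by
    filter_upwards [h.smooth, hF] with a h1 h2 using h1.congr h2
  bdd k hk := by
    obtain ⟨C, hC⟩ := h.bdd k hk
    refine ⟨C, ?_⟩
    filter_upwards [hC, hF, h.isOpen] with a h1 h2 h3
    rwa [(Filter.eventuallyEq_of_mem (h3.1.mem_nhds h3.2) h2).iteratedFDeriv ℝ k |>.self_of_nhds]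

theorem bilin (B : V →L[ℝ] W →L[ℝ] Z) (h : JetsBdd l U u N F) (h' : JetsBdd l U u N F') :
    JetsBdd l U u N (fun a y => B (F a y) (F' a y)) where
  isOpen := h.isOpen
  smooth := by
    filter_upwards [h.smooth, h'.smooth] with a h1 h2
    exact B.isBoundedBilinearMap.contDiff.comp_contDiffOn (h1.prodMk h2)
  bdd k hk := by
    choose! C hC using h.bdd
    choose! C' hC' using h'.bdd
    refine ⟨‖B‖ * ∑ i ∈ Finset.range (k + 1), (k.choose i : ℝ) * C i * C' (k - i), ?_⟩
    have e1 : ∀ᶠ a in l, ∀ i ∈ Finset.range (k + 1),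
        ‖iteratedFDeriv ℝ i (F a) (u a)‖ ≤ C i ∧
          ‖iteratedFDeriv ℝ (k - i) (F' a) (u a)‖ ≤ C' (k - i) := by
      rw [Filter.eventually_all_finset]
      intro i hi
      have := Finset.mem_range.1 hi
      exact (hC i (by omega)).and (hC' (k - i) (by omega))
    filter_upwards [h.isOpen, h.smooth, h'.smooth, e1] with a h1 h2 h3 h4
    have h5 := B.norm_iteratedFDerivWithin_le_of_bilinear h2 h3 h1.1.uniqueDiffOn h1.2 (n := k)
      (by exact_mod_cast le_top)
    simp only [iteratedFDerivWithin_of_isOpen _ h1.1 h1.2] at h5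
    refine h5.trans (mul_le_mul_of_nonneg_left (Finset.sum_le_sum fun i hi => ?_) (norm_nonneg _))
    gcongr
    · exact mul_nonneg (Nat.cast_nonneg _) ((norm_nonneg _).trans (h4 i hi).1)
    · exact (h4 i hi).1
    · exact (h4 i hi).2

theorem fixed {H : E → V} {x : E} {O : Set E} (hO : IsOpen O) (hx : x ∈ O)
    (hH : ContDiffOn ℝ ∞ H O) (hu : Filter.Tendsto u l (𝓝 x))
    (hU : ∀ᶠ a in l, IsOpen (U a) ∧ u a ∈ U a) (hUO : ∀ᶠ a in l, U a ⊆ O) :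
    JetsBdd l U u N (fun _ => H) where
  isOpen := hU
  smooth := by filter_upwards [hUO] with a h using hH.mono h
  bdd k _ := by
    have h1 : ContinuousAt (iteratedFDeriv ℝ k H) x :=
      (hH.contDiffAt (hO.mem_nhds hx)).continuousAt_iteratedFDeriv (by exact_mod_cast le_top)
    exact (h1.tendsto.comp hu).norm.isBoundedUnder_le

theorem const (hU : ∀ᶠ a in l, IsOpen (U a) ∧ u a ∈ U a) (c : V) :
    JetsBdd l U u N (fun _ _ => c) where
  isOpen := hU
  smooth := .of_forall fun _ => contDiffOn_const
  bdd k _ := by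
    rcases k with _ | k
    · exact ⟨‖c‖, .of_forall fun a => by simp⟩
    · exact ⟨0, .of_forall fun a => by simp [iteratedFDeriv_const_of_ne]⟩

theorem clm (B : V →L[ℝ] W) (h : JetsBdd l U u N F) : JetsBdd l U u N (fun a y => B (F a y)) :=
  bilin (ContinuousLinearMap.id ℝ (V →L[ℝ] W)) (const h.isOpen B) h

theorem add {H : A → E → V} (h : JetsBdd l U u N F) (h' : JetsBdd l U u N H) :
    JetsBdd l U u N (fun a y => F a y + H a y) where
  isOpen := h.isOpen
  smooth := by filter_upwards [h.smooth, h'.smooth] with a h1 h2 using h1.add h2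
  bdd k hk := by
    obtain ⟨C, hC⟩ := h.bdd k hk
    obtain ⟨D, hD⟩ := h'.bdd k hk
    refine ⟨C + D, ?_⟩
    filter_upwards [hC, hD, h.smooth, h'.smooth, h.isOpen] with a h1 h2 h3 h4 h5
    have e1 := (h3.contDiffAt (h5.1.mem_nhds h5.2)).of_le (m := k) (by exact_mod_cast le_top)
    have e2 := (h4.contDiffAt (h5.1.mem_nhds h5.2)).of_le (m := k) (by exact_mod_cast le_top)
    have := iteratedFDeriv_add_apply e1 e2
    change ‖iteratedFDeriv ℝ k (F a + H a) (u a)‖ ≤ _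
    rw [this]
    exact (norm_add_le _ _).trans (add_le_add h1 h2)

theorem neg (h : JetsBdd l U u N F) : JetsBdd l U u N (fun a y => -F a y) :=
  h.clm (-ContinuousLinearMap.id ℝ V)

theorem sub {H : A → E → V} (h : JetsBdd l U u N F) (h' : JetsBdd l U u N H) :
    JetsBdd l U u N (fun a y => F a y - H a y) := by
  simpa only [sub_eq_add_neg] using h.add h'.neg

theorem fderiv (h : JetsBdd l U u (N + 1) F) : JetsBdd l U u N (fun a => fderiv ℝ (F a)) where
  isOpen := h.isOpen
  smooth := by
    filter_upwards [h.smooth, h.isOpen] with a h1 h2 using h1.fderiv_of_isOpen h2.1 (by simp)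
  bdd k hk := by
    obtain ⟨C, hC⟩ := h.bdd (k + 1) (by omega)
    refine ⟨C, ?_⟩
    filter_upwards [hC] with a h1
    rwa [norm_iteratedFDeriv_fderiv]

theorem of_fderiv (h0 : JetsBdd l U u 0 F) (h : JetsBdd l U u N (fun a => _root_.fderiv ℝ (F a))) :
    JetsBdd l U u (N + 1) F where
  isOpen := h.isOpen
  smooth := h0.smooth
  bdd k hk := by
    rcases k with _ | k
    · exact h0.bdd 0 le_rfl
    · obtain ⟨C, hC⟩ := h.bdd k (by omega)
      refine ⟨C, ?_⟩
      filter_upwards [hC] with a h1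
      rwa [norm_iteratedFDeriv_fderiv] at h1

theorem zero_of_bdd (hU : ∀ᶠ a in l, IsOpen (U a) ∧ u a ∈ U a)
    (hF : ∀ᶠ a in l, ContDiffOn ℝ ∞ (F a) (U a)) {C : ℝ} (hC : ∀ᶠ a in l, ‖F a (u a)‖ ≤ C) :
    JetsBdd l U u 0 F where
  isOpen := hU
  smooth := hF
  bdd k hk := by
    obtain rfl : k = 0 := by omega
    exact ⟨C, by simpa using hC⟩

/-- Induction on the order by `D(G⁻¹) = -G⁻¹ (DG) G⁻¹`: the right side involves `G⁻¹` only to one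
order less, so a bound on the norm of the inverse at the base points starts the induction. -/
theorem inverse {G : A → E → V →L[ℝ] W} (h : ∀ N, JetsBdd l U u N G) [CompleteSpace V]
    (hinv : ∀ᶠ a in l, ∀ y ∈ U a, (G a y).IsInvertible) {C : ℝ}
    (hC : ∀ᶠ a in l, ‖(G a (u a)).inverse‖ ≤ C) (N : ℕ) :
    JetsBdd l U u N (fun a y => (G a y).inverse) := by
  have hsm : ∀ᶠ a in l, ContDiffOn ℝ ∞ (fun y => (G a y).inverse) (U a) := by
    filter_upwards [hinv, (h 0).smooth] with a h1 h2 y hy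
    exact ((h1 y hy).contDiffAt_map_inverse).comp_contDiffWithinAt y (h2 y hy)
  have h0 := zero_of_bdd (h 0).isOpen hsm hC
  induction N with
  | zero => exact h0
  | succ N ih =>
    refine of_fderiv h0 ?_
    let P1 := ContinuousLinearMap.compL ℝ W V W
    let P2 := ContinuousLinearMap.compL ℝ W W V
    have e1 : JetsBdd l U u N (fun a y => (P1.flip (G a y).inverse).comp (_root_.fderiv ℝ (G a) y)) :=
      bilin (ContinuousLinearMap.compL ℝ E (V →L[ℝ] W) (W →L[ℝ] W)) (ih.clm P1.flip) (h (N + 1)).fderiv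
    have e2 : JetsBdd l U u N (fun a y => -((P2 (G a y).inverse).comp
        ((P1.flip (G a y).inverse).comp (_root_.fderiv ℝ (G a) y)))) :=
      (bilin (ContinuousLinearMap.compL ℝ E (W →L[ℝ] W) (W →L[ℝ] V)) (ih.clm P2) e1).neg
    refine e2.congr ?_
    filter_upwards [hinv, (h 0).smooth, hsm, (h 0).isOpen] with a h1 h2 h3 h4 y hy
    have d1 : HasFDerivAt (G a) (_root_.fderiv ℝ (G a) y) y :=
      ((h2.contDiffAt (h4.1.mem_nhds hy)).differentiableAt (by simp)).hasFDerivAt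
    have d2 : HasFDerivAt (fun y => (G a y).inverse)
        (_root_.fderiv ℝ (fun y => (G a y).inverse) y) y :=
      ((h3.contDiffAt (h4.1.mem_nhds hy)).differentiableAt (by simp)).hasFDerivAt
    have d3 := d2.clm_comp d1
    -- The formula for the derivative of the inverse comes from differentiating the constant `G⁻¹ G
    -- = id`.
    have d4 : HasFDerivAt (fun y => (G a y).inverse.comp (G a y)) (0 : E →L[ℝ] V →L[ℝ] V) y := by
      refine (hasFDerivAt_const (ContinuousLinearMap.id ℝ V) y).congr_of_eventuallyEq ?_
      filter_upwards [h4.1.mem_nhds hy] with z hz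
      obtain ⟨e, he⟩ := h1 z hz
      rw [← he]
      ext; simp
    have d5 := d3.unique d4
    ext v w
    obtain ⟨e, he⟩ := h1 y hy
    have d6 : (G a y).inverse (_root_.fderiv ℝ (G a) y v (e.symm w)) +
        _root_.fderiv ℝ (fun y => (G a y).inverse) y v (G a y (e.symm w)) = 0 :=
      congrArg (fun B => B v (e.symm w)) d5
    have d7 : G a y (e.symm w) = w := by rw [← he]; simp
    have d8 : (G a y).inverse w = e.symm w := by rw [← he]; simp
    change _ = -((G a y).inverse (_root_.fderiv ℝ (G a) y v ((G a y).inverse w)))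
    rw [d8]
    rw [d7] at d6
    exact eq_neg_of_add_eq_zero_right d6

section Tensor
variable {G : A → E → E →L[ℝ] E →L[ℝ] ℝ}

theorem koszul (h : ∀ N, JetsBdd l U u N G) (N : ℕ) :
    JetsBdd l U u N (fun a => koszul (G a)) := by
  have h1 := (h (N + 1)).fderiv
  have h2 := h1.clm
    ((ContinuousLinearMap.flipₗᵢ ℝ E E (E →L[ℝ] ℝ)).toContinuousLinearEquiv :
      (E →L[ℝ] E →L[ℝ] E →L[ℝ] ℝ) →L[ℝ] (E →L[ℝ] E →L[ℝ] E →L[ℝ] ℝ))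
  have h3 := h2.clm (ContinuousLinearMap.compL ℝ E (E →L[ℝ] E →L[ℝ] ℝ) (E →L[ℝ] E →L[ℝ] ℝ)
    (ContinuousLinearMap.flipₗᵢ ℝ E E ℝ : (E →L[ℝ] E →L[ℝ] ℝ) →L[ℝ] (E →L[ℝ] E →L[ℝ] ℝ)))
  exact (((h1.add h2).sub h3).clm ((1 / 2 : ℝ) • ContinuousLinearMap.id ℝ _)).congr
    (.of_forall fun a y _ => rfl)

theorem christoffel [CompleteSpace E] (h : ∀ N, JetsBdd l U u N G)
    (hinv : ∀ᶠ a in l, ∀ y ∈ U a, (G a y).IsInvertible) {C : ℝ}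
    (hC : ∀ᶠ a in l, ‖(G a (u a)).inverse‖ ≤ C) (N : ℕ) :
    JetsBdd l U u N (fun a => christoffel (G a)) :=
  bilin (ContinuousLinearMap.compL ℝ E (E →L[ℝ] E →L[ℝ] ℝ) (E →L[ℝ] E))
    ((inverse h hinv hC N).clm (ContinuousLinearMap.compL ℝ E (E →L[ℝ] ℝ) E)) (koszul h N)

theorem endAct_comp {k : ℕ} {T : A → E → E [×k]→L[ℝ] ℝ} {Γ : A → E → E →L[ℝ] E →L[ℝ] E}
    (hT : JetsBdd l U u N T) (hΓ : JetsBdd l U u N Γ) :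
    JetsBdd l U u N (fun a y => ((endAct E k).flip (T a y)).comp (Γ a y)) :=
  bilin (ContinuousLinearMap.compL ℝ E (E →L[ℝ] E) (E [×k]→L[ℝ] ℝ)) (hT.clm (endAct E k).flip) hΓ

theorem covDeriv {k : ℕ} {T : A → E → E [×k]→L[ℝ] ℝ} (hT : JetsBdd l U u (N + 1) T)
    (hΓ : JetsBdd l U u N (fun a => Conifold.christoffel (G a))) :
    JetsBdd l U u N (fun a => covDeriv (G a) (T a)) :=
  (hT.fderiv.sub (endAct_comp (hT.mono (Nat.le_succ N)) hΓ)).clm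
    ((continuousMultilinearCurryLeftEquiv ℝ (fun _ : Fin (k + 1) => E)
      ℝ).symm.toContinuousLinearEquiv : _ →L[ℝ] (E [×(k + 1)]→L[ℝ] ℝ))

theorem iterCov {k : ℕ} {T : A → E → E [×k]→L[ℝ] ℝ} (hT : ∀ N, JetsBdd l U u N T)
    (hΓ : ∀ N, JetsBdd l U u N (fun a => Conifold.christoffel (G a))) (j N : ℕ) :
    JetsBdd l U u N (fun a => iterCov (G a) (T a) j) := by
  induction j generalizing N with
  | zero => exact hT N
  | succ j ih => exact (ih (N + 1)).covDeriv (hΓ N)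

/-- Bounds on all covariant derivatives bound the jets. -/
theorem of_iterCov {k : ℕ} {T : A → E → E [×k]→L[ℝ] ℝ}
    (h : ∀ j, JetsBdd l U u 0 (fun a => Conifold.iterCov (G a) (T a) j))
    (hΓ : ∀ N, JetsBdd l U u N (fun a => Conifold.christoffel (G a))) (N : ℕ) :
    JetsBdd l U u N T := by
  -- Since `D(∇ʲT)` is `∇ʲ⁺¹T` plus a Christoffel term acting on `∇ʲT`, raising the jet order of
  -- `∇ʲT` by one uses the previous order for `j` and for `j + 1`. The induction therefore treats
  -- all `j` at once.
  suffices ∀ j, JetsBdd l U u N (fun a => Conifold.iterCov (G a) (T a) j) from this 0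
  induction N with
  | zero => exact h
  | succ N ih =>
    intro j
    refine of_fderiv (h j) ?_
    have h1 := (ih (j + 1)).clm
      ((continuousMultilinearCurryLeftEquiv ℝ (fun _ : Fin (k + j + 1) => E)
        ℝ).toContinuousLinearEquiv : (E [×(k + j + 1)]→L[ℝ] ℝ) →L[ℝ] (E →L[ℝ] (E [×(k + j)]→L[ℝ] ℝ)))
    refine (h1.add (endAct_comp (ih j) (hΓ N))).congr (.of_forall fun a y _ => ?_)
    change _ = (continuousMultilinearCurryLeftEquiv ℝ (fun _ : Fin (k + j + 1) => E) ℝ)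
      ((continuousMultilinearCurryLeftEquiv ℝ (fun _ : Fin (k + j + 1) => E) ℝ).symm _) + _
    rw [LinearIsometryEquiv.apply_symm_apply]
    exact (sub_add_cancel _ _).symm

end Tensor
end JetsBdd
end Jets

/-! ### Pull-backs and local primitives of closed 1-forms -/

section Primitives
variable {E : Type*} [NormedAddCommGroup E] [NormedSpace ℝ E] {H : Type*} [TopologicalSpace H]
  {I : ModelWithCorners ℝ E H} {M : Type*} [TopologicalSpace M] [ChartedSpace H M]

/-- `F` is smooth at `x` and `dF = α` at `x`. -/
def IsPrimAt (α : OneForm I M) (F : M → ℝ) (x : M) : Prop :=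
  ContMDiffAt I 𝓘(ℝ, ℝ) ∞ F x ∧ mvfderiv I F x = α x

theorem IsPrimAt.mdifferentiableAt {α : OneForm I M} {F : M → ℝ} {x : M} (h : IsPrimAt α F x) :
    MDifferentiableAt I 𝓘(ℝ, ℝ) F x :=
  h.1.mdifferentiableAt (by simp)

theorem IsPrimAt.congr {α : OneForm I M} {F G : M → ℝ} {x : M} (h : IsPrimAt α F x)
    (hG : G =ᶠ[𝓝 x] F) : IsPrimAt α G x := by
  refine ⟨h.1.congr_of_eventuallyEq hG, ?_⟩
  rw [← h.2]
  have h1 : (mfderiv I 𝓘(ℝ, ℝ) G x : E →L[ℝ] ℝ) = mfderiv I 𝓘(ℝ, ℝ) F x := hG.mfderiv_eq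
  exact h1

theorem IsPrimAt.add {α β : OneForm I M} {F G : M → ℝ} {x : M} (h : IsPrimAt α F x)
    (h' : IsPrimAt β G x) : IsPrimAt (α + β) (F + G) x :=
  ⟨h.1.add h'.1, by rw [mvfderiv_add h.mdifferentiableAt h'.mdifferentiableAt, h.2, h'.2]; rfl⟩

theorem IsPrimAt.sub {α β : OneForm I M} {F G : M → ℝ} {x : M} (h : IsPrimAt α F x)
    (h' : IsPrimAt β G x) : IsPrimAt (α - β) (F - G) x :=
  ⟨h.1.sub h'.1, by rw [mvfderiv_sub h.mdifferentiableAt h'.mdifferentiableAt, h.2, h'.2]; rfl⟩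

theorem isPrimAt_const (c : ℝ) (x : M) : IsPrimAt (0 : OneForm I M) (fun _ => c) x :=
  ⟨contMDiffAt_const, mvfderiv_const c⟩

theorem IsPrimAt.sub_const {α : OneForm I M} {F : M → ℝ} {x : M} (h : IsPrimAt α F x) (c : ℝ) :
    IsPrimAt α (fun y => F y - c) x := by
  have := h.sub (isPrimAt_const c x)
  rwa [sub_zero] at this

theorem isPrimAt_extD (f : C^∞⟮I, M; ℝ⟯) (x : M) : IsPrimAt (extD I M f) f x :=
  ⟨f.contMDiff.contMDiffAt, rfl⟩

/-- The pull-back of a 1-form by a map defined on a normed space. -/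
def pullForm {E₁ : Type*} [NormedAddCommGroup E₁] [NormedSpace ℝ E₁] (α : OneForm I M) (κ : E₁ → M)
    (p : E₁) : E₁ →L[ℝ] ℝ :=
  (α (κ p)).comp (mfderiv 𝓘(ℝ, E₁) I κ p)

/-- All tangent spaces are the same model space `E`, so a vector can be kept fixed while the base
point is replaced by an equal one; a direct rewrite would meet dependent types. -/
theorem oneForm_congr (α : OneForm I M) {x y : M} (h : x = y) (v : E) :
    (α x : E →L[ℝ] ℝ) v = (α y : E →L[ℝ] ℝ) v := by
  subst h; rfl

theorem bilinField_congr (g : BilinField I M) {x y : M} (h : x = y) (v w : E) :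
    (g x : E →L[ℝ] E →L[ℝ] ℝ) v w = (g y : E →L[ℝ] E →L[ℝ] ℝ) v w := by
  subst h; rfl

variable {E₁ : Type*} [NormedAddCommGroup E₁] [NormedSpace ℝ E₁]
variable [IsManifold I ∞ M] [I.Boundaryless]

theorem mfderiv_apply_eq_chartFrame {κ : E₁ → M} {q : E₁} {x₀ : M}
    (hκ : MDifferentiableAt 𝓘(ℝ, E₁) I κ q) (hq : κ q ∈ (extChartAt I x₀).source) (v : E₁) :
    (mfderiv 𝓘(ℝ, E₁) I κ q v : E) =
      (chartFrame I x₀ (extChartAt I x₀ (κ q)) (fderiv ℝ (fun y => extChartAt I x₀ (κ y)) q v) : E) := by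
  have h1 : MDifferentiableAt I 𝓘(ℝ, E) (extChartAt I x₀) (κ q) :=
    mdifferentiableAt_extChartAt (by simpa using hq)
  have h2 : MDifferentiableAt 𝓘(ℝ, E₁) 𝓘(ℝ, E) (fun y => extChartAt I x₀ (κ y)) q := h1.comp q hκ
  have h3 : MDifferentiableAt 𝓘(ℝ, E) I (extChartAt I x₀).symm (extChartAt I x₀ (κ q)) :=
    ((contMDiffOn_extChartAt_symm (I := I) (n := ∞) x₀).contMDiffAt
      ((isOpen_extChartAt_target x₀).mem_nhds
        ((extChartAt I x₀).map_source hq))).mdifferentiableAt (by simp)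
  have h4 : κ =ᶠ[𝓝 q] (extChartAt I x₀).symm ∘ fun y => extChartAt I x₀ (κ y) := by
    filter_upwards [hκ.continuousAt ((isOpen_extChartAt_source x₀).mem_nhds hq)] with y hy
    exact ((extChartAt I x₀).left_inv hy).symm
  have h5 : (mfderiv 𝓘(ℝ, E₁) I κ q : E₁ →L[ℝ] E) = _ := h4.mfderiv_eq
  have h6 := mfderiv_comp (I := 𝓘(ℝ, E₁)) (I' := 𝓘(ℝ, E)) (I'' := I) q h3 h2
  have h7 := congrArg (fun A : E₁ →L[ℝ] E => A v) (h5.trans h6)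
  rw [mfderiv_eq_fderiv] at h7
  exact h7

theorem pullForm_apply_eq {κ : E₁ → M} {q : E₁} {x₀ : M} (α : OneForm I M)
    (hκ : MDifferentiableAt 𝓘(ℝ, E₁) I κ q) (hq : κ q ∈ (extChartAt I x₀).source) :
    pullForm α κ q = (chartForm α x₀ (extChartAt I x₀ (κ q))).comp
      (fderiv ℝ (fun y => extChartAt I x₀ (κ y)) q) := by
  ext v
  have h := mfderiv_apply_eq_chartFrame hκ hq v
  change (α (κ q) : E →L[ℝ] ℝ) (mfderiv 𝓘(ℝ, E₁) I κ q v : E) = _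
  rw [h]
  exact oneForm_congr α ((extChartAt I x₀).left_inv hq).symm _

omit [I.Boundaryless] in
theorem contDiffAt_extChartAt_comp {κ : E₁ → M} {Ω : Set E₁} (hΩ : IsOpen Ω)
    (hκ : ContMDiffOn 𝓘(ℝ, E₁) I ∞ κ Ω) {p : E₁} (hp : p ∈ Ω) {x₀ : M}
    (hx : κ p ∈ (extChartAt I x₀).source) :
    ContDiffAt ℝ ∞ (fun y => extChartAt I x₀ (κ y)) p := by
  rw [← contMDiffAt_iff_contDiffAt]
  exact (contMDiffAt_extChartAt' (by simpa using hx)).comp p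
    (hκ.contMDiffAt (hΩ.mem_nhds hp))

variable [FiniteDimensional ℝ E]

theorem contDiffOn_pullForm {κ : E₁ → M} {Ω : Set E₁} (hΩ : IsOpen Ω)
    (hκ : ContMDiffOn 𝓘(ℝ, E₁) I ∞ κ Ω) {α : OneForm I M} (hα : α ∈ smoothForms I M) :
    ContDiffOn ℝ ∞ (pullForm α κ) Ω := by
  intro p hp
  have hs := mem_extChartAt_source (I := I) (κ p)
  have h1 := contDiffAt_extChartAt_comp hΩ hκ hp hs
  have h2 : ContDiffAt ℝ ∞ (chartForm α (κ p)) (extChartAt I (κ p) (κ p)) :=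
    (contDiffOn_chartForm hα (κ p)).contDiffAt (extChartAt_target_mem_nhds (κ p))
  have h3 := (h2.comp p h1).clm_comp (h1.fderiv_right (m := ∞) (by simp))
  refine (h3.congr_of_eventuallyEq ?_).contDiffWithinAt
  filter_upwards [hΩ.mem_nhds hp, (hκ.continuousOn.continuousAt (hΩ.mem_nhds hp))
    ((isOpen_extChartAt_source (I := I) (κ p)).mem_nhds hs)] with q hq hq'
  exact pullForm_apply_eq α ((hκ.contMDiffAt (hΩ.mem_nhds hq)).mdifferentiableAt (by simp)) hq'

/-- Pull-back preserves closedness: with `Φ` the map `κ` read in a chart, the derivative of the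
pulled-back form is the pull-back of the derivative plus a term in `D²Φ`, and both are symmetric. -/
theorem fderiv_pullForm_symm {κ : E₁ → M} {Ω : Set E₁} (hΩ : IsOpen Ω)
    (hκ : ContMDiffOn 𝓘(ℝ, E₁) I ∞ κ Ω) {α : OneForm I M} (hα : α ∈ closedForms I M) {p : E₁}
    (hp : p ∈ Ω) (v w : E₁) :
    fderiv ℝ (pullForm α κ) p v w = fderiv ℝ (pullForm α κ) p w v := by
  have hs := mem_extChartAt_source (I := I) (κ p)
  have h1 := contDiffAt_extChartAt_comp hΩ hκ hp hs
  have h2 : ContDiffAt ℝ ∞ (chartForm α (κ p)) (extChartAt I (κ p) (κ p)) :=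
    (contDiffOn_chartForm hα.1 (κ p)).contDiffAt (extChartAt_target_mem_nhds (κ p))
  set Φ : E₁ → E := fun y => extChartAt I (κ p) (κ y) with hΦ
  have h4 : HasFDerivAt (fun q => (chartForm α (κ p) (Φ q)).comp (fderiv ℝ Φ q)) _ p :=
    ((h2.differentiableAt (by simp)).hasFDerivAt.comp p
      (h1.differentiableAt (by simp)).hasFDerivAt).clm_comp
      ((h1.fderiv_right (m := ∞) (by simp)).differentiableAt (by simp)).hasFDerivAt
  have h5 : fderiv ℝ (pullForm α κ) p = _ := (h4.congr_of_eventuallyEq (by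
    filter_upwards [hΩ.mem_nhds hp, (hκ.continuousOn.continuousAt (hΩ.mem_nhds hp))
      ((isOpen_extChartAt_source (I := I) (κ p)).mem_nhds hs)] with q hq hq'
    exact pullForm_apply_eq α
      ((hκ.contMDiffAt (hΩ.mem_nhds hq)).mdifferentiableAt (by simp)) hq')).fderiv
  rw [h5]
  have h6 := hα.2 (κ p) _ (mem_extChartAt_target (κ p)) (fderiv ℝ Φ p v) (fderiv ℝ Φ p w)
  have h7 : fderiv ℝ (fderiv ℝ Φ) p v w = fderiv ℝ (fderiv ℝ Φ) p w v :=
    (h1.isSymmSndFDerivAt (by simpa using ENat.LEInfty.out)).eq v w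
  change chartForm α (κ p) (Φ p) (fderiv ℝ (fderiv ℝ Φ) p v w) +
      fderiv ℝ (chartForm α (κ p)) (Φ p) (fderiv ℝ Φ p v) (fderiv ℝ Φ p w) =
    chartForm α (κ p) (Φ p) (fderiv ℝ (fderiv ℝ Φ) p w v) +
      fderiv ℝ (chartForm α (κ p)) (Φ p) (fderiv ℝ Φ p w) (fderiv ℝ Φ p v)
  rw [h7, h6]

/-- The Poincaré lemma for pull-backs to convex open sets. -/
theorem exists_hasFDerivAt_pullForm {κ : E₁ → M} {Ω : Set E₁} (hΩ : IsOpen Ω) (hc : Convex ℝ Ω)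
    (hκ : ContMDiffOn 𝓘(ℝ, E₁) I ∞ κ Ω) {α : OneForm I M} (hα : α ∈ closedForms I M) :
    ∃ f : E₁ → ℝ, ContDiffOn ℝ ∞ f Ω ∧ ∀ p ∈ Ω, HasFDerivAt f (pullForm α κ p) p := by
  have hs := contDiffOn_pullForm hΩ hκ hα.1
  obtain ⟨f, hf⟩ := hc.exists_forall_hasFDerivAt_of_fderiv_symmetric hΩ
    (hs.differentiableOn (by simp)) (fun a ha => fderiv_pullForm_symm hΩ hκ hα ha)
  refine ⟨f, ?_, hf⟩
  rw [contDiffOn_infty_iff_fderiv_of_isOpen hΩ]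
  exact ⟨fun p hp => (hf p hp).differentiableAt.differentiableWithinAt,
    hs.congr fun p hp => (hf p hp).fderiv⟩

-- Transfers a primitive of `κ*α` back to the manifold: as `κ ∘ ι = id` on `W`, one has `d(f ∘ ι) =
-- ι*κ*α = α`.
omit [IsManifold I ∞ M] [I.Boundaryless] [FiniteDimensional ℝ E] in
theorem isPrimAt_comp {κ : E₁ → M} {Ω : Set E₁} (hΩ : IsOpen Ω)
    (hκ : ContMDiffOn 𝓘(ℝ, E₁) I ∞ κ Ω) {α : OneForm I M} {f : E₁ → ℝ} (hf : ContDiffOn ℝ ∞ f Ω)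
    (hd : ∀ p ∈ Ω, HasFDerivAt f (pullForm α κ p) p) {W : Set M} (hW : IsOpen W) {ι : M → E₁}
    (hι : ContMDiffOn I 𝓘(ℝ, E₁) ∞ ι W) (hmap : MapsTo ι W Ω) (hinv : ∀ x ∈ W, κ (ι x) = x) {x : M}
    (hx : x ∈ W) : IsPrimAt α (f ∘ ι) x := by
  have h1 : ContMDiffAt I 𝓘(ℝ, E₁) ∞ ι x := hι.contMDiffAt (hW.mem_nhds hx)
  have h2 : ContDiffAt ℝ ∞ f (ι x) := hf.contDiffAt (hΩ.mem_nhds (hmap hx))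
  have h3 : MDifferentiableAt 𝓘(ℝ, E₁) I κ (ι x) :=
    (hκ.contMDiffAt (hΩ.mem_nhds (hmap hx))).mdifferentiableAt (by simp)
  have h4 : MDifferentiableAt I 𝓘(ℝ, E₁) ι x := h1.mdifferentiableAt (by simp)
  refine ⟨h2.contMDiffAt.comp x h1, ?_⟩
  have h5 : mvfderiv I (f ∘ ι) x = (mvfderiv 𝓘(ℝ, E₁) f (ι x)).comp (mfderiv I 𝓘(ℝ, E₁) ι x) :=
    mvfderiv_comp x ((hd _ (hmap hx)).differentiableAt.mdifferentiableAt) h4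
  have h6 : mfderiv I I (κ ∘ ι) x = (mfderiv 𝓘(ℝ, E₁) I κ (ι x)).comp (mfderiv I 𝓘(ℝ, E₁) ι x) :=
    mfderiv_comp x h3 h4
  have h7 : (mfderiv I I (κ ∘ ι) x : E →L[ℝ] E) = mfderiv I I id x :=
    (Filter.eventuallyEq_of_mem (hW.mem_nhds hx) fun y hy => hinv y hy).mfderiv_eq
  rw [mfderiv_id] at h7
  rw [h5]
  ext v
  have h8 : (mvfderiv 𝓘(ℝ, E₁) f (ι x) : E₁ →L[ℝ] ℝ) = pullForm α κ (ι x) := by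
    rw [← (hd _ (hmap hx)).fderiv]
    exact mfderiv_eq_fderiv
  have h9 : (mfderiv 𝓘(ℝ, E₁) I κ (ι x) (mfderiv I 𝓘(ℝ, E₁) ι x v) : E) = v :=
    congrArg (fun A : E →L[ℝ] E => A v) (h6.symm.trans h7)
  change (mvfderiv 𝓘(ℝ, E₁) f (ι x) : E₁ →L[ℝ] ℝ) (mfderiv I 𝓘(ℝ, E₁) ι x v : E₁) = _
  rw [h8]
  change (α (κ (ι x)) : E →L[ℝ] ℝ) (mfderiv 𝓘(ℝ, E₁) I κ (ι x) (mfderiv I 𝓘(ℝ, E₁) ι x v) : E) = _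
  rw [h9]
  exact oneForm_congr α (hinv x hx) v

/-- Every point has arbitrarily small preconnected open neighbourhoods on which all closed 1-forms
are exact. -/
theorem exists_nhd_exact (x : M) {N : Set M} (hN : N ∈ 𝓝 x) :
    ∃ W ⊆ N, IsOpen W ∧ x ∈ W ∧ IsPreconnected W ∧
      ∀ α ∈ closedForms I M, ∃ F : M → ℝ, ∀ y ∈ W, IsPrimAt α F y := by
  have h1 : (extChartAt I x).target ∩ (extChartAt I x).symm ⁻¹' N ∈ 𝓝 (extChartAt I x x) := by
    refine Filter.inter_mem (extChartAt_target_mem_nhds x) ?_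
    refine (continuousAt_extChartAt_symm x).preimage_mem_nhds ?_
    rwa [extChartAt_to_inv]
  obtain ⟨r, hr, hsub⟩ := Metric.mem_nhds_iff.1 h1
  have hκ : ContMDiffOn 𝓘(ℝ, E) I ∞ (extChartAt I x).symm (Metric.ball (extChartAt I x x) r) :=
    (contMDiffOn_extChartAt_symm x).mono fun y hy => (hsub hy).1
  have hWo : IsOpen ((extChartAt I x).source ∩ extChartAt I x ⁻¹' Metric.ball (extChartAt I x x) r) :=
    isOpen_extChartAt_preimage' x Metric.isOpen_ball
  refine ⟨(extChartAt I x).source ∩ extChartAt I x ⁻¹' Metric.ball (extChartAt I x x) r,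
    ?_, hWo, ⟨mem_extChartAt_source x, Metric.mem_ball_self hr⟩, ?_, ?_⟩
  · rintro y ⟨hy1, hy2⟩
    have := (hsub hy2).2
    rwa [mem_preimage, (extChartAt I x).left_inv hy1] at this
  · have : (extChartAt I x).source ∩ extChartAt I x ⁻¹' Metric.ball (extChartAt I x x) r =
        (extChartAt I x).symm '' Metric.ball (extChartAt I x x) r := by
      rw [← (extChartAt I x).symm_image_eq_source_inter_preimage (fun y hy => (hsub hy).1)]
    rw [this]
    exact ((convex_ball _ _).isPreconnected).image _ hκ.continuousOn
  · intro α hα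
    obtain ⟨f, hf, hd⟩ := exists_hasFDerivAt_pullForm Metric.isOpen_ball (convex_ball _ _) hκ hα
    refine ⟨f ∘ extChartAt I x, fun y hy => ?_⟩
    exact isPrimAt_comp Metric.isOpen_ball hκ hf hd hWo
      ((contMDiffOn_extChartAt (x := x) (n := ∞)).mono fun y hy => by simpa using hy.1)
      (fun y hy => hy.2) (fun y hy => (extChartAt I x).left_inv hy.1) hy

omit [FiniteDimensional ℝ E] in
theorem eventuallyEq_of_isPrimAt_zero {F : M → ℝ} {x : M}
    (h : ∀ᶠ y in 𝓝 x, IsPrimAt (0 : OneForm I M) F y) : ∀ᶠ y in 𝓝 x, F y = F x := by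
  have h1 : ∀ᶠ u in 𝓝 (extChartAt I x x), u ∈ (extChartAt I x).target ∧
      IsPrimAt (0 : OneForm I M) F ((extChartAt I x).symm u) := by
    refine Filter.Eventually.and (extChartAt_target_mem_nhds x) ?_
    refine (continuousAt_extChartAt_symm x).eventually ?_
    rwa [extChartAt_to_inv]
  obtain ⟨r, hr, hsub⟩ := Metric.mem_nhds_iff.1 h1
  have h2 : ∀ u ∈ Metric.ball (extChartAt I x x) r,
      HasFDerivAt (F ∘ (extChartAt I x).symm) (0 : E →L[ℝ] ℝ) u := by
    intro u hu
    have h3 : MDifferentiableAt 𝓘(ℝ, E) I (extChartAt I x).symm u :=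
      ((contMDiffOn_extChartAt_symm (I := I) (n := ∞) x).contMDiffAt
        ((isOpen_extChartAt_target x).mem_nhds (hsub hu).1)).mdifferentiableAt (by simp)
    have h4 := (hsub hu).2.mdifferentiableAt
    have h5 := mvfderiv_comp u h4 h3
    rw [(hsub hu).2.2] at h5
    have h6 : DifferentiableAt ℝ (F ∘ (extChartAt I x).symm) u :=
      mdifferentiableAt_iff_differentiableAt.1 (h4.comp u h3)
    have h7 : fderiv ℝ (F ∘ (extChartAt I x).symm) u = 0 := by
      rw [← mfderiv_eq_fderiv]
      exact h5
    rw [← h7]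
    exact h6.hasFDerivAt
  have h8 : ∀ u ∈ Metric.ball (extChartAt I x x) r,
      F ((extChartAt I x).symm u) = F ((extChartAt I x).symm (extChartAt I x x)) := fun u hu =>
    Metric.isOpen_ball.is_const_of_fderiv_eq_zero (convex_ball _ _).isPreconnected
      (fun v hv => (h2 v hv).differentiableAt.differentiableWithinAt)
      (fun v hv => (h2 v hv).fderiv) hu (Metric.mem_ball_self hr)
  filter_upwards [extChartAt_source_mem_nhds (I := I) x,
    (continuousAt_extChartAt (I := I) x).preimage_mem_nhds (Metric.ball_mem_nhds _ hr)] with y hy hy'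
  have := h8 _ hy'
  rwa [(extChartAt I x).left_inv hy, extChartAt_to_inv] at this

omit [FiniteDimensional ℝ E] in
/-- Primitives on a neighbourhood of a preconnected set differ by a constant on it. -/
theorem sub_eq_sub_of_isPrimAt {α : OneForm I M} {F G : M → ℝ} {C : Set M} (hC : IsPreconnected C)
    (hF : ∀ x ∈ C, ∀ᶠ y in 𝓝 x, IsPrimAt α F y) (hG : ∀ x ∈ C, ∀ᶠ y in 𝓝 x, IsPrimAt α G y)
    {x y : M} (hx : x ∈ C) (hy : y ∈ C) : F x - G x = F y - G y := by
  have h1 : ∀ x ∈ C, ∀ᶠ y in 𝓝 x, F y - G y = F x - G x := by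
    intro x hx
    refine eventuallyEq_of_isPrimAt_zero (I := I) (F := F - G) ?_
    filter_upwards [hF x hx, hG x hx] with y h1 h2
    exact sub_self α ▸ h1.sub h2
  have : PreconnectedSpace C := isPreconnected_iff_preconnectedSpace.1 hC
  have h2 : IsLocallyConstant (fun z : C => F z - G z) := by
    rw [IsLocallyConstant.iff_eventually_eq]
    intro z
    exact continuousAt_subtype_val.eventually (h1 z z.2)
  exact h2.apply_eq_of_preconnectedSpace ⟨x, hx⟩ ⟨y, hy⟩

/-- In the trivialization of the cotangent bundle at `x₀`, the fibre coordinate of `α` near `x₀` is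
exactly its representation in the chart at `x₀`. -/
theorem isSmoothForm_of_chartForm {α : OneForm I M}
    (h : ∀ x₀ : M, ContDiffAt ℝ ∞ (chartForm α x₀) (extChartAt I x₀ x₀)) : IsSmoothForm α := by
  intro x₀
  rw [contMDiffAt_hom_bundle]
  refine ⟨contMDiffAt_id, ?_⟩
  have h1 : ContMDiffAt I 𝓘(ℝ, E →L[ℝ] ℝ) ∞ (chartForm α x₀ ∘ extChartAt I x₀) x₀ :=
    (h x₀).contMDiffAt.comp x₀ contMDiffAt_extChartAt
  refine h1.congr_of_eventuallyEq ?_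
  filter_upwards [extChartAt_source_mem_nhds (I := I) x₀] with x hx
  have hx' : x ∈ (chartAt H x₀).source := by simpa using hx
  ext v
  simp only [ContinuousLinearMap.inCoordinates, ContinuousLinearMap.comp_apply]
  rw [TangentBundle.symmL_trivializationAt hx']
  simp [chartForm, chartFrame, I.range_eq_univ]
  exact oneForm_congr α (by simpa using ((extChartAt I x₀).left_inv hx).symm) _

omit [FiniteDimensional ℝ E] in
theorem chartForm_extD (f : C^∞⟮I, M; ℝ⟯) (x₀ : M) {u : E} (hu : u ∈ (extChartAt I x₀).target) :
    chartForm (extD I M f) x₀ u = fderiv ℝ (chartFun I f x₀) u := by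
  have h3 : MDifferentiableAt 𝓘(ℝ, E) I (extChartAt I x₀).symm u :=
    ((contMDiffOn_extChartAt_symm (I := I) (n := ∞) x₀).contMDiffAt
      ((isOpen_extChartAt_target x₀).mem_nhds hu)).mdifferentiableAt (by simp)
  have h4 : MDifferentiableAt I 𝓘(ℝ, ℝ) f ((extChartAt I x₀).symm u) :=
    f.contMDiff.mdifferentiableAt (by simp)
  have h5 := mvfderiv_comp u h4 h3
  rw [← mfderiv_eq_fderiv]
  exact h5.symm

theorem extD_mem_closedForms (f : C^∞⟮I, M; ℝ⟯) : extD I M f ∈ closedForms I M := by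
  have h : ∀ x₀ : M, ContDiffOn ℝ ∞ (chartFun I f x₀) (extChartAt I x₀).target := fun x₀ => by
    rw [← contMDiffOn_iff_contDiffOn]
    exact f.contMDiff.comp_contMDiffOn (contMDiffOn_extChartAt_symm x₀)
  refine ⟨isSmoothForm_of_chartForm fun x₀ => ?_, fun x₀ u hu v w => ?_⟩
  · refine (((h x₀).fderiv_of_isOpen (m := ∞) (isOpen_extChartAt_target x₀) (by simp)).contDiffAt
      (extChartAt_target_mem_nhds x₀)).congr_of_eventuallyEq ?_
    filter_upwards [extChartAt_target_mem_nhds (I := I) x₀] with u hu using chartForm_extD f x₀ hu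
  · have h1 : chartForm (extD I M f) x₀ =ᶠ[𝓝 u] fderiv ℝ (chartFun I f x₀) := by
      filter_upwards [(isOpen_extChartAt_target x₀).mem_nhds hu] with u hu
        using chartForm_extD f x₀ hu
    rw [h1.fderiv_eq]
    exact (((h x₀).contDiffAt ((isOpen_extChartAt_target x₀).mem_nhds hu)).isSymmSndFDerivAt
      (by simpa using ENat.LEInfty.out)).eq v w

end Primitives

/-! ### Radii of the two kinds of ends, and cutoff functions -/

section Radii
variable {s l : ℕ}

theorem isOpen_openRadii (c : ℝ) (i : Fin s ⊕ Fin l) : IsOpen (openRadii c i) := by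
  cases i
  · exact isOpen_Ioo
  · exact isOpen_Ioi

theorem convex_openRadii (c : ℝ) (i : Fin s ⊕ Fin l) : Convex ℝ (openRadii c i) := by
  cases i
  · exact convex_Ioo _ _
  · exact convex_Ioi _

theorem openRadii_subset_closedRadii (c : ℝ) (i : Fin s ⊕ Fin l) :
    openRadii c i ⊆ closedRadii c i := by
  cases i
  · exact Ioo_subset_Ioc_self
  · exact Ioi_subset_Ici_self

theorem pos_of_mem_closedRadii {c : ℝ} (hc : 0 < c) {i : Fin s ⊕ Fin l} {r : ℝ}
    (hr : r ∈ closedRadii c i) : 0 < r := by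
  cases i
  · exact hr.1
  · exact hc.trans_le hr

theorem pos_of_mem_openRadii {c : ℝ} (hc : 0 < c) {i : Fin s ⊕ Fin l} {r : ℝ}
    (hr : r ∈ openRadii c i) : 0 < r :=
  pos_of_mem_closedRadii hc (openRadii_subset_closedRadii c i hr)

instance endFilter_neBot (i : Fin s ⊕ Fin l) : (endFilter i).NeBot := by
  cases i
  · exact inferInstanceAs (𝓝[>] (0 : ℝ)).NeBot
  · exact inferInstanceAs (Filter.atTop : Filter ℝ).NeBot

theorem openRadii_mem_endFilter {c : ℝ} (hc : 0 < c) (i : Fin s ⊕ Fin l) :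
    openRadii c i ∈ endFilter i := by
  cases i
  · exact Ioo_mem_nhdsGT hc
  · exact Filter.Ioi_mem_atTop c

/-- Eventual properties along an end hold on a smaller end. -/
theorem exists_openRadii_of_eventually {b : ℝ} (hb : 0 < b) {i : Fin s ⊕ Fin l} {P : ℝ → Prop}
    (h : ∀ᶠ r in endFilter i, P r) :
    ∃ c, 0 < c ∧ closedRadii c i ⊆ openRadii b i ∧ ∀ r ∈ closedRadii c i, P r := by
  cases i
  · obtain ⟨u, hu, hsub⟩ := mem_nhdsGT_iff_exists_Ioc_subset.1 h
    have hu' : 0 < u := hu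
    refine ⟨min u (b / 2), by positivity, fun r hr => ⟨hr.1, ?_⟩, fun r hr => hsub ⟨hr.1, ?_⟩⟩
    · have := hr.2.trans (min_le_right _ _)
      linarith
    · exact hr.2.trans (min_le_left _ _)
  · obtain ⟨u, hu⟩ := Filter.eventually_atTop.1 h
    refine ⟨max u (b + 1), lt_max_of_lt_right (by linarith), fun r hr => ?_, fun r hr => hu r ?_⟩
    · have : max u (b + 1) ≤ r := hr
      exact (lt_add_one b).trans_le ((le_max_right _ _).trans this)
    · exact (le_max_left _ _).trans hr

theorem eventually_notMem_of_isCompact {i : Fin s ⊕ Fin l} {T : Set ℝ} (hT : IsCompact T)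
    (hT0 : T ⊆ Ioi 0) : ∀ᶠ r in endFilter i, r ∉ T := by
  cases i
  · refine nhdsWithin_le_nhds (hT.isClosed.isOpen_compl.mem_nhds fun h => ?_)
    exact lt_irrefl (0 : ℝ) (hT0 h)
  · exact atTop_le_cocompact hT.compl_mem_cocompact

theorem isCompact_closedRadii_diff {b c : ℝ} (hc : 0 < c) (i : Fin s ⊕ Fin l) :
    IsCompact (closedRadii b i \ openRadii c i) := by
  cases i
  · have : Ioc 0 b \ Ioo 0 c = Icc c b := by
      ext r
      simp only [mem_sdiff, mem_Ioc, mem_Ioo, mem_Icc, not_and, not_lt]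
      exact ⟨fun h => ⟨h.2 h.1.1, h.1.2⟩, fun h => ⟨⟨hc.trans_le h.1, h.2⟩, fun _ => h.1⟩⟩
    exact this ▸ isCompact_Icc
  · have : Ici b \ Ioi c = Icc b c := by
      ext r
      simp
    exact this ▸ isCompact_Icc

/-- The closed set `A` confines the support of `χ` on the closed end to the open end. This is what
makes the extension by zero beyond the end smooth. -/
theorem exists_cutoff {b : ℝ} (hb : 0 < b) (i : Fin s ⊕ Fin l) :
    ∃ χ : ℝ → ℝ, ContDiff ℝ ∞ χ ∧ ∃ c, 0 < c ∧ ∃ A, IsClosed A ∧ closedRadii b i ∩ A ⊆ openRadii b i ∧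
      (∀ r ∈ openRadii c i, χ r = 1) ∧ ∀ r ∈ closedRadii b i, r ∉ A → χ r = 0 := by
  cases i
  -- Equal to 1 up to `b / 4` and to 0 from `b / 2` on.
  · refine ⟨fun r => Real.smoothTransition (2 - 4 * r / b),
      Real.smoothTransition.contDiff.comp (by fun_prop), b / 4, by positivity, Iic (b / 2),
      isClosed_Iic, fun r hr => ⟨hr.1.1, hr.2.trans_lt (by linarith)⟩, fun r hr => ?_,
      fun r hr hr' => ?_⟩
    · apply Real.smoothTransition.one_of_one_le
      have : 4 * r / b ≤ 1 := by rw [div_le_one hb]; linarith [hr.2]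
      linarith
    · apply Real.smoothTransition.zero_of_nonpos
      have : 2 ≤ 4 * r / b := by rw [le_div_iff₀ hb]; linarith [(not_le.1 hr' : b / 2 < r)]
      linarith
  -- Equal to 0 up to `2 * b` and to 1 from `3 * b` on.
  · refine ⟨fun r => Real.smoothTransition (r / b - 2),
      Real.smoothTransition.contDiff.comp (by fun_prop), 3 * b, by positivity, Ici (2 * b),
      isClosed_Ici, fun r hr => lt_of_lt_of_le (by linarith : b < 2 * b) hr.2, fun r hr => ?_,
      fun r hr hr' => ?_⟩
    · apply Real.smoothTransition.one_of_one_le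
      have : 3 ≤ r / b := by rw [le_div_iff₀ hb]; exact le_of_lt hr
      linarith
    · apply Real.smoothTransition.zero_of_nonpos
      have : r / b ≤ 2 := by rw [div_le_iff₀ hb]; exact (not_le.1 hr' : r < 2 * b).le
      linarith

end Radii

/-! ### Submersions are open maps -/

section InverseFunction
variable {E E' : Type*} [NormedAddCommGroup E] [NormedSpace ℝ E] [NormedAddCommGroup E']
  [NormedSpace ℝ E'] [FiniteDimensional ℝ E] [FiniteDimensional ℝ E']
  {H H' : Type*} [TopologicalSpace H] [TopologicalSpace H']
  {I : ModelWithCorners ℝ E H} {I' : ModelWithCorners ℝ E' H'} [I.Boundaryless] [I'.Boundaryless]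
  {M M' : Type*} [TopologicalSpace M] [ChartedSpace H M] [TopologicalSpace M'] [ChartedSpace H' M']

/-- The open mapping form of the inverse function theorem for the map read in charts; the extended
charts carry neighbourhood filters to neighbourhood filters as there is no boundary. It makes the
parametrizations of the ends open. -/
theorem map_nhds_eq_of_surjective_mfderiv {f : M → M'} {p : M} (hf : ContMDiffAt I I' ∞ f p)
    (hs : Function.Surjective (mfderiv I I' f p)) : Filter.map f (𝓝 p) = 𝓝 (f p) := by
  have := FiniteDimensional.complete ℝ E
  have := FiniteDimensional.complete ℝ E'
  have hm : MDifferentiableAt I I' f p := hf.mdifferentiableAt (by simp)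
  have h1 := (contMDiffAt_iff.1 hf).2
  rw [I.range_eq_univ, contDiffWithinAt_univ] at h1
  set F := extChartAt I' (f p) ∘ f ∘ (extChartAt I p).symm
  have h2 : mfderiv I I' f p = fderiv ℝ F (extChartAt I p p) := by
    rw [hm.mfderiv, I.range_eq_univ, fderivWithin_univ]; rfl
  have h3 : (fderiv ℝ F (extChartAt I p p)).range = ⊤ := by
    rw [LinearMap.range_eq_top]
    rw [h2] at hs
    exact hs
  have h4 := (h1.hasStrictFDerivAt (by simp)).map_nhds_eq_of_surj h3
  have h5 : Filter.map (extChartAt I p) (𝓝 p) = 𝓝 (extChartAt I p p) := by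
    rw [map_extChartAt_nhds, I.range_eq_univ, nhdsWithin_univ]
  have h6 : Filter.map (extChartAt I' (f p)).symm (𝓝 (extChartAt I' (f p) (f p))) = 𝓝 (f p) := by
    have := map_extChartAt_symm_nhdsWithin_range (I := I') (f p)
    rwa [I'.range_eq_univ, nhdsWithin_univ] at this
  have h7 : F (extChartAt I p p) = extChartAt I' (f p) (f p) := by
    simp [F]
  rw [h7, ← h5, Filter.map_map] at h4
  rw [← h6, ← h4, Filter.map_map]
  refine Filter.map_congr ?_
  filter_upwards [extChartAt_source_mem_nhds (I := I) p,
    hf.continuousAt (extChartAt_source_mem_nhds (I := I') (f p))] with x hx hx'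
  simp only [F, Function.comp_apply, (extChartAt I p).left_inv hx]
  exact ((extChartAt I' (f p)).left_inv hx').symm

end InverseFunction

theorem surjective_of_leftInverse {V V' : Type*} [NormedAddCommGroup V] [NormedSpace ℝ V]
    [NormedAddCommGroup V'] [NormedSpace ℝ V'] [FiniteDimensional ℝ V] [FiniteDimensional ℝ V']
    (h : Module.finrank ℝ V = Module.finrank ℝ V') {A : V →L[ℝ] V'} {B : V' →L[ℝ] V}
    (hBA : ∀ v, B (A v) = v) : Function.Surjective A :=
  (LinearMap.injective_iff_surjective_of_finrank_eq_finrank h (f := A.toLinearMap)).1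
    (Function.LeftInverse.injective hBA)

/-! ### Topology of the ends and extension of functions from an end -/

section Ends
open Bundle
variable {n s l : ℕ} {L : Type*} [TopologicalSpace L]
    [ChartedSpace (EuclideanSpace ℝ (Fin (n + 1))) L] [IsManifold (𝓡 (n + 1)) ∞ L]
    {g : Metric (n + 1) L}
    {Lk : Fin s ⊕ Fin l → Type*} [∀ i, TopologicalSpace (Lk i)]
    [∀ i, ChartedSpace (EuclideanSpace ℝ (Fin n)) (Lk i)] [∀ i, IsManifold (𝓡 n) ∞ (Lk i)]
    (X : CSACStructure g Lk)

namespace CSACStructure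

theorem isOpen_domain (i : Fin s ⊕ Fin l) (c : ℝ) :
    IsOpen ((univ : Set (Lk i)) ×ˢ (openRadii c i : Set ℝ)) :=
  isOpen_univ.prod (isOpen_openRadii _ i)

theorem domain_subset (i : Fin s ⊕ Fin l) :
    (univ : Set (Lk i)) ×ˢ openRadii (X.b i) i ⊆ univ ×ˢ closedRadii (X.b i) i :=
  prod_mono_right (openRadii_subset_closedRadii _ i)

theorem contMDiffOn_φ (i : Fin s ⊕ Fin l) :
    ContMDiffOn ((𝓡 n).prod 𝓘(ℝ, ℝ)) (𝓡 (n + 1)) ∞ (X.φ i) (univ ×ˢ openRadii (X.b i) i) :=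
  (X.smooth_φ i).mono (X.domain_subset i)

theorem contMDiffAt_φ {i : Fin s ⊕ Fin l} {p : Lk i × ℝ} (hp : p.2 ∈ openRadii (X.b i) i) :
    ContMDiffAt ((𝓡 n).prod 𝓘(ℝ, ℝ)) (𝓡 (n + 1)) ∞ (X.φ i) p :=
  (X.contMDiffOn_φ i).contMDiffAt ((isOpen_domain i _).mem_nhds ⟨mem_univ _, hp⟩)

/-- Differentiating `ψ ∘ φ = id` makes `dφ` injective, hence onto for reasons of dimension. At this
stage `ψ` is known to be smooth only within the closed end, so its derivative is taken within that
set. -/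
theorem surjective_mfderiv_φ {i : Fin s ⊕ Fin l} {p : Lk i × ℝ} (hp : p.2 ∈ openRadii (X.b i) i) :
    Function.Surjective (mfderiv ((𝓡 n).prod 𝓘(ℝ, ℝ)) (𝓡 (n + 1)) (X.φ i) p) := by
  have hp' : p ∈ (univ : Set (Lk i)) ×ˢ openRadii (X.b i) i := ⟨mem_univ _, hp⟩
  have h1 := ((X.contMDiffAt_φ hp).mdifferentiableAt (by simp)).hasMFDerivAt
  have h2 := ((X.smooth_ψ i _ (mem_image_of_mem _ (X.domain_subset i hp'))).mdifferentiableWithinAt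
    (by simp)).hasMFDerivWithinAt
  have h3 := (h2.comp p (h1.hasMFDerivWithinAt (s := univ ×ˢ openRadii (X.b i) i))
    (fun q hq => mem_image_of_mem _ (X.domain_subset i hq))).hasMFDerivAt
    ((isOpen_domain i _).mem_nhds hp')
  have h4 := (hasMFDerivAt_id (I := (𝓡 n).prod 𝓘(ℝ, ℝ)) p).congr_of_eventuallyEq
    (f₁ := X.ψ i ∘ X.φ i) (by
    filter_upwards [(isOpen_domain i _).mem_nhds hp'] with q hq
    exact X.left_inv i (X.domain_subset i hq))
  have h5 := hasMFDerivAt_unique h3 h4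
  exact surjective_of_leftInverse (V := EuclideanSpace ℝ (Fin n) × ℝ)
    (V' := EuclideanSpace ℝ (Fin (n + 1)))
    (A := mfderiv ((𝓡 n).prod 𝓘(ℝ, ℝ)) (𝓡 (n + 1)) (X.φ i) p) (by simp) fun v => congrArg
      (fun A : (EuclideanSpace ℝ (Fin n) × ℝ) →L[ℝ] (EuclideanSpace ℝ (Fin n) × ℝ) => A v) h5

theorem map_φ_nhds {i : Fin s ⊕ Fin l} {p : Lk i × ℝ} (hp : p.2 ∈ openRadii (X.b i) i) :
    Filter.map (X.φ i) (𝓝 p) = 𝓝 (X.φ i p) :=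
  map_nhds_eq_of_surjective_mfderiv (X.contMDiffAt_φ hp) (X.surjective_mfderiv_φ hp)

theorem isOpen_image_φ {i : Fin s ⊕ Fin l} {B : Set (Lk i × ℝ)} (hB : IsOpen B)
    (hB' : B ⊆ univ ×ˢ openRadii (X.b i) i) : IsOpen (X.φ i '' B) := by
  rw [isOpen_iff_mem_nhds]
  rintro _ ⟨p, hp, rfl⟩
  rw [← X.map_φ_nhds (hB' hp).2]
  exact Filter.image_mem_map (hB.mem_nhds hp)

theorem isOpen_endSet (i : Fin s ⊕ Fin l) : IsOpen (X.endSet i) :=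
  X.isOpen_image_φ (isOpen_domain i _) subset_rfl

theorem contMDiffOn_ψ (i : Fin s ⊕ Fin l) :
    ContMDiffOn (𝓡 (n + 1)) ((𝓡 n).prod 𝓘(ℝ, ℝ)) ∞ (X.ψ i) (X.endSet i) :=
  (X.smooth_ψ i).mono (image_mono (X.domain_subset i))

theorem ψ_φ {i : Fin s ⊕ Fin l} {p : Lk i × ℝ} (hp : p.2 ∈ openRadii (X.b i) i) :
    X.ψ i (X.φ i p) = p :=
  X.left_inv i (X.domain_subset i ⟨mem_univ _, hp⟩)

theorem φ_mem_endSet {i : Fin s ⊕ Fin l} {p : Lk i × ℝ} (hp : p.2 ∈ openRadii (X.b i) i) :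
    X.φ i p ∈ X.endSet i :=
  mem_image_of_mem _ ⟨mem_univ _, hp⟩

theorem isClosed_closedEnd (i : Fin s ⊕ Fin l) :
    IsClosed (X.φ i '' (univ ×ˢ closedRadii (X.b i) i)) :=
  X.closure_end i ▸ isClosed_closure

/-- The radius is continuous on the closed end, and the closed end is closed in `L` because it is
the closure of the open one. -/
theorem isClosed_image_φ (i : Fin s ⊕ Fin l) {A : Set ℝ} (hA : IsClosed A) :
    IsClosed (X.φ i '' (univ ×ˢ (closedRadii (X.b i) i ∩ A))) := by
  have h1 := ContinuousOn.preimage_isClosed_of_isClosed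
    (continuous_snd.comp_continuousOn (X.smooth_ψ i).continuousOn) (X.isClosed_closedEnd i) hA
  convert h1 using 1
  ext x
  constructor
  · rintro ⟨p, ⟨-, hp, hp'⟩, rfl⟩
    refine ⟨mem_image_of_mem _ ⟨mem_univ _, hp⟩, ?_⟩
    change (X.ψ i (X.φ i p)).2 ∈ A
    rwa [X.left_inv i ⟨mem_univ _, hp⟩]
  · rintro ⟨⟨p, ⟨-, hp⟩, rfl⟩, hp'⟩
    refine mem_image_of_mem _ ⟨mem_univ _, hp, ?_⟩
    change (X.ψ i (X.φ i p)).2 ∈ A at hp'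
    rwa [X.left_inv i ⟨mem_univ _, hp⟩] at hp'

theorem notMem_endSet {i k : Fin s ⊕ Fin l} (hki : k ≠ i) {x : L} (hx : x ∈ X.endSet i) :
    x ∉ X.endSet k :=
  fun hx' => disjoint_left.1 (X.disjoint_ends hki) hx' hx

/-- A function on an end can be cut off to a function on the whole manifold. -/
theorem exists_extension (i : Fin s ⊕ Fin l) {F : L → ℝ}
    (hF : ∀ x ∈ X.endSet i, ContMDiffAt (𝓡 (n + 1)) 𝓘(ℝ, ℝ) ∞ F x) :
    ∃ G : C^∞⟮𝓡 (n + 1), L; ℝ⟯, (∀ᶠ r in endFilter i, ∀ θ, G (X.φ i (θ, r)) = F (X.φ i (θ, r))) ∧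
      ∀ k ≠ i, ∀ x ∈ X.endSet k, G x = 0 := by
  classical
  obtain ⟨χ, hχ, c, hc, A, hA, hAb, hχ1, hχ0⟩ := exists_cutoff (X.b_pos i) i
  let G : L → ℝ := (X.endSet i).indicator fun x => χ (X.ψ i x).2 * F x
  have hG : ContMDiff (𝓡 (n + 1)) 𝓘(ℝ, ℝ) ∞ G := by
    intro x
    by_cases hx : x ∈ X.endSet i
    · have h1 : ContMDiffAt (𝓡 (n + 1)) 𝓘(ℝ, ℝ) ∞ (fun x => χ (X.ψ i x).2 * F x) x := by
        refine ContMDiffAt.mul ?_ (hF x hx)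
        have h2 := (X.contMDiffOn_ψ i).contMDiffAt ((X.isOpen_endSet i).mem_nhds hx)
        exact hχ.contMDiff.contMDiffAt.comp x (contMDiffAt_snd.comp x h2)
      refine h1.congr_of_eventuallyEq ?_
      filter_upwards [(X.isOpen_endSet i).mem_nhds hx] with y hy
      exact indicator_of_mem hy _
    -- A point off the open end has a neighbourhood missing the closed set over `A`, and on that
    -- neighbourhood the cut-off function vanishes.
    · have h1 : x ∉ X.φ i '' (univ ×ˢ (closedRadii (X.b i) i ∩ A)) := fun h =>
        hx (image_mono (prod_mono_right hAb) h)
      refine (contMDiffAt_const (c := (0 : ℝ))).congr_of_eventuallyEq ?_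
      filter_upwards [(X.isClosed_image_φ i hA).isOpen_compl.mem_nhds h1] with y hy
      by_cases hy' : y ∈ X.endSet i
      · obtain ⟨p, ⟨-, hp⟩, rfl⟩ := hy'
        have h2 : p.2 ∉ A := fun h =>
          hy (mem_image_of_mem _ ⟨mem_univ _, openRadii_subset_closedRadii _ _ hp, h⟩)
        simp only [G]
        rw [indicator_of_mem (X.φ_mem_endSet hp), X.ψ_φ hp,
          hχ0 _ (openRadii_subset_closedRadii _ _ hp) h2, zero_mul]
      · exact indicator_of_notMem hy' _
  refine ⟨⟨G, hG⟩, ?_, fun k hk x hx =>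
    indicator_of_notMem (f := fun x => χ (X.ψ i x).2 * F x) (X.notMem_endSet hk.symm hx)⟩
  filter_upwards [openRadii_mem_endFilter hc i, openRadii_mem_endFilter (X.b_pos i) i]
    with r hr hr' θ
  change G _ = _
  simp only [G]
  rw [indicator_of_mem (X.φ_mem_endSet hr'), X.ψ_φ hr', hχ1 _ hr, one_mul]

variable [∀ i, CompactSpace (Lk i)]

/-- Shrinking the ends enlarges the core by collars, which are images of the link times a compact
interval of radii. -/
theorem isCompact_core {c : Fin s ⊕ Fin l → ℝ} (hc : ∀ i, 0 < c i)
    (hcb : ∀ i, closedRadii (c i) i ⊆ openRadii (X.b i) i) :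
    IsCompact (⋃ i, X.φ i '' (univ ×ˢ openRadii (c i) i))ᶜ := by
  have h1 : ∀ i, IsCompact (X.φ i '' (univ ×ˢ (closedRadii (X.b i) i \ openRadii (c i) i))) :=
    fun i => (isCompact_univ.prod (isCompact_closedRadii_diff (hc i) i)).image_of_continuousOn
      ((X.smooth_φ i).continuousOn.mono (prod_mono_right sdiff_subset))
  refine (X.compact_core.union (isCompact_iUnion h1)).of_isClosed_subset ?_ ?_
  · refine (isOpen_iUnion fun i => X.isOpen_image_φ (isOpen_domain i _) ?_).isClosed_compl
    exact prod_mono_right ((openRadii_subset_closedRadii _ i).trans (hcb i))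
  · intro x hx
    by_cases h : x ∈ ⋃ i, X.φ i '' (univ ×ˢ openRadii (X.b i) i)
    · right
      obtain ⟨i, p, ⟨-, hp⟩, rfl⟩ := mem_iUnion.1 h
      refine mem_iUnion.2 ⟨i, mem_image_of_mem _ ⟨mem_univ _, openRadii_subset_closedRadii _ _ hp,
        fun hp' => hx (mem_iUnion.2 ⟨i, mem_image_of_mem _ ⟨mem_univ _, hp'⟩⟩)⟩⟩
    · exact Or.inl h

-- The radii of the points of `K` on the closed end form a compact subset of `(0, ∞)`, which stays
-- away from the limit of the radius.
omit [∀ i, CompactSpace (Lk i)] in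
theorem eventually_φ_notMem {K : Set L} (hK : IsCompact K) (i : Fin s ⊕ Fin l) :
    ∀ᶠ r in endFilter i, ∀ θ, X.φ i (θ, r) ∉ K := by
  have h1 : IsCompact (K ∩ X.φ i '' (univ ×ˢ closedRadii (X.b i) i)) :=
    hK.inter_right (X.isClosed_closedEnd i)
  have h2 := h1.image_of_continuousOn
    ((continuous_snd.comp_continuousOn (X.smooth_ψ i).continuousOn).mono inter_subset_right)
  have h3 := eventually_notMem_of_isCompact (i := i) h2 (by
    rintro _ ⟨_, ⟨-, p, ⟨-, hp⟩, rfl⟩, rfl⟩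
    change 0 < (X.ψ i (X.φ i p)).2
    rw [X.left_inv i ⟨mem_univ _, hp⟩]
    exact pos_of_mem_closedRadii (X.b_pos i) hp)
  filter_upwards [h3, openRadii_mem_endFilter (X.b_pos i) i] with r hr hr' θ hθ
  have hp : ((θ, r) : Lk i × ℝ) ∈ (univ : Set (Lk i)) ×ˢ closedRadii (X.b i) i :=
    X.domain_subset i ⟨mem_univ _, hr'⟩
  refine hr ⟨X.φ i (θ, r), ⟨hθ, mem_image_of_mem _ hp⟩, ?_⟩
  change (X.ψ i (X.φ i (θ, r))).2 = r
  rw [X.left_inv i hp]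

/-- Translates conditions outside a compact set into conditions far along every end, the form in
which the estimates are made. -/
theorem eventually_cocompact_iff {P : L → Prop} :
    (∀ᶠ x in Filter.cocompact L, P x) ↔ ∀ i, ∀ᶠ r in endFilter i, ∀ θ, P (X.φ i (θ, r)) := by
  constructor
  · intro h i
    obtain ⟨K, hK, hKP⟩ := Filter.mem_cocompact.1 h
    filter_upwards [X.eventually_φ_notMem hK i] with r hr θ
    exact hKP (hr θ)
  · intro h
    choose c hc hcb hP using fun i => exists_openRadii_of_eventually (X.b_pos i) (h i)
    refine Filter.mem_cocompact.2 ⟨_, X.isCompact_core hc hcb, ?_⟩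
    rw [compl_compl]
    refine iUnion_subset fun i => ?_
    rintro _ ⟨p, ⟨-, hp⟩, rfl⟩
    exact hP i _ (openRadii_subset_closedRadii _ _ hp) p.1

omit [∀ i, CompactSpace (Lk i)] in
theorem eventually_nearSingularities_iff {P : L → Prop} :
    (∀ᶠ x in X.nearSingularities, P x) ↔
      ∀ i : Fin s, ∀ᶠ r in endFilter (s := s) (l := l) (.inl i), ∀ θ, P (X.φ (.inl i) (θ, r)) := by
  simp only [nearSingularities, Filter.eventually_iSup, Filter.eventually_map]
  refine forall_congr' fun i => ?_
  rw [Filter.top_prod, Filter.eventually_comap]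
  constructor
  · intro h
    filter_upwards [h] with r hr θ using hr (θ, r) rfl
  · intro h
    filter_upwards [h] with r hr
    rintro ⟨θ, _⟩ rfl
    exact hr θ

end CSACStructure
end Ends

/-! ### Growth estimates for functions of one real variable -/

section RealEstimates
open Filter

/-- Both functions `C / β * r ^ β ± f` have nonnegative derivative `C * r ^ (β - 1) ± f'`, hence are
monotone; comparing their values at `x` and `y` replaces an integration. -/
theorem abs_sub_le_of_abs_deriv_le_rpow {S : Set ℝ} (hS : IsOpen S) (hc : Convex ℝ S)
    (hpos : ∀ r ∈ S, 0 < r) {f f' : ℝ → ℝ} {C β : ℝ} (hβ : β ≠ 0)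
    (hf : ∀ r ∈ S, HasDerivAt f (f' r) r) (hb : ∀ r ∈ S, |f' r| ≤ C * r ^ (β - 1)) {x y : ℝ}
    (hx : x ∈ S) (hy : y ∈ S) : |f x - f y| ≤ |C / β| * |x ^ β - y ^ β| := by
  have key : ∀ σ : ℝ, |σ| = 1 → MonotoneOn (fun r => C / β * r ^ β + σ * f r) S := by
    intro σ hσ
    have hd : ∀ r ∈ S, HasDerivAt (fun r => C / β * r ^ β + σ * f r)
        (C * r ^ (β - 1) + σ * f' r) r := by
      intro r hr
      have h1 := ((Real.hasDerivAt_rpow_const (p := β) (Or.inl (hpos r hr).ne')).const_mul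
        (C / β)).add ((hf r hr).const_mul σ)
      exact h1.congr_deriv (by field_simp)
    refine monotoneOn_of_deriv_nonneg hc
      (fun r hr => (hd r hr).continuousAt.continuousWithinAt) ?_ ?_
    · rw [hS.interior_eq]
      exact fun r hr => (hd r hr).differentiableAt.differentiableWithinAt
    · rw [hS.interior_eq]
      intro r hr
      rw [(hd r hr).deriv]
      have h1 : |σ * f' r| ≤ C * r ^ (β - 1) := by rw [abs_mul, hσ, one_mul]; exact hb r hr
      linarith [neg_le_of_abs_le h1]
  rw [← abs_mul]
  wlog hxy : x ≤ y generalizing x y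
  · rw [abs_sub_comm, ← abs_neg (C / β * _), ← mul_neg, neg_sub]
    exact this hy hx (le_of_not_ge hxy)
  have h1 := key 1 (by simp) hx hy hxy
  have h2 := key (-1) (by simp) hx hy hxy
  simp only at h1 h2
  have h3 : |C / β * (x ^ β - y ^ β)| = C / β * (y ^ β - x ^ β) := by
    rw [abs_of_nonpos] <;> linarith
  rw [h3, abs_le]
  constructor <;> linarith

/-- The image of `l` under `f` is Cauchy because that under `ρ` is. Letting `y` run along `l` in the
hypothesis then gives the rate of convergence. -/
theorem exists_limit_of_abs_sub_le {l : Filter ℝ} [l.NeBot] {f ρ : ℝ → ℝ} {S : Set ℝ} (hS : S ∈ l)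
    {K : ℝ} (hf : ∀ x ∈ S, ∀ y ∈ S, |f x - f y| ≤ K * |ρ x - ρ y|) (hρ : Tendsto ρ l (𝓝 0)) :
    ∃ a, Tendsto f l (𝓝 a) ∧ ∀ x ∈ S, |f x - a| ≤ K * |ρ x| := by
  have h0 : Cauchy (l.map ρ) := hρ.cauchy_map
  have h1 : Cauchy (l.map f) := by
    rw [Metric.cauchy_iff] at h0 ⊢
    refine ⟨inferInstance, fun ε hε => ?_⟩
    -- The summand 1 covers the case `K = 0`.
    obtain ⟨t, ht, htd⟩ := h0.2 (ε / (|K| + 1)) (by positivity)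
    refine ⟨f '' (S ∩ ρ ⁻¹' t), image_mem_map (inter_mem hS ht), ?_⟩
    rintro _ ⟨x, ⟨hx, hx'⟩, rfl⟩ _ ⟨y, ⟨hy, hy'⟩, rfl⟩
    rw [Real.dist_eq]
    have h2 := htd _ hx' _ hy'
    rw [Real.dist_eq, lt_div_iff₀ (by positivity)] at h2
    refine ((hf x hx y hy).trans ?_).trans_lt h2
    rw [mul_comm]
    exact mul_le_mul_of_nonneg_left (by linarith [le_abs_self K]) (abs_nonneg _)
  obtain ⟨a, ha⟩ := cauchy_map_iff_exists_tendsto.1 h1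
  refine ⟨a, ha, fun x hx => ?_⟩
  have h2 : Tendsto (fun y => |f x - f y|) l (𝓝 |f x - a|) := (tendsto_const_nhds.sub ha).abs
  have h3 : Tendsto (fun y => K * |ρ x - ρ y|) l (𝓝 (K * |ρ x - 0|)) :=
    ((tendsto_const_nhds.sub hρ).abs).const_mul K
  rw [sub_zero] at h3
  refine le_of_tendsto_of_tendsto h2 h3 ?_
  filter_upwards [hS] with y hy using hf x hx y hy

end RealEstimates

/-! ### Rescaled coordinates on an end and derivatives along rays -/

section Ends
open Bundle
variable {n s l : ℕ} {L : Type*} [TopologicalSpace L]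
    [ChartedSpace (EuclideanSpace ℝ (Fin (n + 1))) L] [IsManifold (𝓡 (n + 1)) ∞ L]
    {g : Metric (n + 1) L}
    {Lk : Fin s ⊕ Fin l → Type*} [∀ i, TopologicalSpace (Lk i)]
    [∀ i, ChartedSpace (EuclideanSpace ℝ (Fin n)) (Lk i)] [∀ i, IsManifold (𝓡 n) ∞ (Lk i)]
    (X : CSACStructure g Lk)

namespace CSACStructure

/-- The differential of the parametrization of an end. -/
def dφ (i : Fin s ⊕ Fin l) (p : Lk i × ℝ) :
    (EuclideanSpace ℝ (Fin n) × ℝ) →L[ℝ] EuclideanSpace ℝ (Fin (n + 1)) :=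
  mfderiv ((𝓡 n).prod 𝓘(ℝ, ℝ)) (𝓡 (n + 1)) (X.φ i) p

/-- Coordinates on an end: the chart at `θ₀` on the link and the radius in units of `t`. -/
def coord (i : Fin s ⊕ Fin l) (θ₀ : Lk i) (t : ℝ) (p : EuclideanSpace ℝ (Fin n) × ℝ) : L :=
  X.φ i ((extChartAt (𝓡 n) θ₀).symm p.1, t * p.2)

/-- The domain of these coordinates. -/
def coordDomain (i : Fin s ⊕ Fin l) (θ₀ : Lk i) (t : ℝ) : Set (EuclideanSpace ℝ (Fin n) × ℝ) :=
  (extChartAt (𝓡 n) θ₀).target ×ˢ ((fun r => t * r) ⁻¹' openRadii (X.b i) i)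

theorem isOpen_coordDomain (i : Fin s ⊕ Fin l) (θ₀ : Lk i) (t : ℝ) :
    IsOpen (X.coordDomain i θ₀ t) :=
  (isOpen_extChartAt_target θ₀).prod ((isOpen_openRadii _ i).preimage (by fun_prop))

omit [∀ i, IsManifold (𝓡 n) ∞ (Lk i)] in
theorem contMDiffOn_scaledChart {i : Fin s ⊕ Fin l} [IsManifold (𝓡 n) ∞ (Lk i)] (θ₀ : Lk i) (t : ℝ) :
    ContMDiffOn 𝓘(ℝ, EuclideanSpace ℝ (Fin n) × ℝ) ((𝓡 n).prod 𝓘(ℝ, ℝ)) ∞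
      (Prod.map (extChartAt (𝓡 n) θ₀).symm (fun r : ℝ => t * r))
      ((extChartAt (𝓡 n) θ₀).target ×ˢ univ) := by
  -- The model and the atlas of the product vector space are replaced by the product model and
  -- atlas, for which products of smooth maps are available.
  rw [modelWithCornersSelf_prod, ← chartedSpaceSelf_prod]
  exact (contMDiffOn_extChartAt_symm θ₀).prodMap
    (contDiff_const.mul contDiff_id).contMDiff.contMDiffOn

theorem contMDiffOn_coord (i : Fin s ⊕ Fin l) (θ₀ : Lk i) (t : ℝ) :
    ContMDiffOn 𝓘(ℝ, EuclideanSpace ℝ (Fin n) × ℝ) (𝓡 (n + 1)) ∞ (X.coord i θ₀ t)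
      (X.coordDomain i θ₀ t) :=
  (X.contMDiffOn_φ i).comp ((contMDiffOn_scaledChart θ₀ t).mono (prod_mono_right (subset_univ _)))
    fun _ hp => ⟨mem_univ _, hp.2⟩

omit [∀ i, IsManifold (𝓡 n) ∞ (Lk i)] in
theorem mfderiv_scaledChart {i : Fin s ⊕ Fin l} [IsManifold (𝓡 n) ∞ (Lk i)] (θ₀ : Lk i) (t : ℝ)
    {p : EuclideanSpace ℝ (Fin n) × ℝ} (hp : p.1 ∈ (extChartAt (𝓡 n) θ₀).target)
    (w : EuclideanSpace ℝ (Fin n) × ℝ) :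
    (mfderiv 𝓘(ℝ, EuclideanSpace ℝ (Fin n) × ℝ) ((𝓡 n).prod 𝓘(ℝ, ℝ))
      (Prod.map (extChartAt (𝓡 n) θ₀).symm (fun r : ℝ => t * r)) p w :
        EuclideanSpace ℝ (Fin n) × ℝ) = (chartFrame (𝓡 n) θ₀ p.1 w.1, t * w.2) := by
  have h1 : MDifferentiableAt 𝓘(ℝ, EuclideanSpace ℝ (Fin n)) (𝓡 n) (extChartAt (𝓡 n) θ₀).symm p.1 :=
    ((contMDiffOn_extChartAt_symm (I := 𝓡 n) (n := ∞) θ₀).contMDiffAt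
      ((isOpen_extChartAt_target θ₀).mem_nhds hp)).mdifferentiableAt (by simp)
  have h2 : HasDerivAt (fun r : ℝ => t * r) t p.2 := by
    simpa using (hasDerivAt_id p.2).const_mul t
  have h3 := mfderiv_prodMap h1 h2.differentiableAt.mdifferentiableAt
  have h4 : mfderiv 𝓘(ℝ, ℝ) 𝓘(ℝ, ℝ) (fun r : ℝ => t * r) p.2 w.2 = t * w.2 := by
    have h5 : fderiv ℝ (fun r : ℝ => t * r) p.2 w.2 = t * w.2 := by
      rw [h2.hasFDerivAt.fderiv]
      simp [mul_comm]
    rw [mfderiv_eq_fderiv]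
    exact h5
  rw [modelWithCornersSelf_prod, ← chartedSpaceSelf_prod, h3]
  exact Prod.ext rfl h4

theorem mfderiv_coord {i : Fin s ⊕ Fin l} {θ₀ : Lk i} {t : ℝ}
    {p : EuclideanSpace ℝ (Fin n) × ℝ} (hp : p ∈ X.coordDomain i θ₀ t)
    (w : EuclideanSpace ℝ (Fin n) × ℝ) :
    (mfderiv 𝓘(ℝ, EuclideanSpace ℝ (Fin n) × ℝ) (𝓡 (n + 1)) (X.coord i θ₀ t) p w :
      EuclideanSpace ℝ (Fin (n + 1))) =
      X.dφ i ((extChartAt (𝓡 n) θ₀).symm p.1, t * p.2) (chartFrame (𝓡 n) θ₀ p.1 w.1, t * w.2) := by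
  have h1 : MDifferentiableAt 𝓘(ℝ, EuclideanSpace ℝ (Fin n) × ℝ) ((𝓡 n).prod 𝓘(ℝ, ℝ))
      (Prod.map (extChartAt (𝓡 n) θ₀).symm (fun r : ℝ => t * r)) p :=
    ((contMDiffOn_scaledChart θ₀ t).contMDiffAt
      (((isOpen_extChartAt_target θ₀).prod isOpen_univ).mem_nhds ⟨hp.1, mem_univ _⟩)).mdifferentiableAt
      (by simp)
  have h2 : MDifferentiableAt ((𝓡 n).prod 𝓘(ℝ, ℝ)) (𝓡 (n + 1)) (X.φ i)
      (Prod.map (extChartAt (𝓡 n) θ₀).symm (fun r : ℝ => t * r) p) :=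
    (X.contMDiffAt_φ (p := Prod.map (extChartAt (𝓡 n) θ₀).symm (fun r : ℝ => t * r) p)
      hp.2).mdifferentiableAt (by simp)
  have h3 := mfderiv_comp p h2 h1
  have h4 := congrArg (fun A : (EuclideanSpace ℝ (Fin n) × ℝ) →L[ℝ] EuclideanSpace ℝ (Fin (n + 1)) =>
    A w) h3
  exact h4.trans (congrArg (X.dφ i _) (mfderiv_scaledChart θ₀ t hp.1 w))

theorem hasDerivAt_radial {i : Fin s ⊕ Fin l} {α : OneForm (𝓡 (n + 1)) L} {F : L → ℝ} {θ : Lk i}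
    {r : ℝ} (hr : r ∈ openRadii (X.b i) i) (hF : IsPrimAt α F (X.φ i (θ, r))) :
    HasDerivAt (fun r => F (X.φ i (θ, r)))
      ((α (X.φ i (θ, r)) : EuclideanSpace ℝ (Fin (n + 1)) →L[ℝ] ℝ) (X.dφ i (θ, r) (0, 1))) r := by
  have h1 : MDifferentiableAt 𝓘(ℝ, ℝ) ((𝓡 n).prod 𝓘(ℝ, ℝ)) (fun r : ℝ => (θ, r)) r :=
    mdifferentiableAt_const.prodMk mdifferentiableAt_id
  have h2 : MDifferentiableAt ((𝓡 n).prod 𝓘(ℝ, ℝ)) (𝓡 (n + 1)) (X.φ i) (θ, r) :=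
    (X.contMDiffAt_φ (p := (θ, r)) hr).mdifferentiableAt (by simp)
  have h3 := mvfderiv_comp r (hF.mdifferentiableAt) (h2.comp r h1)
  have h4 : DifferentiableAt ℝ (fun r => F (X.φ i (θ, r))) r :=
    mdifferentiableAt_iff_differentiableAt.1 (hF.mdifferentiableAt.comp r (h2.comp r h1))
  have h5 := mfderiv_comp r h2 h1
  have h6 := h4.hasDerivAt
  refine h6.congr_deriv ?_
  symm
  rw [← fderiv_apply_one_eq_deriv, ← mfderiv_eq_fderiv]
  have h7 := congrArg (fun A : ℝ →L[ℝ] ℝ => A 1) h3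
  refine Eq.trans ?_ h7.symm
  have h11 : (mvfderiv (𝓡 (n + 1)) F (X.φ i (θ, r)) : EuclideanSpace ℝ (Fin (n + 1)) →L[ℝ] ℝ) =
    α (X.φ i (θ, r)) := hF.2
  change _ = (mvfderiv (𝓡 (n + 1)) F (X.φ i (θ, r)) : EuclideanSpace ℝ (Fin (n + 1)) →L[ℝ] ℝ) _
  rw [h11]
  have h8 := congrArg (fun A : ℝ →L[ℝ] EuclideanSpace ℝ (Fin (n + 1)) => A 1) h5
  refine congrArg (α (X.φ i (θ, r)) : EuclideanSpace ℝ (Fin (n + 1)) →L[ℝ] ℝ) ?_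
  refine Eq.trans ?_ h8.symm
  have h9 := mfderiv_prod_right (I := 𝓡 n) (I' := 𝓘(ℝ, ℝ)) (x₀ := θ) (y₀ := r)
  have h10 := congrArg (fun A : ℝ →L[ℝ] (EuclideanSpace ℝ (Fin n) × ℝ) => A 1) h9
  exact (congrArg (X.dφ i (θ, r)) h10).symm

end CSACStructure
end Ends

theorem hasFDerivAt_comp_of_isPrimAt {E E₁ H M : Type*} [NormedAddCommGroup E] [NormedSpace ℝ E]
    [NormedAddCommGroup E₁] [NormedSpace ℝ E₁] [TopologicalSpace H] {I : ModelWithCorners ℝ E H}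
    [TopologicalSpace M] [ChartedSpace H M] {α : OneForm I M} {F : M → ℝ} {κ : E₁ → M} {p : E₁}
    (hκ : MDifferentiableAt 𝓘(ℝ, E₁) I κ p) (hF : IsPrimAt α F (κ p)) :
    HasFDerivAt (fun q => F (κ q)) (pullForm α κ p) p := by
  have h1 : DifferentiableAt ℝ (F ∘ κ) p :=
    mdifferentiableAt_iff_differentiableAt.1 (hF.mdifferentiableAt.comp p hκ)
  have h2 := mvfderiv_comp p hF.mdifferentiableAt hκ
  have h3 : fderiv ℝ (F ∘ κ) p = pullForm α κ p := by
    rw [← mfderiv_eq_fderiv]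
    refine Eq.trans h2 ?_
    rw [hF.2]
    rfl
  rw [← h3]
  exact h1.hasFDerivAt

/-! ### Primitives on a whole end -/

section Ends
open Bundle
variable {n s l : ℕ} {L : Type*} [TopologicalSpace L]
    [ChartedSpace (EuclideanSpace ℝ (Fin (n + 1))) L] [IsManifold (𝓡 (n + 1)) ∞ L]
    {g : Metric (n + 1) L}
    {Lk : Fin s ⊕ Fin l → Type*} [∀ i, TopologicalSpace (Lk i)]
    [∀ i, ChartedSpace (EuclideanSpace ℝ (Fin n)) (Lk i)] [∀ i, IsManifold (𝓡 n) ∞ (Lk i)]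
    (X : CSACStructure g Lk)

namespace CSACStructure

/-- A coordinate ball in a link. -/
def linkBall {i : Fin s ⊕ Fin l} (θ₀ : Lk i) (ρ : ℝ) : Set (Lk i) :=
  (extChartAt (𝓡 n) θ₀).source ∩ extChartAt (𝓡 n) θ₀ ⁻¹' Metric.ball (extChartAt (𝓡 n) θ₀ θ₀) ρ

omit [∀ i, IsManifold (𝓡 n) ∞ (Lk i)] in
theorem isOpen_linkBall {i : Fin s ⊕ Fin l} (θ₀ : Lk i) (ρ : ℝ) :
    IsOpen (linkBall (n := n) θ₀ ρ) :=
  isOpen_extChartAt_preimage' θ₀ Metric.isOpen_ball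

omit [∀ i, IsManifold (𝓡 n) ∞ (Lk i)] in
theorem mem_linkBall {i : Fin s ⊕ Fin l} (θ₀ : Lk i) {ρ : ℝ} (hρ : 0 < ρ) :
    θ₀ ∈ linkBall (n := n) θ₀ ρ :=
  ⟨mem_extChartAt_source θ₀, Metric.mem_ball_self hρ⟩

omit [∀ i, IsManifold (𝓡 n) ∞ (Lk i)] in
theorem linkBall_eq_image {i : Fin s ⊕ Fin l} (θ₀ : Lk i) {ρ : ℝ}
    (hρ : Metric.ball (extChartAt (𝓡 n) θ₀ θ₀) ρ ⊆ (extChartAt (𝓡 n) θ₀).target) :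
    linkBall (n := n) θ₀ ρ =
      (extChartAt (𝓡 n) θ₀).symm '' Metric.ball (extChartAt (𝓡 n) θ₀ θ₀) ρ :=
  ((extChartAt (𝓡 n) θ₀).symm_image_eq_source_inter_preimage hρ).symm

omit [∀ i, IsManifold (𝓡 n) ∞ (Lk i)] in
theorem isPreconnected_linkBall {i : Fin s ⊕ Fin l} (θ₀ : Lk i) {ρ : ℝ}
    (hρ : Metric.ball (extChartAt (𝓡 n) θ₀ θ₀) ρ ⊆ (extChartAt (𝓡 n) θ₀).target) :
    IsPreconnected (linkBall (n := n) θ₀ ρ) := by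
  rw [linkBall_eq_image θ₀ hρ]
  exact (convex_ball _ _).isPreconnected.image _ ((continuousOn_extChartAt_symm θ₀).mono hρ)

theorem isOpen_image_linkBall {i : Fin s ⊕ Fin l} (θ₀ : Lk i) (ρ : ℝ) :
    IsOpen (X.φ i '' (linkBall (n := n) θ₀ ρ ×ˢ openRadii (X.b i) i)) :=
  X.isOpen_image_φ ((isOpen_linkBall θ₀ ρ).prod (isOpen_openRadii _ i))
    (prod_mono_left (subset_univ _))

/-- Closed forms are exact over coordinate balls of the link. -/
theorem exists_prim_linkBall {i : Fin s ⊕ Fin l} (θ₀ : Lk i) {ρ : ℝ}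
    (hρ : Metric.ball (extChartAt (𝓡 n) θ₀ θ₀) ρ ⊆ (extChartAt (𝓡 n) θ₀).target)
    {α : OneForm (𝓡 (n + 1)) L} (hα : α ∈ closedForms (𝓡 (n + 1)) L) :
    ∃ F : L → ℝ, ∀ x ∈ X.φ i '' (linkBall (n := n) θ₀ ρ ×ˢ openRadii (X.b i) i), IsPrimAt α F x := by
  have hΩ : IsOpen (Metric.ball (extChartAt (𝓡 n) θ₀ θ₀) ρ ×ˢ (openRadii (X.b i) i : Set ℝ)) :=
    Metric.isOpen_ball.prod (isOpen_openRadii _ i)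
  have hκ : ContMDiffOn 𝓘(ℝ, EuclideanSpace ℝ (Fin n) × ℝ) (𝓡 (n + 1)) ∞ (X.coord i θ₀ 1)
      (Metric.ball (extChartAt (𝓡 n) θ₀ θ₀) ρ ×ˢ openRadii (X.b i) i) :=
    (X.contMDiffOn_coord i θ₀ 1).mono fun p hp => ⟨hρ hp.1, by simpa using hp.2⟩
  obtain ⟨f, hf, hd⟩ := exists_hasFDerivAt_pullForm hΩ
    ((convex_ball _ _).prod (convex_openRadii _ _)) hκ hα
  have hW := X.isOpen_image_linkBall (i := i) θ₀ ρ
  let ι : L → EuclideanSpace ℝ (Fin n) × ℝ :=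
    fun x => (extChartAt (𝓡 n) θ₀ (X.ψ i x).1, (X.ψ i x).2)
  have hsub : X.φ i '' (linkBall (n := n) θ₀ ρ ×ˢ openRadii (X.b i) i) ⊆ X.endSet i :=
    image_mono (prod_mono_left (subset_univ _))
  refine ⟨f ∘ ι, fun x hx => isPrimAt_comp hΩ hκ hf hd hW (ι := ι) ?_ ?_ ?_ hx⟩
  · have h1 := (X.contMDiffOn_ψ i).mono hsub
    rw [modelWithCornersSelf_prod, ← chartedSpaceSelf_prod]
    refine ContMDiffOn.prodMk ?_ (contMDiff_snd.comp_contMDiffOn h1)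
    refine (contMDiffOn_extChartAt (x := θ₀)).comp (contMDiff_fst.comp_contMDiffOn h1) ?_
    rintro _ ⟨p, hp, rfl⟩
    change (X.ψ i (X.φ i p)).1 ∈ (chartAt (EuclideanSpace ℝ (Fin n)) θ₀).source
    rw [X.ψ_φ hp.2]
    simpa using hp.1.1
  · rintro _ ⟨p, hp, rfl⟩
    simp only [ι, X.ψ_φ hp.2]
    exact ⟨hp.1.2, hp.2⟩
  · rintro _ ⟨p, hp, rfl⟩
    simp only [ι, X.ψ_φ hp.2, coord, one_mul, (extChartAt (𝓡 n) θ₀).left_inv hp.1.1]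

/-- Local primitives along an end that are normalised on every ray fit together. -/
theorem exists_prim_end_of_local {i : Fin s ⊕ Fin l} {α : OneForm (𝓡 (n + 1)) L} {lf : Filter ℝ}
    [lf.NeBot] (hlf : openRadii (X.b i) i ∈ lf) {h : L → ℝ}
    (hloc : ∀ θ₀ : Lk i, ∃ N : Set (Lk i), IsOpen N ∧ θ₀ ∈ N ∧ ∃ F : L → ℝ,
      (∀ x ∈ X.φ i '' (N ×ˢ openRadii (X.b i) i), IsPrimAt α F x) ∧
      ∀ θ ∈ N, Filter.Tendsto (fun r => F (X.φ i (θ, r)) - h (X.φ i (θ, r))) lf (𝓝 0)) :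
    ∃ F : L → ℝ, (∀ x ∈ X.endSet i, IsPrimAt α F x) ∧
      ∀ θ, Filter.Tendsto (fun r => F (X.φ i (θ, r)) - h (X.φ i (θ, r))) lf (𝓝 0) := by
  choose N hNo hN F hF hlim using hloc
  have hWo : ∀ θ, IsOpen (X.φ i '' (N θ ×ˢ openRadii (X.b i) i)) := fun θ =>
    X.isOpen_image_φ ((hNo θ).prod (isOpen_openRadii _ i)) (prod_mono_left (subset_univ _))
  have key : ∀ θ₀ θ, θ ∈ N θ₀ → ∀ r ∈ openRadii (X.b i) i,
      F θ (X.φ i (θ, r)) = F θ₀ (X.φ i (θ, r)) := by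
    intro θ₀ θ hθ r hr
    -- Two local primitives over the same link point differ by a constant along the ray. Both have
    -- the limit behaviour of `h`, so the constant is zero.
    have hray : IsPreconnected ((fun r => X.φ i (θ, r)) '' openRadii (X.b i) i) :=
      (convex_openRadii _ i).isPreconnected.image _
        ((X.contMDiffOn_φ i).continuousOn.comp (by fun_prop) fun r hr => ⟨mem_univ _, hr⟩)
    have hsub : ∀ θ₁, θ ∈ N θ₁ → ∀ x ∈ (fun r => X.φ i (θ, r)) '' openRadii (X.b i) i,
        ∀ᶠ y in 𝓝 x, IsPrimAt α (F θ₁) y := by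
      rintro θ₁ hθ₁ _ ⟨r, hr, rfl⟩
      exact Filter.eventually_of_mem ((hWo θ₁).mem_nhds ⟨(θ, r), ⟨hθ₁, hr⟩, rfl⟩) (hF θ₁)
    have hc : ∀ r' ∈ openRadii (X.b i) i, F θ (X.φ i (θ, r')) - F θ₀ (X.φ i (θ, r')) =
        F θ (X.φ i (θ, r)) - F θ₀ (X.φ i (θ, r)) := fun r' hr' =>
      sub_eq_sub_of_isPrimAt hray (hsub θ (hN θ)) (hsub θ₀ hθ) ⟨r', hr', rfl⟩ ⟨r, hr, rfl⟩
    have h1 := (hlim θ θ (hN θ)).sub (hlim θ₀ θ hθ)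
    have h2 : Filter.Tendsto (fun _ : ℝ => F θ (X.φ i (θ, r)) - F θ₀ (X.φ i (θ, r))) lf
        (𝓝 (0 - 0)) := by
      refine h1.congr' ?_
      filter_upwards [hlf] with r' hr'
      rw [← hc r' hr']
      ring
    have h3 := tendsto_nhds_unique h2 tendsto_const_nhds
    linarith
  -- At each point the local primitive attached to its own link coordinate is used; near `φ (θ₀,
  -- r₀)` this coincides with the single primitive `F θ₀`.
  refine ⟨fun x => F (X.ψ i x).1 x, ?_, fun θ => ?_⟩
  · rintro _ ⟨⟨θ₀, r₀⟩, ⟨-, hr₀⟩, rfl⟩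
    have hx : X.φ i (θ₀, r₀) ∈ X.φ i '' (N θ₀ ×ˢ openRadii (X.b i) i) := ⟨(θ₀, r₀), ⟨hN θ₀, hr₀⟩, rfl⟩
    refine (hF θ₀ _ hx).congr ?_
    filter_upwards [(hWo θ₀).mem_nhds hx]
    rintro _ ⟨⟨θ, r⟩, ⟨hθ, hr⟩, rfl⟩
    rw [X.ψ_φ hr]
    exact key θ₀ θ hθ r hr
  · refine (hlim θ θ (hN θ)).congr' ?_
    filter_upwards [hlf] with r hr
    rw [X.ψ_φ hr]

omit [∀ i, IsManifold (𝓡 n) ∞ (Lk i)] in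
theorem exists_ball_subset_target {i : Fin s ⊕ Fin l} (θ₀ : Lk i)
    {P : EuclideanSpace ℝ (Fin n) → Prop} (hP : ∀ᶠ u in 𝓝 (extChartAt (𝓡 n) θ₀ θ₀), P u) :
    ∃ ρ > 0, Metric.ball (extChartAt (𝓡 n) θ₀ θ₀) ρ ⊆ (extChartAt (𝓡 n) θ₀).target ∧
      ∀ u ∈ Metric.ball (extChartAt (𝓡 n) θ₀ θ₀) ρ, P u := by
  obtain ⟨ρ, hρ, h⟩ := Metric.mem_nhds_iff.1
    (Filter.inter_mem (extChartAt_target_mem_nhds (I := 𝓡 n) θ₀) hP)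
  exact ⟨ρ, hρ, fun u hu => (h hu).1, fun u hu => (h hu).2⟩

/-- A primitive near a slice of an end extends to the whole end. -/
theorem exists_prim_end_of_slice {i : Fin s ⊕ Fin l} {α : OneForm (𝓡 (n + 1)) L}
    (hα : α ∈ closedForms (𝓡 (n + 1)) L) {r₀ : ℝ} (hr₀ : r₀ ∈ openRadii (X.b i) i) {h : L → ℝ}
    (hh : ∀ θ, ∀ᶠ y in 𝓝 (X.φ i (θ, r₀)), IsPrimAt α h y) :
    ∃ F : L → ℝ, (∀ x ∈ X.endSet i, IsPrimAt α F x) ∧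
      ∀ θ, F (X.φ i (θ, r₀)) = h (X.φ i (θ, r₀)) := by
  -- For the filter `pure r₀`, convergence of the difference to zero means equality with `h` on the
  -- slice.
  obtain ⟨F, hF, hlim⟩ := X.exists_prim_end_of_local (i := i) (α := α) (lf := pure r₀) (h := h)
    (by simpa using hr₀) (by
      intro θ₀
      obtain ⟨ρ, hρ, hsub, -⟩ := exists_ball_subset_target (n := n) θ₀ (P := fun _ => True) (by simp)
      obtain ⟨F, hF⟩ := X.exists_prim_linkBall θ₀ hsub hα
      refine ⟨linkBall (n := n) θ₀ ρ, isOpen_linkBall θ₀ ρ, mem_linkBall θ₀ hρ,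
        fun x => F x - (F (X.φ i (θ₀, r₀)) - h (X.φ i (θ₀, r₀))),
        fun x hx => (hF x hx).sub_const _, fun θ hθ => ?_⟩
      have hpre : IsPreconnected ((fun θ => X.φ i (θ, r₀)) '' linkBall (n := n) θ₀ ρ) :=
        (isPreconnected_linkBall θ₀ hsub).image _
          ((X.contMDiffOn_φ i).continuousOn.comp (by fun_prop) fun θ _ => ⟨mem_univ _, hr₀⟩)
      have h1 := sub_eq_sub_of_isPrimAt hpre (α := α) (F := F) (G := h) (by
        rintro _ ⟨θ, hθ, rfl⟩
        exact Filter.eventually_of_mem ((X.isOpen_image_linkBall θ₀ ρ).mem_nhds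
          ⟨(θ, r₀), ⟨hθ, hr₀⟩, rfl⟩) hF) (by
        rintro _ ⟨θ, hθ, rfl⟩
        exact hh θ) (mem_image_of_mem _ hθ) (mem_image_of_mem _ (mem_linkBall θ₀ hρ))
      rw [Filter.tendsto_pure_left]
      intro s hs
      have h2 : F (X.φ i (θ, r₀)) - (F (X.φ i (θ₀, r₀)) - h (X.φ i (θ₀, r₀))) - h (X.φ i (θ, r₀))
        = 0 := by linarith
      rw [h2]
      exact mem_of_mem_nhds hs)
  refine ⟨F, hF, fun θ => ?_⟩
  have h1 := tendsto_nhds_unique (hlim θ) (tendsto_pure_nhds _ _)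
  exact (sub_eq_zero.1 h1.symm)

/-- `|α| = O(r^(β - 1))` along the end `Sᵢ`, in terms of the cone metric. -/
def FormBound (α : OneForm (𝓡 (n + 1)) L) (i : Fin s ⊕ Fin l) (β : ℝ) : Prop :=
  ∃ C, 0 ≤ C ∧ ∀ᶠ r in endFilter i, ∀ θ : Lk i, ∀ w : EuclideanSpace ℝ (Fin n) × ℝ,
    |(α (X.φ i (θ, r)) : EuclideanSpace ℝ (Fin (n + 1)) →L[ℝ] ℝ) (X.dφ i (θ, r) w)| ≤
      C * r ^ (β - 1) * √(w.2 ^ 2 + r ^ 2 * (X.linkMetric i).inner θ w.1 w.1)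

/-- The radial vector `(0, 1)` has unit length for the cone metric, so the derivative of a primitive
along a ray is `O(r^(β - 1))`. The constant `K` serves all rays and all primitives. -/
theorem FormBound.abs_sub_le {α : OneForm (𝓡 (n + 1)) L} {i : Fin s ⊕ Fin l} {β : ℝ}
    (hα : X.FormBound α i β) (hβ : β ≠ 0) :
    ∃ c, 0 < c ∧ closedRadii c i ⊆ openRadii (X.b i) i ∧ ∃ K, ∀ (F : L → ℝ) (θ : Lk i),
      (∀ r ∈ openRadii c i, IsPrimAt α F (X.φ i (θ, r))) → ∀ x ∈ openRadii c i,
      ∀ y ∈ openRadii c i, |F (X.φ i (θ, x)) - F (X.φ i (θ, y))| ≤ K * |x ^ β - y ^ β| := by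
  obtain ⟨C, -, hC⟩ := hα
  obtain ⟨c, hc, hcb, hP⟩ := exists_openRadii_of_eventually (X.b_pos i) hC
  refine ⟨c, hc, hcb, |C / β|, fun F θ hF x hx y hy => ?_⟩
  refine abs_sub_le_of_abs_deriv_le_rpow (isOpen_openRadii c i) (convex_openRadii c i)
    (fun r hr => pos_of_mem_openRadii hc hr) hβ (fun r hr => X.hasDerivAt_radial
      (hcb (openRadii_subset_closedRadii _ _ hr)) (hF r hr)) (fun r hr => ?_) hx hy
  have h1 := hP r (openRadii_subset_closedRadii _ _ hr) θ (0, 1)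
  have h2 : (X.linkMetric i).inner θ (0 : EuclideanSpace ℝ (Fin n)) (0 : EuclideanSpace ℝ (Fin n)) = 0 :=
    ((X.linkMetric i).inner θ _).map_zero
  simpa [h2] using h1

/-- A vector tangent to the link has cone length proportional to `r`, so a primitive has link
derivative `O(r^(β - 1) * r) = O(r^β)`. By the mean value inequality on a coordinate ball, the
values on neighbouring rays approach each other. -/
theorem FormBound.tendsto_sub {α : OneForm (𝓡 (n + 1)) L} {i : Fin s ⊕ Fin l} {β : ℝ}
    (hα : X.FormBound α i β) (hβ : Filter.Tendsto (fun r : ℝ => r ^ β) (endFilter i) (𝓝 0))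
    (θ₀ : Lk i) :
    ∃ ρ > 0, Metric.ball (extChartAt (𝓡 n) θ₀ θ₀) ρ ⊆ (extChartAt (𝓡 n) θ₀).target ∧
      ∀ F : L → ℝ, (∀ x ∈ X.φ i '' (linkBall (n := n) θ₀ ρ ×ˢ openRadii (X.b i) i), IsPrimAt α F x) →
      ∀ θ ∈ linkBall (n := n) θ₀ ρ,
        Filter.Tendsto (fun r => F (X.φ i (θ, r)) - F (X.φ i (θ₀, r))) (endFilter i) (𝓝 0) := by
  have hcont : ContinuousAt (chartBilin (X.linkMetric i).inner θ₀) (extChartAt (𝓡 n) θ₀ θ₀) :=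
    (contDiffOn_chartBilin (X.linkMetric i) θ₀).continuousOn.continuousAt
      (extChartAt_target_mem_nhds θ₀)
  obtain ⟨K, hK⟩ := hcont.norm.isBoundedUnder_le
  obtain ⟨ρ, hρ, hsub, hKb⟩ := exists_ball_subset_target (n := n) θ₀ (Filter.eventually_map.1 hK)
  refine ⟨ρ, hρ, hsub, fun F hF θ hθ => ?_⟩
  obtain ⟨C, hC0, hC⟩ := hα
  have hK0 : 0 ≤ K := (norm_nonneg _).trans (hKb _ (Metric.mem_ball_self hρ))
  have h1 : ∀ᶠ r in endFilter i, ‖F (X.φ i (θ, r)) - F (X.φ i (θ₀, r))‖ ≤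
      C * √K * ‖extChartAt (𝓡 n) θ₀ θ - extChartAt (𝓡 n) θ₀ θ₀‖ * r ^ β := by
    filter_upwards [hC, openRadii_mem_endFilter (X.b_pos i) i] with r hr hrb
    have hr0 : 0 < r := pos_of_mem_openRadii (X.b_pos i) hrb
    have hdom : ∀ u ∈ Metric.ball (extChartAt (𝓡 n) θ₀ θ₀) ρ, (u, r) ∈ X.coordDomain i θ₀ 1 :=
      fun u hu => ⟨hsub hu, by simpa using hrb⟩
    have hd : ∀ u ∈ Metric.ball (extChartAt (𝓡 n) θ₀ θ₀) ρ,
        HasFDerivAt (fun u => F (X.coord i θ₀ 1 (u, r)))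
          ((pullForm α (X.coord i θ₀ 1) (u, r)).comp (ContinuousLinearMap.inl ℝ _ ℝ)) u := by
      intro u hu
      have e1 : MDifferentiableAt 𝓘(ℝ, EuclideanSpace ℝ (Fin n) × ℝ) (𝓡 (n + 1))
          (X.coord i θ₀ 1) (u, r) := ((X.contMDiffOn_coord i θ₀ 1).contMDiffAt
        ((X.isOpen_coordDomain i θ₀ 1).mem_nhds (hdom u hu))).mdifferentiableAt (by simp)
      have e2 : IsPrimAt α F (X.coord i θ₀ 1 (u, r)) := hF _ ⟨_, ⟨by
        rw [linkBall_eq_image θ₀ hsub]; exact mem_image_of_mem _ hu, by simpa using hrb⟩, rfl⟩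
      have e3 : HasFDerivAt (fun u : EuclideanSpace ℝ (Fin n) => (u, r))
        (ContinuousLinearMap.inl ℝ (EuclideanSpace ℝ (Fin n)) ℝ) u := hasFDerivAt_prodMk_left u r
      exact HasFDerivAt.comp u (g := fun q => F (X.coord i θ₀ 1 q)) (f := fun u => (u, r))
        (hasFDerivAt_comp_of_isPrimAt e1 e2) e3
    have hn : ∀ u ∈ Metric.ball (extChartAt (𝓡 n) θ₀ θ₀) ρ,
        ‖(pullForm α (X.coord i θ₀ 1) (u, r)).comp (ContinuousLinearMap.inl ℝ _ ℝ)‖ ≤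
          C * √K * r ^ β := by
      intro u hu
      refine ContinuousLinearMap.opNorm_le_bound _ (by positivity) fun v => ?_
      have e1 := hr ((extChartAt (𝓡 n) θ₀).symm u) (chartFrame (𝓡 n) θ₀ u v, 0)
      have e2 := X.mfderiv_coord (hdom u hu) (v, 0)
      simp only [one_mul] at e2
      have e3 : (pullForm α (X.coord i θ₀ 1) (u, r)).comp (ContinuousLinearMap.inl ℝ _ ℝ) v =
          (α (X.φ i ((extChartAt (𝓡 n) θ₀).symm u, r)) :
            EuclideanSpace ℝ (Fin (n + 1)) →L[ℝ] ℝ)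
          (X.dφ i ((extChartAt (𝓡 n) θ₀).symm u, r) (chartFrame (𝓡 n) θ₀ u v, 0)) := by
        rw [← e2]
        exact oneForm_congr α (by simp [coord]) _
      rw [Real.norm_eq_abs, e3]
      refine e1.trans ?_
      have e4 : (X.linkMetric i).inner ((extChartAt (𝓡 n) θ₀).symm u) (chartFrame (𝓡 n) θ₀ u v)
          (chartFrame (𝓡 n) θ₀ u v) ≤ K * ‖v‖ ^ 2 := by
        rw [← chartBilin_apply]
        have := (chartBilin (X.linkMetric i).inner θ₀ u).le_opNorm₂ v v
        calc _ ≤ ‖chartBilin (X.linkMetric i).inner θ₀ u v v‖ := le_abs_self _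
          _ ≤ _ := this
          _ ≤ K * ‖v‖ * ‖v‖ := by gcongr; exact hKb u hu
          _ = K * ‖v‖ ^ 2 := by ring
      have e5 : √((0 : ℝ) ^ 2 + r ^ 2 * (X.linkMetric i).inner ((extChartAt (𝓡 n) θ₀).symm u)
          (chartFrame (𝓡 n) θ₀ u v) (chartFrame (𝓡 n) θ₀ u v)) ≤ r * (√K * ‖v‖) := by
        -- Here `K` bounds the link metric over the coordinate ball.
        rw [Real.sqrt_le_left (by positivity), mul_pow, mul_pow, Real.sq_sqrt hK0]
        nlinarith [mul_le_mul_of_nonneg_left e4 (sq_nonneg r)]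
      calc _ ≤ C * r ^ (β - 1) * (r * (√K * ‖v‖)) :=
            mul_le_mul_of_nonneg_left e5 (by positivity)
        _ = C * √K * (r ^ (β - 1) * r) * ‖v‖ := by ring
        _ = C * √K * r ^ β * ‖v‖ := by
            rw [← Real.rpow_add_one hr0.ne', sub_add_cancel]
    have h2 := (convex_ball _ _).norm_image_sub_le_of_norm_hasFDerivWithin_le
      (fun u hu => (hd u hu).hasFDerivWithinAt) hn (Metric.mem_ball_self hρ) hθ.2
    simp only [coord, one_mul, (extChartAt (𝓡 n) θ₀).left_inv hθ.1, extChartAt_to_inv] at h2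
    refine h2.trans (le_of_eq ?_)
    ring
  refine squeeze_zero_norm' h1 ?_
  simpa using hβ.const_mul (C * √K * ‖extChartAt (𝓡 n) θ₀ θ - extChartAt (𝓡 n) θ₀ θ₀‖)

/-- Decaying closed forms have decaying primitives on an end. -/
theorem exists_prim_end_of_decay {i : Fin s ⊕ Fin l} {α : OneForm (𝓡 (n + 1)) L}
    (hα : α ∈ closedForms (𝓡 (n + 1)) L) {β : ℝ} (hb : X.FormBound α i β) (hβ0 : β ≠ 0)
    (hβ : Filter.Tendsto (fun r : ℝ => r ^ β) (endFilter i) (𝓝 0)) :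
    ∃ F : L → ℝ, (∀ x ∈ X.endSet i, IsPrimAt α F x) ∧
      ∃ K, ∀ᶠ r in endFilter i, ∀ θ, |F (X.φ i (θ, r))| ≤ K * r ^ β := by
  obtain ⟨c, hc, hcb, K, hK⟩ := hb.abs_sub_le X hβ0
  have hcJ : openRadii c i ⊆ openRadii (X.b i) i := (openRadii_subset_closedRadii c i).trans hcb
  have hcl := openRadii_mem_endFilter hc i
  obtain ⟨F, hF, hlim⟩ := X.exists_prim_end_of_local (i := i) (α := α) (lf := endFilter i)
    (h := fun _ => 0) (openRadii_mem_endFilter (X.b_pos i) i) (by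
      intro θ₀
      obtain ⟨ρ, hρ, hsub, hdiff⟩ := hb.tendsto_sub X hβ θ₀
      obtain ⟨F, hF⟩ := X.exists_prim_linkBall θ₀ hsub hα
      -- The limit along the central ray is subtracted; `hdiff` shows that the other rays of the
      -- ball have the same limit.
      obtain ⟨a, ha, -⟩ := exists_limit_of_abs_sub_le (f := fun r => F (X.φ i (θ₀, r))) hcl
        (hK F θ₀ fun r hr => hF _ ⟨_, ⟨mem_linkBall θ₀ hρ, hcJ hr⟩, rfl⟩) hβ
      refine ⟨linkBall (n := n) θ₀ ρ, isOpen_linkBall θ₀ ρ, mem_linkBall θ₀ hρ,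
        fun x => F x - a, fun x hx => (hF x hx).sub_const _, fun θ hθ => ?_⟩
      have h1 := (hdiff F hF θ hθ).add (ha.sub (tendsto_const_nhds (x := a)))
      simp only [sub_self, add_zero] at h1
      refine h1.congr fun r => ?_
      ring)
  refine ⟨F, hF, K, ?_⟩
  filter_upwards [hcl] with r hr θ
  obtain ⟨a, ha, hbd⟩ := exists_limit_of_abs_sub_le (f := fun r => F (X.φ i (θ, r))) hcl
    (hK F θ fun r hr => hF _ (X.φ_mem_endSet (hcJ hr))) hβ
  -- The limit along each ray has been normalised to zero, so the rate of convergence is a bound on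
  -- `F` itself.
  have h0 := tendsto_nhds_unique ha (by simpa using hlim θ)
  subst h0
  have := hbd r hr
  rwa [sub_zero, abs_of_nonneg (Real.rpow_nonneg (pos_of_mem_openRadii hc hr).le _)] at this

end CSACStructure
end Ends

/-! ### Pointwise meaning of the covariant bounds -/

section PointwiseBounds
open Bundle
variable {E : Type*} [NormedAddCommGroup E] [NormedSpace ℝ E] {H : Type*} [TopologicalSpace H]
  {I : ModelWithCorners ℝ E H} {M : Type*} [TopologicalSpace M] [ChartedSpace H M]

theorem CovBound.congr {g : BilinField I M} {x : M} {k : ℕ} {T S : E → E [×k]→L[ℝ] ℝ} {j : ℕ} {C : ℝ}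
    (h : CovBound g x T j C) (hTS : T =ᶠ[𝓝 (extChartAt I x x)] S) : CovBound g x S j C := by
  unfold CovBound at *
  rwa [← (iterCov_eventuallyEq (chartBilin g x) hTS j).self_of_nhds]

variable [IsManifold I ∞ M] [I.Boundaryless] [FiniteDimensional ℝ E]

theorem chartFrame_surjective (x₀ : M) {u : E} (hu : u ∈ (extChartAt I x₀).target) (w : E) :
    ∃ v : E, (chartFrame I x₀ u v : E) = w :=
  (LinearMap.injective_iff_surjective (K := ℝ) (V := E)
    (f := (chartFrame I x₀ u : E →L[ℝ] E).toLinearMap)).1 (chartFrame_injective x₀ hu) w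

theorem CovBound.abs_form_le {g : BilinField I M} {x : M} {α : OneForm I M} {C : ℝ}
    (h : CovBound g x (fun u => tensor1 (chartForm α x u)) 0 C) (w : E) :
    |(α x : E →L[ℝ] ℝ) w| ≤ C * √((g x : E →L[ℝ] E →L[ℝ] ℝ) w w) := by
  obtain ⟨v, hv⟩ := chartFrame_surjective x (mem_extChartAt_target (I := I) x) w
  have h1 := h (fun _ => v)
  rw [← oneForm_congr α (extChartAt_to_inv (I := I) x) w,
    ← bilinField_congr g (extChartAt_to_inv (I := I) x) w w, ← hv]
  have h2 : ∀ c : ℝ, ∏ _i : Fin (1 + 0), c = c := fun c => by simp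
  rw [h2] at h1
  exact h1

theorem CovBound.abs_bilin_le {g h : BilinField I M} {x : M} {C : ℝ}
    (hb : CovBound g x (fun u => tensor2 (chartBilin h x u)) 0 C) (w : E) :
    |(h x : E →L[ℝ] E →L[ℝ] ℝ) w w| ≤ C * √((g x : E →L[ℝ] E →L[ℝ] ℝ) w w) ^ 2 := by
  obtain ⟨v, hv⟩ := chartFrame_surjective x (mem_extChartAt_target (I := I) x) w
  have h1 := hb (fun _ => v)
  rw [← bilinField_congr h (extChartAt_to_inv (I := I) x) w w,
    ← bilinField_congr g (extChartAt_to_inv (I := I) x) w w, ← hv]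
  have h2 : ∀ c : ℝ, ∏ _i : Fin (2 + 0), c = c ^ 2 := fun c => by simp
  rw [h2] at h1
  exact h1

omit [I.Boundaryless] [FiniteDimensional ℝ E] [IsManifold I ∞ M] in
theorem covBound_function_zero_iff {g : BilinField I M} {x : M} {f : M → ℝ} {C : ℝ} :
    CovBound g x (fun u => tensor0 (E := E) (chartFun I f x u)) 0 C ↔ |f x| ≤ C := by
  constructor
  · intro h
    have h1 := h (fun _ => 0)
    have h2 : ∀ c : ℝ, ∏ _i : Fin (0 + 0), c = 1 := fun c => by simp
    rw [h2, mul_one] at h1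
    rw [← extChartAt_to_inv (I := I) x]
    exact h1
  · intro h v
    have h2 : ∀ c : Fin (0 + 0) → ℝ, ∏ i : Fin (0 + 0), c i = 1 := fun c => by simp
    rw [h2, mul_one]
    rw [← extChartAt_to_inv (I := I) x] at h
    exact h

omit [FiniteDimensional ℝ E] in
theorem covDeriv_tensor0 (G : E → E →L[ℝ] E →L[ℝ] ℝ) (f : C^∞⟮I, M; ℝ⟯) (x : M) {u : E}
    (hu : u ∈ (extChartAt I x).target) :
    covDeriv G (fun u => tensor0 (E := E) (chartFun I f x u)) u =
      tensor1 (chartForm (extD I M f) x u) := by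
  ext v
  rw [covDeriv_apply, chartForm_extD f x hu]
  have h1 : ContDiffOn ℝ ∞ (chartFun I f x) (extChartAt I x).target := by
    rw [← contMDiffOn_iff_contDiffOn]
    exact f.contMDiff.comp_contMDiffOn (contMDiffOn_extChartAt_symm x)
  have h2 : HasFDerivAt (chartFun I f x) (fderiv ℝ (chartFun I f x) u) u :=
    ((h1.contDiffAt ((isOpen_extChartAt_target x).mem_nhds hu)).differentiableAt
      (by simp)).hasFDerivAt
  have h3 : HasFDerivAt (fun u => tensor0 (E := E) (chartFun I f x u)) _ u :=
    ((continuousMultilinearCurryFin0 ℝ E ℝ).symm.toContinuousLinearEquiv :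
      ℝ →L[ℝ] (E [×0]→L[ℝ] ℝ)).hasFDerivAt.comp u h2
  rw [h3.fderiv]
  simp only [Finset.univ_eq_empty, Finset.sum_empty, sub_zero]
  rfl

-- This is `∇ʲ⁺¹f = ∇ʲ(df)`. It reduces the conditions of positive order on a function to conditions
-- on its differential.
omit [FiniteDimensional ℝ E] in
theorem covBound_function_succ_iff {g : BilinField I M} {x : M} {f : C^∞⟮I, M; ℝ⟯} {j : ℕ} {C : ℝ} :
    CovBound g x (fun u => tensor0 (E := E) (chartFun I f x u)) (j + 1) C ↔
      CovBound g x (fun u => tensor1 (chartForm (extD I M f) x u)) j C := by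
  have h1 : covDeriv (chartBilin g x) (fun u => tensor0 (E := E) (chartFun I f x u))
      =ᶠ[𝓝 (extChartAt I x x)] fun u => tensor1 (chartForm (extD I M f) x u) := by
    filter_upwards [extChartAt_target_mem_nhds (I := I) x] with u hu
      using covDeriv_tensor0 (chartBilin g x) f x hu
  have h2 := normLE_iterCov_covDeriv_iff (chartBilin g x (extChartAt I x x)) (chartBilin g x)
    (fun u => tensor0 (E := E) (chartFun I f x u)) j (extChartAt I x x) C
  refine h2.symm.trans ?_
  rw [(iterCov_eventuallyEq (chartBilin g x) h1 j).self_of_nhds]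
  rfl

omit [IsManifold I ∞ M] [I.Boundaryless] [FiniteDimensional ℝ E] in
theorem chartForm_eventuallyEq {α β : OneForm I M} {x : M} (h : ∀ᶠ y in 𝓝 x, α y = β y) :
    (fun u => tensor1 (chartForm α x u)) =ᶠ[𝓝 (extChartAt I x x)]
      fun u => tensor1 (chartForm β x u) := by
  have h1 : ∀ᶠ u in 𝓝 (extChartAt I x x), α ((extChartAt I x).symm u) = β ((extChartAt I x).symm u) := by
    refine (continuousAt_extChartAt_symm (I := I) x).eventually (p := fun y => α y = β y) ?_
    rwa [extChartAt_to_inv]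
  filter_upwards [h1] with u hu
  simp only [chartForm, hu]

end PointwiseBounds

/-! ### The weight conditions along an end -/

section Ends
open Bundle
variable {n s l : ℕ} {L : Type*} [TopologicalSpace L]
    [ChartedSpace (EuclideanSpace ℝ (Fin (n + 1))) L] [IsManifold (𝓡 (n + 1)) ∞ L]
    {g : Metric (n + 1) L}
    {Lk : Fin s ⊕ Fin l → Type*} [∀ i, TopologicalSpace (Lk i)]
    [∀ i, ChartedSpace (EuclideanSpace ℝ (Fin n)) (Lk i)] [∀ i, IsManifold (𝓡 n) ∞ (Lk i)]
    (X : CSACStructure g Lk)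

namespace CSACStructure

theorem tendsto_rpow_rate (i : Fin s ⊕ Fin l) :
    Filter.Tendsto (fun r : ℝ => r ^ X.rate i) (endFilter i) (𝓝 0) := by
  cases i with
  | inl i =>
    have h := (Real.continuousAt_rpow_const 0 (X.rate (.inl i)) (Or.inr (X.rate_pos i).le)).tendsto
    rw [Real.zero_rpow (X.rate_pos i).ne'] at h
    exact h.mono_left nhdsWithin_le_nhds
  | inr i =>
    have h := tendsto_rpow_neg_atTop (neg_pos.2 (X.rate_neg i))
    rwa [neg_neg] at h

omit [∀ i, ChartedSpace (EuclideanSpace ℝ (Fin n)) (Lk i)] [∀ i, IsManifold (𝓡 n) ∞ (Lk i)]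
  [∀ i, TopologicalSpace (Lk i)] in
theorem coneMetric_apply {S : Type*} [TopologicalSpace S] [ChartedSpace (EuclideanSpace ℝ (Fin n)) S]
    [IsManifold (𝓡 n) ∞ S] (g' : Metric n S) (p : S × ℝ) (v w : EuclideanSpace ℝ (Fin n) × ℝ) :
    (coneMetric g' p : (EuclideanSpace ℝ (Fin n) × ℝ) →L[ℝ] (EuclideanSpace ℝ (Fin n) × ℝ) →L[ℝ] ℝ)
      v w = v.2 * w.2 + p.2 ^ 2 * g'.inner p.1 v.1 w.1 := by
  have h1 : ∀ w : EuclideanSpace ℝ (Fin n) × ℝ,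
      (mvfderiv ((𝓡 n).prod 𝓘(ℝ, ℝ)) (Prod.snd : S × ℝ → ℝ) p :
        (EuclideanSpace ℝ (Fin n) × ℝ) →L[ℝ] ℝ) w = w.2 := fun w =>
    congrArg (fun A : (EuclideanSpace ℝ (Fin n) × ℝ) →L[ℝ] ℝ => A w)
      (mfderiv_snd (I := 𝓡 n) (I' := 𝓘(ℝ, ℝ)) (x := p))
  have h2 : ∀ w : EuclideanSpace ℝ (Fin n) × ℝ,
      (mfderiv ((𝓡 n).prod 𝓘(ℝ, ℝ)) (𝓡 n) (Prod.fst : S × ℝ → S) p :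
        (EuclideanSpace ℝ (Fin n) × ℝ) →L[ℝ] EuclideanSpace ℝ (Fin n)) w = w.1 := fun w =>
    congrArg (fun A : (EuclideanSpace ℝ (Fin n) × ℝ) →L[ℝ] EuclideanSpace ℝ (Fin n) => A w)
      (mfderiv_fst (I := 𝓡 n) (I' := 𝓘(ℝ, ℝ)) (x := p))
  rw [← h1 v, ← h1 w, ← h2 v, ← h2 w]
  rfl

/-- The asymptotic condition of order zero bounds `φ*g - g̃` by `C r^ν g̃`, and `r^ν < 1` far along
the end; hence the constant `1 + |C|`. -/
theorem eventually_metric_le (i : Fin s ⊕ Fin l) :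
    ∃ C, 0 ≤ C ∧ ∀ᶠ r in endFilter i, ∀ θ : Lk i, ∀ w : EuclideanSpace ℝ (Fin n) × ℝ,
      (g.inner (X.φ i (θ, r)) : EuclideanSpace ℝ (Fin (n + 1)) →L[ℝ] EuclideanSpace ℝ (Fin (n + 1))
        →L[ℝ] ℝ) (X.dφ i (θ, r) w) (X.dφ i (θ, r) w) ≤
        C * (w.2 ^ 2 + r ^ 2 * (X.linkMetric i).inner θ w.1 w.1) := by
  obtain ⟨C, hC⟩ := X.asymptotic i 0
  refine ⟨1 + |C|, by positivity, ?_⟩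
  filter_upwards [hC, (X.tendsto_rpow_rate i).eventually (gt_mem_nhds one_pos),
    openRadii_mem_endFilter (X.b_pos i) i] with r hr hr1 hrb θ w
  have hr0 : 0 < r := pos_of_mem_openRadii (X.b_pos i) hrb
  have h1 := (hr θ).abs_bilin_le w
  have h2 : 0 ≤ w.2 ^ 2 + r ^ 2 * (X.linkMetric i).inner θ w.1 w.1 := by
    have : 0 ≤ (X.linkMetric i).inner θ w.1 w.1 := by
      by_cases h : w.1 = 0
      · rw [h]
        exact le_of_eq (((X.linkMetric i).inner θ _).map_zero).symm
      · exact ((X.linkMetric i).pos θ w.1 h).le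
    positivity
  have h3 := coneMetric_apply (X.linkMetric i) (θ, r) w w
  rw [h3, Real.sq_sqrt (by simpa [pow_two] using h2)] at h1
  have h4 : (g.inner (X.φ i (θ, r)) : EuclideanSpace ℝ (Fin (n + 1)) →L[ℝ]
      EuclideanSpace ℝ (Fin (n + 1)) →L[ℝ] ℝ) (X.dφ i (θ, r) w) (X.dφ i (θ, r) w) =
    ((pullbackBilin ((𝓡 n).prod 𝓘(ℝ, ℝ)) (𝓡 (n + 1)) (X.φ i) g.inner
          - coneMetric (X.linkMetric i)) (θ, r) : (EuclideanSpace ℝ (Fin n) × ℝ) →L[ℝ]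
            (EuclideanSpace ℝ (Fin n) × ℝ) →L[ℝ] ℝ) w w +
      (coneMetric (X.linkMetric i) (θ, r) : (EuclideanSpace ℝ (Fin n) × ℝ) →L[ℝ]
            (EuclideanSpace ℝ (Fin n) × ℝ) →L[ℝ] ℝ) w w :=
    (sub_add_cancel ((pullbackBilin ((𝓡 n).prod 𝓘(ℝ, ℝ)) (𝓡 (n + 1)) (X.φ i) g.inner (θ, r) :
      (EuclideanSpace ℝ (Fin n) × ℝ) →L[ℝ] (EuclideanSpace ℝ (Fin n) × ℝ) →L[ℝ] ℝ) w w) _).symm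
  rw [h4, h3]
  have h5 : C * r ^ (X.rate i - ((0 : ℕ) : ℝ)) ≤ |C| := by
    rw [Nat.cast_zero, sub_zero]
    calc C * r ^ X.rate i ≤ |C| * r ^ X.rate i :=
          mul_le_mul_of_nonneg_right (le_abs_self C) (Real.rpow_nonneg hr0.le _)
      _ ≤ |C| * 1 := mul_le_mul_of_nonneg_left hr1.le (abs_nonneg C)
      _ = |C| := mul_one _
  have h6 := (le_abs_self _).trans (h1.trans (mul_le_mul_of_nonneg_right h5 (by simpa [pow_two] using h2)))
  simp only at h6 ⊢
  nlinarith [h6]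

/-- The condition defining `C^∞_β(Λ¹)` along the end `Sᵢ`. -/
def FormWeight (i : Fin s ⊕ Fin l) (β : ℝ) (α : OneForm (𝓡 (n + 1)) L) : Prop :=
  ∀ j : ℕ, ∃ C : ℝ, ∀ᶠ r in endFilter i, ∀ θ : Lk i,
    CovBound g.inner (X.φ i (θ, r))
      (fun u => tensor1 (chartForm α (X.φ i (θ, r)) u)) j (C * r ^ (β - j))

theorem FormWeight.formBound {i : Fin s ⊕ Fin l} {β : ℝ} {α : OneForm (𝓡 (n + 1)) L}
    (h : X.FormWeight i (β - 1) α) : X.FormBound α i β := by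
  obtain ⟨C, hC⟩ := h 0
  obtain ⟨D, hD0, hD⟩ := X.eventually_metric_le i
  refine ⟨|C| * √D, by positivity, ?_⟩
  filter_upwards [hC, hD, openRadii_mem_endFilter (X.b_pos i) i] with r h1 h2 hrb θ w
  have hr0 : 0 < r := pos_of_mem_openRadii (X.b_pos i) hrb
  refine ((h1 θ).abs_form_le (X.dφ i (θ, r) w)).trans ?_
  rw [Nat.cast_zero, sub_zero]
  calc _ ≤ |C| * r ^ (β - 1) * √(D * (w.2 ^ 2 + r ^ 2 * (X.linkMetric i).inner θ w.1 w.1)) :=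
        mul_le_mul (mul_le_mul_of_nonneg_right (le_abs_self C) (by positivity))
          (Real.sqrt_le_sqrt (h2 θ w)) (Real.sqrt_nonneg _) (by positivity)
    _ = _ := by rw [Real.sqrt_mul hD0]; ring

/-- A smaller end is open in `L`, so equalities that hold far along an end hold near each of its
points and can be differentiated. -/
theorem eventually_nhds_of_eventually {i : Fin s ⊕ Fin l} {P : L → Prop}
    (h : ∀ᶠ r in endFilter i, ∀ θ, P (X.φ i (θ, r))) :
    ∀ᶠ r in endFilter i, ∀ θ, ∀ᶠ y in 𝓝 (X.φ i (θ, r)), P y := by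
  obtain ⟨c, hc, hcb, hP⟩ := exists_openRadii_of_eventually (X.b_pos i) h
  have hcJ : openRadii c i ⊆ openRadii (X.b i) i := (openRadii_subset_closedRadii c i).trans hcb
  filter_upwards [openRadii_mem_endFilter hc i] with r hr θ
  filter_upwards [(X.isOpen_image_φ (isOpen_domain i c) (prod_mono_right hcJ)).mem_nhds
    (mem_image_of_mem _ (show ((θ, r) : Lk i × ℝ) ∈ univ ×ˢ openRadii c i from ⟨mem_univ _, hr⟩))]
  rintro _ ⟨p, ⟨-, hp⟩, rfl⟩
  exact hP _ (openRadii_subset_closedRadii _ _ hp) p.1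

theorem FormWeight.congr {i : Fin s ⊕ Fin l} {β : ℝ} {α α' : OneForm (𝓡 (n + 1)) L}
    (h : X.FormWeight i β α) (hα : ∀ᶠ r in endFilter i, ∀ θ, α (X.φ i (θ, r)) = α' (X.φ i (θ, r))) :
    X.FormWeight i β α' := by
  intro j
  obtain ⟨C, hC⟩ := h j
  refine ⟨C, ?_⟩
  filter_upwards [hC, X.eventually_nhds_of_eventually (P := fun x => α x = α' x) hα] with r h1 h2 θ
  exact (h1 θ).congr (chartForm_eventuallyEq (h2 θ))

theorem formWeight_zero (i : Fin s ⊕ Fin l) (β : ℝ) : X.FormWeight i β 0 := fun j =>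
  ⟨0, Filter.Eventually.of_forall fun r θ => by
    rw [zero_mul]
    exact CovBound.zero (g := g) (k := 1) j⟩

theorem formWeight_of_eventually_zero {i : Fin s ⊕ Fin l} {β : ℝ} {α : OneForm (𝓡 (n + 1)) L}
    (hα : ∀ᶠ r in endFilter i, ∀ θ, α (X.φ i (θ, r)) = 0) : X.FormWeight i β α :=
  (X.formWeight_zero i β).congr X (by
    filter_upwards [hα] with r hr θ
    exact (hr θ).symm)

theorem mem_weightedForms_iff {β : Fin s ⊕ Fin l → ℝ} {α : OneForm (𝓡 (n + 1)) L} :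
    α ∈ X.weightedForms β ↔ α ∈ smoothForms (𝓡 (n + 1)) L ∧ ∀ i, X.FormWeight i (β i) α := Iff.rfl

/-- With this criterion only the size of a primitive has to be estimated, since the weight of its
differential is known beforehand. -/
theorem mem_weightedFunctions_iff {β : Fin s ⊕ Fin l → ℝ} {f : C^∞⟮𝓡 (n + 1), L; ℝ⟯} :
    f ∈ X.weightedFunctions β ↔ ∀ i,
      (∃ C, ∀ᶠ r in endFilter i, ∀ θ, |f (X.φ i (θ, r))| ≤ C * r ^ β i) ∧
        X.FormWeight i (β i - 1) (extD (𝓡 (n + 1)) L f) := by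
  refine forall_congr' fun i => ?_
  constructor
  · intro h
    constructor
    · obtain ⟨C, hC⟩ := h 0
      refine ⟨C, ?_⟩
      filter_upwards [hC] with r hr θ
      have := covBound_function_zero_iff.1 (hr θ)
      rwa [Nat.cast_zero, sub_zero] at this
    · intro j
      obtain ⟨C, hC⟩ := h (j + 1)
      refine ⟨C, ?_⟩
      filter_upwards [hC] with r hr θ
      have e : β i - 1 - (j : ℝ) = β i - ((j + 1 : ℕ) : ℝ) := by push_cast; ring
      rw [e]
      exact covBound_function_succ_iff.1 (hr θ)
  · rintro ⟨⟨C, hC⟩, h⟩ j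
    rcases j with _ | j
    · refine ⟨C, ?_⟩
      filter_upwards [hC] with r hr θ
      rw [Nat.cast_zero, sub_zero]
      exact covBound_function_zero_iff.2 (hr θ)
    · obtain ⟨C, hC⟩ := h j
      refine ⟨C, ?_⟩
      filter_upwards [hC] with r hr θ
      have e : β i - ((j + 1 : ℕ) : ℝ) = β i - 1 - (j : ℝ) := by push_cast; ring
      rw [e]
      exact covBound_function_succ_iff.2 (hr θ)

end CSACStructure
end Ends

/-! ### Covariant bounds in arbitrary coordinates -/

section PullBack
open Bundle
variable {E : Type*} [NormedAddCommGroup E] [NormedSpace ℝ E] {H : Type*} [TopologicalSpace H]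
  {I : ModelWithCorners ℝ E H} {M : Type*} [TopologicalSpace M] [ChartedSpace H M]
  {E₁ : Type*} [NormedAddCommGroup E₁] [NormedSpace ℝ E₁]

/-- The pull-back of a field of bilinear forms by a map defined on a normed space. -/
def pullBilin (h : BilinField I M) (κ : E₁ → M) (p : E₁) : E₁ →L[ℝ] E₁ →L[ℝ] ℝ :=
  pullbackBilin 𝓘(ℝ, E₁) I κ h p

theorem pullBilin_apply (h : BilinField I M) (κ : E₁ → M) (p v w : E₁) :
    pullBilin h κ p v w = (h (κ p) : E →L[ℝ] E →L[ℝ] ℝ) (mfderiv 𝓘(ℝ, E₁) I κ p v : E)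
      (mfderiv 𝓘(ℝ, E₁) I κ p w : E) := rfl

variable [IsManifold I ∞ M] [I.Boundaryless]

theorem pullBilin_apply_eq {κ : E₁ → M} {q : E₁} {x₀ : M} (h : BilinField I M)
    (hκ : MDifferentiableAt 𝓘(ℝ, E₁) I κ q) (hq : κ q ∈ (extChartAt I x₀).source) (v w : E₁) :
    pullBilin h κ q v w = chartBilin h x₀ (extChartAt I x₀ (κ q))
      (fderiv ℝ (fun y => extChartAt I x₀ (κ y)) q v)
      (fderiv ℝ (fun y => extChartAt I x₀ (κ y)) q w) := by
  rw [pullBilin_apply, mfderiv_apply_eq_chartFrame hκ hq v, mfderiv_apply_eq_chartFrame hκ hq w]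
  exact bilinField_congr h ((extChartAt I x₀).left_inv hq).symm _ _

theorem contDiffOn_pullBilin {κ : E₁ → M} {Ω : Set E₁} (hΩ : IsOpen Ω)
    (hκ : ContMDiffOn 𝓘(ℝ, E₁) I ∞ κ Ω) {h : BilinField I M}
    (hh : ∀ p ∈ Ω, ContDiffAt ℝ ∞ (chartBilin h (κ p)) (extChartAt I (κ p) (κ p))) :
    ContDiffOn ℝ ∞ (pullBilin h κ) Ω := by
  intro p hp
  have hs := mem_extChartAt_source (I := I) (κ p)
  have h1 := contDiffAt_extChartAt_comp hΩ hκ hp hs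
  have h2 : ContDiffAt ℝ ∞ (fun q => chartBilin h (κ p) (extChartAt I (κ p) (κ q))) p :=
    ContDiffAt.comp (g := chartBilin h (κ p)) p (hh p hp) h1
  have h3 : ContDiffAt ℝ ∞ (fderiv ℝ fun y => extChartAt I (κ p) (κ y)) p :=
    h1.fderiv_right (m := ∞) (by simp)
  have h4 : ContDiffAt ℝ ∞ (fun q => ContinuousLinearMap.precomp ℝ
      (fderiv ℝ (fun y => extChartAt I (κ p) (κ y)) q) : E₁ → (E →L[ℝ] ℝ) →L[ℝ] (E₁ →L[ℝ] ℝ)) p :=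
    (ContinuousLinearMap.compL ℝ E₁ E ℝ).flip.contDiff.contDiffAt.comp p h3
  have h5 := h4.clm_comp (h2.clm_comp h3)
  refine (h5.congr_of_eventuallyEq ?_).contDiffWithinAt
  filter_upwards [hΩ.mem_nhds hp, (hκ.continuousOn.continuousAt (hΩ.mem_nhds hp))
    ((isOpen_extChartAt_source (I := I) (κ p)).mem_nhds hs)] with q hq hq'
  ext v w
  exact pullBilin_apply_eq h ((hκ.contMDiffAt (hΩ.mem_nhds hq)).mdifferentiableAt (by simp)) hq' v w

/-- Covariant derivatives may be computed in arbitrary coordinates, after a constant rescaling of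
the metric. -/
theorem covBound_iff_of_pullBilin [FiniteDimensional ℝ E] {κ : E₁ → M} {Ω : Set E₁} (hΩ : IsOpen Ω)
    (hκ : ContMDiffOn 𝓘(ℝ, E₁) I ∞ κ Ω)
    (hs : ∀ q ∈ Ω, Function.Surjective (mfderiv 𝓘(ℝ, E₁) I κ q))
    {G : E₁ → E₁ →L[ℝ] E₁ →L[ℝ] ℝ} (hG : SmoothNondeg G Ω) {h : BilinField I M} {c : ℝ}
    (hGc : ∀ q ∈ Ω, ∀ v w, pullBilin h κ q v w = c * G q v w) {p : E₁} (hp : p ∈ Ω)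
    {N : Set E} (hN : IsOpen N) (hpN : extChartAt I (κ p) (κ p) ∈ N)
    (hNt : N ⊆ (extChartAt I (κ p)).target)
    (hh : SmoothNondeg (chartBilin h (κ p)) N)
    (hsymm : ∀ u ∈ N, ∀ v w, chartBilin h (κ p) u v w = chartBilin h (κ p) u w v) {k : ℕ}
    {T' : E → E [×k]→L[ℝ] ℝ} (hT' : ContDiffOn ℝ ∞ T' N) {T : E₁ → E₁ [×k]→L[ℝ] ℝ}
    (hT : ∀ q ∈ Ω, κ q ∈ (extChartAt I (κ p)).source →
      T q = (T' (extChartAt I (κ p) (κ q))).compContinuousLinearMap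
        fun _ => fderiv ℝ (fun y => extChartAt I (κ p) (κ y)) q) (j : ℕ) (C : ℝ) :
    CovBound h (κ p) T' j C ↔ NormLE (c • G p) (iterCov G T j p) C := by
  have := FiniteDimensional.complete ℝ E
  set Φ : E₁ → E := fun y => extChartAt I (κ p) (κ y) with hΦ
  set V : Set E₁ := Ω ∩ κ ⁻¹' (extChartAt I (κ p)).source with hV
  have hVo : IsOpen V := hκ.continuousOn.isOpen_inter_preimage hΩ (isOpen_extChartAt_source _)
  have hΦs : ContDiffOn ℝ ∞ Φ V := fun q hq =>
    (contDiffAt_extChartAt_comp hΩ hκ hq.1 hq.2).contDiffWithinAt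
  have hUo : IsOpen (V ∩ Φ ⁻¹' N) := hΦs.continuousOn.isOpen_inter_preimage hVo hN
  have hd : ∀ q ∈ Ω, MDifferentiableAt 𝓘(ℝ, E₁) I κ q := fun q hq =>
    (hκ.contMDiffAt (hΩ.mem_nhds hq)).mdifferentiableAt (by simp)
  -- The change from the coordinates `κ` to the chart at `κ p` is a conformal pull-back on the open
  -- set where both are usable.
  have key : ConformalPullback G (V ∩ Φ ⁻¹' N) (chartBilin h (κ p)) N Φ c :=
    { isOpen := hUo
      isOpen' := hN
      smooth := hΦs.mono inter_subset_left
      mapsTo := fun q hq => hq.2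
      surj := fun q hq w => by
        obtain ⟨v, hv⟩ := hs q hq.1.1 (chartFrame I (κ p) (Φ q) w : E)
        refine ⟨v, chartFrame_injective (κ p) (hNt hq.2) ?_⟩
        exact (mfderiv_apply_eq_chartFrame (hd q hq.1.1) hq.1.2 v).symm.trans hv
      nondeg := ⟨hG.smooth.mono fun q hq => hq.1.1, fun q hq => hG.inv q hq.1.1⟩
      nondeg' := hh
      symm' := hsymm
      eq := fun q hq v w => by
        rw [← hGc q hq.1.1, pullBilin_apply_eq h (hd q hq.1.1) hq.1.2] }
  exact key.normLE_iff hT' (fun q hq => hT q hq.1.1 hq.1.2) j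
    ⟨⟨hp, mem_extChartAt_source (I := I) (κ p)⟩, hpN⟩ C

end PullBack

/-! ### Positive definite forms and coercivity -/

section PositiveForms
variable {E : Type*} [NormedAddCommGroup E] [NormedSpace ℝ E] [FiniteDimensional ℝ E]

theorem isInvertible_of_pos {B : E →L[ℝ] E →L[ℝ] ℝ} (hB : ∀ v, v ≠ 0 → 0 < B v v) :
    B.IsInvertible := by
  have hinj : Function.Injective B.toLinearMap := by
    rw [← LinearMap.ker_eq_bot, LinearMap.ker_eq_bot']
    intro v hv
    by_contra hne
    have h2 : B v v = 0 := congrArg (fun f : E →L[ℝ] ℝ => f v) hv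
    exact (hB v hne).ne' h2
  have hdim : Module.finrank ℝ E = Module.finrank ℝ (E →L[ℝ] ℝ) := by
    rw [← (LinearMap.toContinuousLinearMap (𝕜 := ℝ) (E := E) (F' := ℝ)).finrank_eq]
    exact (Subspace.dual_finrank_eq (K := ℝ) (V := E)).symm
  exact ⟨(LinearEquiv.ofInjectiveOfFinrankEq _ hinj hdim).toContinuousLinearEquiv, by ext v w; rfl⟩

/-- For `v = B⁻¹ f` one has `m ‖v‖² ≤ B v v = f v ≤ ‖f‖ ‖v‖`. This supplies the bound on the inverse
metric needed for the Christoffel symbols. -/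
theorem norm_inverse_le_of_coercive {B : E →L[ℝ] E →L[ℝ] ℝ} {m : ℝ} (hm : 0 < m)
    (hB : ∀ v, m * ‖v‖ ^ 2 ≤ B v v) : ‖B.inverse‖ ≤ m⁻¹ := by
  have hpos : ∀ v, v ≠ 0 → 0 < B v v := fun v hv =>
    (mul_pos hm (pow_pos (norm_pos_iff.2 hv) 2)).trans_le (hB v)
  obtain ⟨e, he⟩ := isInvertible_of_pos hpos
  refine ContinuousLinearMap.opNorm_le_bound _ (by positivity) fun f => ?_
  have h1 : B (B.inverse f) = f := by rw [← he]; simp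
  set v := B.inverse f
  have h2 := hB v
  rw [h1] at h2
  have h3 : f v ≤ ‖f‖ * ‖v‖ := (le_abs_self _).trans (f.le_opNorm v)
  rcases eq_or_ne ‖v‖ 0 with h0 | h0
  · rw [h0]; positivity
  · have hv : 0 < ‖v‖ := lt_of_le_of_ne (norm_nonneg _) (Ne.symm h0)
    have h4 : m * ‖v‖ ≤ ‖f‖ := by
      refine le_of_mul_le_mul_right ?_ hv
      calc m * ‖v‖ * ‖v‖ = m * ‖v‖ ^ 2 := by ring
        _ ≤ ‖f‖ * ‖v‖ := h2.trans h3
    rw [inv_mul_eq_div, le_div_iff₀ hm]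
    linarith

/-- The constant is the minimum of `B v v` on the unit sphere, which is compact. -/
theorem exists_coercive {B : E →L[ℝ] E →L[ℝ] ℝ} (hB : ∀ v, v ≠ 0 → 0 < B v v) :
    ∃ m, 0 < m ∧ ∀ v, m * ‖v‖ ^ 2 ≤ B v v := by
  rcases subsingleton_or_nontrivial E with hE | hE
  · exact ⟨1, one_pos, fun v => by rw [Subsingleton.elim v 0]; simp⟩
  · have := FiniteDimensional.proper ℝ E
    have hc : Continuous fun v => B v v := B.continuous.clm_apply continuous_id
    obtain ⟨v₀, hv₀, hmin⟩ := (isCompact_sphere (0 : E) 1).exists_isMinOn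
      (NormedSpace.sphere_nonempty.2 zero_le_one) hc.continuousOn
    have h0 : v₀ ≠ 0 := by
      rintro rfl
      simp at hv₀
    refine ⟨B v₀ v₀, hB v₀ h0, fun v => ?_⟩
    rcases eq_or_ne v 0 with rfl | hv
    · simp
    · have hn : ‖v‖ ≠ 0 := norm_ne_zero_iff.2 hv
      have h1 : B v₀ v₀ ≤ B (‖v‖⁻¹ • v) (‖v‖⁻¹ • v) := hmin (by simp [norm_smul, hn])
      simp only [map_smul, smul_apply, smul_eq_mul] at h1
      calc B v₀ v₀ * ‖v‖ ^ 2 ≤ ‖v‖⁻¹ * (‖v‖⁻¹ * B v v) * ‖v‖ ^ 2 := by gcongr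
        _ = B v v := by field_simp

omit [FiniteDimensional ℝ E] in
theorem eventually_coercive {B : E →L[ℝ] E →L[ℝ] ℝ} {m : ℝ} (hm : 0 < m)
    (hB : ∀ v, m * ‖v‖ ^ 2 ≤ B v v) :
    ∀ᶠ A in 𝓝 B, ∀ v, m / 2 * ‖v‖ ^ 2 ≤ (A : E →L[ℝ] E →L[ℝ] ℝ) v v := by
  filter_upwards [Metric.ball_mem_nhds B (half_pos hm)] with A hA v
  rw [Metric.mem_ball, dist_eq_norm] at hA
  have h1 : |(A - B) v v| ≤ m / 2 * ‖v‖ ^ 2 := by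
    calc |(A - B) v v| ≤ ‖A - B‖ * ‖v‖ * ‖v‖ := (A - B).le_opNorm₂ v v
      _ ≤ m / 2 * ‖v‖ * ‖v‖ := by gcongr
      _ = _ := by ring
  have h2 : (A - B) v v = A v v - B v v := rfl
  rw [h2] at h1
  linarith [neg_le_of_abs_le h1, hB v]

end PositiveForms

/-! ### Bilinear forms as tensors of rank two -/

section Tensors
variable {E : Type*} [NormedAddCommGroup E] [NormedSpace ℝ E]

/-- `tensor2` as a continuous linear map. -/
def tensor2L (E : Type*) [NormedAddCommGroup E] [NormedSpace ℝ E] :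
    (E →L[ℝ] E →L[ℝ] ℝ) →L[ℝ] (E [×2]→L[ℝ] ℝ) :=
  ((continuousMultilinearCurryLeftEquiv ℝ (fun _ : Fin 2 => E) ℝ).symm.toContinuousLinearEquiv :
    (E →L[ℝ] (E [×1]→L[ℝ] ℝ)) →L[ℝ] (E [×2]→L[ℝ] ℝ)).comp
  (ContinuousLinearMap.compL ℝ E (E →L[ℝ] ℝ) (E [×1]→L[ℝ] ℝ)
    ((continuousMultilinearCurryFin1 ℝ E ℝ).symm.toContinuousLinearEquiv :
      (E →L[ℝ] ℝ) →L[ℝ] (E [×1]→L[ℝ] ℝ)))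

/-- The inverse of `tensor2`. -/
def ofTensor2L (E : Type*) [NormedAddCommGroup E] [NormedSpace ℝ E] :
    (E [×2]→L[ℝ] ℝ) →L[ℝ] (E →L[ℝ] E →L[ℝ] ℝ) :=
  (ContinuousLinearMap.compL ℝ E (E [×1]→L[ℝ] ℝ) (E →L[ℝ] ℝ)
    ((continuousMultilinearCurryFin1 ℝ E ℝ).toContinuousLinearEquiv :
      (E [×1]→L[ℝ] ℝ) →L[ℝ] (E →L[ℝ] ℝ))).comp
  ((continuousMultilinearCurryLeftEquiv ℝ (fun _ : Fin 2 => E) ℝ).toContinuousLinearEquiv :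
    (E [×2]→L[ℝ] ℝ) →L[ℝ] (E →L[ℝ] (E [×1]→L[ℝ] ℝ)))

theorem ofTensor2L_tensor2 (B : E →L[ℝ] E →L[ℝ] ℝ) : ofTensor2L E (tensor2 B) = B := by
  ext v w; rfl

end Tensors

/-! ### The cone metric and the given metric in rescaled coordinates -/

section Ends
open Bundle
set_option linter.unusedSectionVars false
variable {n s l : ℕ} {L : Type*} [TopologicalSpace L]
    [ChartedSpace (EuclideanSpace ℝ (Fin (n + 1))) L] [IsManifold (𝓡 (n + 1)) ∞ L]
    {g : Metric (n + 1) L}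
    {Lk : Fin s ⊕ Fin l → Type*} [∀ i, TopologicalSpace (Lk i)]
    [∀ i, ChartedSpace (EuclideanSpace ℝ (Fin n)) (Lk i)] [∀ i, IsManifold (𝓡 n) ∞ (Lk i)]
    (X : CSACStructure g Lk)

namespace CSACStructure

/-- The cone metric in the coordinates given by the chart at `θ₀` and the radius. -/
def coneChart (i : Fin s ⊕ Fin l) (θ₀ : Lk i) (p : EuclideanSpace ℝ (Fin n) × ℝ) :
    (EuclideanSpace ℝ (Fin n) × ℝ) →L[ℝ] (EuclideanSpace ℝ (Fin n) × ℝ) →L[ℝ] ℝ :=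
  (ContinuousLinearMap.snd ℝ (EuclideanSpace ℝ (Fin n)) ℝ).smulRight
      (ContinuousLinearMap.snd ℝ (EuclideanSpace ℝ (Fin n)) ℝ)
    + p.2 ^ 2 • (ContinuousLinearMap.precomp ℝ
        (ContinuousLinearMap.fst ℝ (EuclideanSpace ℝ (Fin n)) ℝ)).comp
      ((chartBilin (X.linkMetric i).inner θ₀ p.1).comp
        (ContinuousLinearMap.fst ℝ (EuclideanSpace ℝ (Fin n)) ℝ))

theorem coneChart_apply (i : Fin s ⊕ Fin l) (θ₀ : Lk i)
    (p v w : EuclideanSpace ℝ (Fin n) × ℝ) :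
    X.coneChart i θ₀ p v w =
      v.2 * w.2 + p.2 ^ 2 * chartBilin (X.linkMetric i).inner θ₀ p.1 v.1 w.1 := rfl

theorem coneChart_pos {i : Fin s ⊕ Fin l} {θ₀ : Lk i} {p : EuclideanSpace ℝ (Fin n) × ℝ}
    (hp : p ∈ (extChartAt (𝓡 n) θ₀).target ×ˢ Ioi (0 : ℝ))
    {v : EuclideanSpace ℝ (Fin n) × ℝ} (hv : v ≠ 0) : 0 < X.coneChart i θ₀ p v v := by
  have hp2 : 0 < p.2 := hp.2
  rw [coneChart_apply]
  by_cases h1 : v.1 = 0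
  · have h2 : v.2 ≠ 0 := fun h => hv (Prod.ext h1 h)
    rw [h1, map_zero, mul_zero, add_zero]
    exact mul_self_pos.2 h2
  · have h2 : chartFrame (𝓡 n) θ₀ p.1 v.1 ≠ 0 := fun h =>
      h1 (chartFrame_injective θ₀ hp.1 (h.trans (map_zero _).symm))
    have h3 : 0 < chartBilin (X.linkMetric i).inner θ₀ p.1 v.1 v.1 :=
      (X.linkMetric i).pos _ _ h2
    have : 0 ≤ v.2 * v.2 := mul_self_nonneg _
    positivity

theorem coneChart_symm (i : Fin s ⊕ Fin l) (θ₀ : Lk i) (p v w : EuclideanSpace ℝ (Fin n) × ℝ) :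
    X.coneChart i θ₀ p v w = X.coneChart i θ₀ p w v := by
  rw [coneChart_apply, coneChart_apply, chartBilin_apply, chartBilin_apply,
    (X.linkMetric i).symm _ (chartFrame (𝓡 n) θ₀ p.1 v.1), mul_comm v.2]

theorem smoothNondeg_coneChart (i : Fin s ⊕ Fin l) (θ₀ : Lk i) :
    SmoothNondeg (X.coneChart i θ₀) ((extChartAt (𝓡 n) θ₀).target ×ˢ Ioi (0 : ℝ)) where
  smooth := by
    have h1 : ContDiffOn ℝ ∞ (fun p : EuclideanSpace ℝ (Fin n) × ℝ =>
        chartBilin (X.linkMetric i).inner θ₀ p.1) ((extChartAt (𝓡 n) θ₀).target ×ˢ Ioi (0 : ℝ)) :=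
      (contDiffOn_chartBilin (X.linkMetric i) θ₀).comp contDiffOn_fst fun p hp => hp.1
    exact contDiffOn_const.add ((contDiffOn_snd.pow 2).smul
      (contDiffOn_const.clm_comp (h1.clm_comp contDiffOn_const)))
  inv p hp := isInvertible_of_pos fun v hv => X.coneChart_pos hp hv

/-- Coordinates on `Σᵢ × ℝ`: the chart at `θ₀` on the link and the radius in units of `t`. -/
def scaledChart (i : Fin s ⊕ Fin l) (θ₀ : Lk i) (t : ℝ) :
    EuclideanSpace ℝ (Fin n) × ℝ → Lk i × ℝ :=
  Prod.map (extChartAt (𝓡 n) θ₀).symm (fun r : ℝ => t * r)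

theorem extChartAt_link_prod (i : Fin s ⊕ Fin l) (p : Lk i × ℝ) :
    extChartAt ((𝓡 n).prod 𝓘(ℝ, ℝ)) p =
      (extChartAt (𝓡 n) p.1).prod (PartialEquiv.refl ℝ) := by
  rw [extChartAt_prod, extChartAt_model_space_eq_id]

theorem extChartAt_link_prod_symm (i : Fin s ⊕ Fin l) (p : Lk i × ℝ) :
    ((extChartAt ((𝓡 n).prod 𝓘(ℝ, ℝ)) p).symm : EuclideanSpace ℝ (Fin n) × ℝ → Lk i × ℝ) =
      scaledChart i p.1 1 := by
  rw [extChartAt_link_prod]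
  funext q
  simp [scaledChart]
  rfl

theorem chartFrame_link_prod {i : Fin s ⊕ Fin l} {p : Lk i × ℝ} {u : EuclideanSpace ℝ (Fin n) × ℝ}
    (hu : u.1 ∈ (extChartAt (𝓡 n) p.1).target) (v : EuclideanSpace ℝ (Fin n) × ℝ) :
    (chartFrame ((𝓡 n).prod 𝓘(ℝ, ℝ)) p u v : EuclideanSpace ℝ (Fin n) × ℝ) =
      (chartFrame (𝓡 n) p.1 u.1 v.1, v.2) := by
  have h := mfderiv_scaledChart p.1 1 hu v
  rw [one_mul] at h
  rw [← h]
  unfold chartFrame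
  rw [extChartAt_link_prod_symm]
  rfl

theorem chartBilin_coneMetric {i : Fin s ⊕ Fin l} {p : Lk i × ℝ}
    {u : EuclideanSpace ℝ (Fin n) × ℝ} (hu : u.1 ∈ (extChartAt (𝓡 n) p.1).target) :
    chartBilin (coneMetric (X.linkMetric i)) p u = X.coneChart i p.1 u := by
  refine ContinuousLinearMap.ext fun v => ContinuousLinearMap.ext fun w => ?_
  have h1 : (extChartAt ((𝓡 n).prod 𝓘(ℝ, ℝ)) p).symm u = ((extChartAt (𝓡 n) p.1).symm u.1, u.2) := by
    rw [extChartAt_link_prod_symm]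
    simp [scaledChart]
    rfl
  rw [chartBilin_apply, coneChart_apply]
  refine (bilinField_congr (coneMetric (X.linkMetric i)) h1
    (chartFrame ((𝓡 n).prod 𝓘(ℝ, ℝ)) p u v : EuclideanSpace ℝ (Fin n) × ℝ)
    (chartFrame ((𝓡 n).prod 𝓘(ℝ, ℝ)) p u w : EuclideanSpace ℝ (Fin n) × ℝ)).trans ?_
  rw [chartFrame_link_prod hu v, chartFrame_link_prod hu w]
  exact coneMetric_apply (X.linkMetric i) ((extChartAt (𝓡 n) p.1).symm u.1, u.2)
    (chartFrame (𝓡 n) p.1 u.1 v.1, v.2) (chartFrame (𝓡 n) p.1 u.1 w.1, w.2)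

/-- Homogeneity of the cone: dilating the radius by `t` multiplies the cone metric by `t²`. After
division by `t²` the coordinate expression is independent of `t`. -/
theorem pullBilin_coneMetric {i : Fin s ⊕ Fin l} {θ₀ : Lk i} (t : ℝ)
    {q : EuclideanSpace ℝ (Fin n) × ℝ} (hq : q.1 ∈ (extChartAt (𝓡 n) θ₀).target)
    (v w : EuclideanSpace ℝ (Fin n) × ℝ) :
    pullBilin (coneMetric (X.linkMetric i)) (scaledChart i θ₀ t) q v w =
      t ^ 2 * X.coneChart i θ₀ q v w := by
  have hv := mfderiv_scaledChart θ₀ t hq v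
  have hw := mfderiv_scaledChart θ₀ t hq w
  rw [pullBilin_apply]
  unfold scaledChart
  rw [hv, hw, coneChart_apply, chartBilin_apply]
  refine (coneMetric_apply (X.linkMetric i) (scaledChart i θ₀ t q)
    (chartFrame (𝓡 n) θ₀ q.1 v.1, t * v.2) (chartFrame (𝓡 n) θ₀ q.1 w.1, t * w.2)).trans ?_
  change t * v.2 * (t * w.2) + (t * q.2) ^ 2 * _ = _
  rw [mul_add, mul_pow]
  ring_nf
  rfl

theorem pullBilin_pullbackBilin {i : Fin s ⊕ Fin l} {θ₀ : Lk i} {t : ℝ}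
    {q : EuclideanSpace ℝ (Fin n) × ℝ} (hq : q ∈ X.coordDomain i θ₀ t)
    (v w : EuclideanSpace ℝ (Fin n) × ℝ) :
    pullBilin (pullbackBilin ((𝓡 n).prod 𝓘(ℝ, ℝ)) (𝓡 (n + 1)) (X.φ i) g.inner)
      (scaledChart i θ₀ t) q v w = pullBilin g.inner (X.coord i θ₀ t) q v w := by
  have hv := mfderiv_scaledChart θ₀ t hq.1 v
  have hw := mfderiv_scaledChart θ₀ t hq.1 w
  rw [pullBilin_apply, pullBilin_apply, X.mfderiv_coord hq, X.mfderiv_coord hq]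
  unfold scaledChart
  rw [hv, hw]
  rfl

theorem chartBilin_pullbackBilin {i : Fin s ⊕ Fin l} {p : Lk i × ℝ}
    {u : EuclideanSpace ℝ (Fin n) × ℝ} (hu : u ∈ X.coordDomain i p.1 1) :
    chartBilin (pullbackBilin ((𝓡 n).prod 𝓘(ℝ, ℝ)) (𝓡 (n + 1)) (X.φ i) g.inner) p u =
      pullBilin g.inner (X.coord i p.1 1) u := by
  refine ContinuousLinearMap.ext fun v => ContinuousLinearMap.ext fun w => ?_
  rw [← X.pullBilin_pullbackBilin hu, pullBilin_apply, chartBilin_apply]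
  unfold chartFrame
  rw [extChartAt_link_prod_symm]
  rfl

theorem contDiffOn_pullBilin_coord (i : Fin s ⊕ Fin l) (θ₀ : Lk i) (t : ℝ) :
    ContDiffOn ℝ ∞ (pullBilin g.inner (X.coord i θ₀ t)) (X.coordDomain i θ₀ t) :=
  contDiffOn_pullBilin (X.isOpen_coordDomain i θ₀ t) (X.contMDiffOn_coord i θ₀ t) fun _ _ =>
    (contDiffOn_chartBilin g _).contDiffAt (extChartAt_target_mem_nhds _)

theorem surjective_mfderiv_scaledChart {i : Fin s ⊕ Fin l} {θ₀ : Lk i} {t : ℝ} (ht : t ≠ 0)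
    {q : EuclideanSpace ℝ (Fin n) × ℝ} (hq : q.1 ∈ (extChartAt (𝓡 n) θ₀).target) :
    Function.Surjective (mfderiv 𝓘(ℝ, EuclideanSpace ℝ (Fin n) × ℝ) ((𝓡 n).prod 𝓘(ℝ, ℝ))
      (scaledChart i θ₀ t) q) := by
  intro w
  obtain ⟨v, hv⟩ := chartFrame_surjective θ₀ hq (w : EuclideanSpace ℝ (Fin n) × ℝ).1
  refine ⟨(v, t⁻¹ * (w : EuclideanSpace ℝ (Fin n) × ℝ).2), ?_⟩
  refine (mfderiv_scaledChart θ₀ t hq (v, t⁻¹ * (w : EuclideanSpace ℝ (Fin n) × ℝ).2)).trans ?_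
  exact Prod.ext hv (mul_inv_cancel_left₀ ht _)

theorem surjective_mfderiv_coord {i : Fin s ⊕ Fin l} {θ₀ : Lk i} {t : ℝ} (ht : t ≠ 0)
    {q : EuclideanSpace ℝ (Fin n) × ℝ} (hq : q ∈ X.coordDomain i θ₀ t) :
    Function.Surjective (mfderiv 𝓘(ℝ, EuclideanSpace ℝ (Fin n) × ℝ) (𝓡 (n + 1))
      (X.coord i θ₀ t) q) := by
  intro w
  obtain ⟨v, hv⟩ := X.surjective_mfderiv_φ
    (p := ((extChartAt (𝓡 n) θ₀).symm q.1, t * q.2)) hq.2 w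
  obtain ⟨y, hy⟩ := surjective_mfderiv_scaledChart ht hq.1 v
  have h3 := congrArg (X.dφ i ((extChartAt (𝓡 n) θ₀).symm q.1, t * q.2)) ((mfderiv_scaledChart θ₀ t hq.1 y).symm.trans hy)
  exact ⟨y, (X.mfderiv_coord hq y).trans (h3.trans hv)⟩

/-- Surjectivity and equality of dimensions. Injectivity is what keeps the pulled-back metric
positive definite. -/
theorem injective_mfderiv_coord {i : Fin s ⊕ Fin l} {θ₀ : Lk i} {t : ℝ} (ht : t ≠ 0)
    {q : EuclideanSpace ℝ (Fin n) × ℝ} (hq : q ∈ X.coordDomain i θ₀ t) :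
    Function.Injective (mfderiv 𝓘(ℝ, EuclideanSpace ℝ (Fin n) × ℝ) (𝓡 (n + 1))
      (X.coord i θ₀ t) q) := by
  let A : (EuclideanSpace ℝ (Fin n) × ℝ) →L[ℝ] EuclideanSpace ℝ (Fin (n + 1)) :=
    mfderiv 𝓘(ℝ, EuclideanSpace ℝ (Fin n) × ℝ) (𝓡 (n + 1)) (X.coord i θ₀ t) q
  exact (LinearMap.injective_iff_surjective_of_finrank_eq_finrank (f := A.toLinearMap)
    (by simp)).2 (X.surjective_mfderiv_coord ht hq)

theorem pullBilin_coord_pos {i : Fin s ⊕ Fin l} {θ₀ : Lk i} {t : ℝ} (ht : t ≠ 0)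
    {q : EuclideanSpace ℝ (Fin n) × ℝ} (hq : q ∈ X.coordDomain i θ₀ t)
    {v : EuclideanSpace ℝ (Fin n) × ℝ} (hv : v ≠ 0) :
    0 < pullBilin g.inner (X.coord i θ₀ t) q v v := by
  have h1 : (mfderiv 𝓘(ℝ, EuclideanSpace ℝ (Fin n) × ℝ) (𝓡 (n + 1)) (X.coord i θ₀ t) q v) ≠ 0 :=
    fun h => hv (X.injective_mfderiv_coord ht hq (h.trans (map_zero _).symm))
  exact g.pos _ _ h1

/-- The metric on an end, rescaled by `t⁻²`, in the coordinates in which the radius is measured in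
units of `t`. -/
def scaledMetric (i : Fin s ⊕ Fin l) (θ₀ : Lk i) (t : ℝ) (q : EuclideanSpace ℝ (Fin n) × ℝ) :
    (EuclideanSpace ℝ (Fin n) × ℝ) →L[ℝ] (EuclideanSpace ℝ (Fin n) × ℝ) →L[ℝ] ℝ :=
  (t ^ 2)⁻¹ • pullBilin g.inner (X.coord i θ₀ t) q

theorem sq_mul_scaledMetric {i : Fin s ⊕ Fin l} {θ₀ : Lk i} {t : ℝ} (ht : t ≠ 0)
    (q v w : EuclideanSpace ℝ (Fin n) × ℝ) :
    t ^ 2 * X.scaledMetric i θ₀ t q v w = pullBilin g.inner (X.coord i θ₀ t) q v w :=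
  mul_inv_cancel_left₀ (pow_ne_zero 2 ht) _

theorem smoothNondeg_scaledMetric (i : Fin s ⊕ Fin l) (θ₀ : Lk i) {t : ℝ} (ht : t ≠ 0) :
    SmoothNondeg (X.scaledMetric i θ₀ t) (X.coordDomain i θ₀ t) where
  smooth := (X.contDiffOn_pullBilin_coord i θ₀ t).const_smul _
  inv q hq := isInvertible_of_pos fun v hv => by
    have h1 := X.pullBilin_coord_pos ht hq hv
    have h2 : 0 < t ^ 2 := by positivity
    exact mul_pos (inv_pos.2 h2) h1

/-- The radii relevant after rescaling. -/
def shell (i : Fin s ⊕ Fin l) (θ₀ : Lk i) : Set (EuclideanSpace ℝ (Fin n) × ℝ) :=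
  (extChartAt (𝓡 n) θ₀).target ×ˢ Ioo (1 / 2 : ℝ) 2

theorem isOpen_shell (i : Fin s ⊕ Fin l) (θ₀ : Lk i) : IsOpen (shell (n := n) i θ₀) :=
  (isOpen_extChartAt_target θ₀).prod isOpen_Ioo

theorem shell_subset (i : Fin s ⊕ Fin l) (θ₀ : Lk i) :
    shell (n := n) i θ₀ ⊆ (extChartAt (𝓡 n) θ₀).target ×ˢ Ioi (0 : ℝ) :=
  prod_mono_right fun r hr => lt_trans (by norm_num) hr.1

theorem eventually_mul_mem_openRadii {c : ℝ} (hc : 0 < c) (i : Fin s ⊕ Fin l) :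
    ∀ᶠ t in endFilter i, ∀ r ∈ Ioo (1 / 2 : ℝ) 2, t * r ∈ openRadii c i := by
  cases i with
  | inl i =>
    filter_upwards [Ioo_mem_nhdsGT (half_pos hc)] with t ht r hr
    have h1 : (1 / 2 : ℝ) < r := hr.1
    exact ⟨mul_pos ht.1 (by linarith), by nlinarith [ht.1, ht.2, hr.2]⟩
  | inr i =>
    filter_upwards [Filter.Ioi_mem_atTop (2 * c)] with t ht r hr
    have h1 : 2 * c < t := ht
    have h2 : (1 / 2 : ℝ) < r := hr.1
    change c < t * r
    nlinarith

theorem shell_subset_coordDomain {i : Fin s ⊕ Fin l} (θ₀ : Lk i) {t : ℝ}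
    (ht : ∀ r ∈ Ioo (1 / 2 : ℝ) 2, t * r ∈ openRadii (X.b i) i) :
    shell i θ₀ ⊆ X.coordDomain i θ₀ t := fun q hq => ⟨hq.1, ht q.2 hq.2⟩

theorem mk_one_mem_shell {i : Fin s ⊕ Fin l} {θ₀ : Lk i} {x : EuclideanSpace ℝ (Fin n)}
    (hx : x ∈ (extChartAt (𝓡 n) θ₀).target) : (x, (1 : ℝ)) ∈ shell i θ₀ :=
  ⟨hx, by norm_num, by norm_num⟩

end CSACStructure
end Ends

/-! ### Comparison of tensor norms -/

section NormLE
variable {E : Type*} [NormedAddCommGroup E] [NormedSpace ℝ E] {B : E →L[ℝ] E →L[ℝ] ℝ} {k : ℕ}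
  {T : E [×k]→L[ℝ] ℝ} {C D : ℝ}

theorem NormLE.mono (h : NormLE B T C) (hCD : C ≤ D) : NormLE B T D := fun v =>
  (h v).trans (mul_le_mul_of_nonneg_right hCD (Finset.prod_nonneg fun _ _ => Real.sqrt_nonneg _))

/-- Lengths for `t² B` are `t` times those for `B`, once for each of the `k` arguments. This is the
source of the shift of the weight with the order of differentiation. -/
theorem normLE_smul_iff {t : ℝ} (ht : 0 < t) : NormLE (t ^ 2 • B) T C ↔ NormLE B T (C * t ^ k) := by
  refine forall_congr' fun v => ?_
  have h1 : ∏ i, √((t ^ 2 • B) (v i) (v i)) = t ^ k * ∏ i, √(B (v i) (v i)) := by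
    have h2 : ∀ i, √((t ^ 2 • B) (v i) (v i)) = t * √(B (v i) (v i)) := fun i => by
      change √(t ^ 2 * B (v i) (v i)) = _
      rw [Real.sqrt_mul (sq_nonneg t), Real.sqrt_sq ht.le]
    simp only [h2]
    rw [Finset.prod_mul_distrib, Finset.prod_const, Finset.card_univ, Fintype.card_fin]
  rw [h1, mul_assoc]

theorem NormLE.norm_le (h : NormLE B T C) (hC : 0 ≤ C) (hB : ‖B‖ ≤ D) : ‖T‖ ≤ C * √D ^ k := by
  refine ContinuousMultilinearMap.opNorm_le_bound (by positivity) fun v => ?_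
  have h1 : ∏ i, √(B (v i) (v i)) ≤ √D ^ k * ∏ i, ‖v i‖ := by
    calc ∏ i, √(B (v i) (v i)) ≤ ∏ i, √D * ‖v i‖ := by
          refine Finset.prod_le_prod (fun _ _ => Real.sqrt_nonneg _) fun i _ => ?_
          rw [← Real.sqrt_sq (norm_nonneg (v i)), ← Real.sqrt_mul ((norm_nonneg _).trans hB)]
          refine Real.sqrt_le_sqrt ((le_abs_self _).trans ((B.le_opNorm₂ _ _).trans ?_))
          rw [mul_assoc, ← pow_two]
          gcongr
      _ = _ := by rw [Finset.prod_mul_distrib, Finset.prod_const, Finset.card_univ, Fintype.card_fin]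
  calc ‖T v‖ ≤ C * ∏ i, √(B (v i) (v i)) := h v
    _ ≤ C * (√D ^ k * ∏ i, ‖v i‖) := by gcongr
    _ = _ := by ring

theorem normLE_of_coercive {m : ℝ} (hm : 0 < m) (hB : ∀ v, m * ‖v‖ ^ 2 ≤ B v v) (hT : ‖T‖ ≤ C) :
    NormLE B T (C * (√m)⁻¹ ^ k) := by
  intro v
  have h0 : 0 ≤ C := (norm_nonneg _).trans hT
  have h1 : ∏ i, ‖v i‖ ≤ (√m)⁻¹ ^ k * ∏ i, √(B (v i) (v i)) := by
    calc ∏ i, ‖v i‖ ≤ ∏ i, (√m)⁻¹ * √(B (v i) (v i)) := by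
          refine Finset.prod_le_prod (fun _ _ => norm_nonneg _) fun i _ => ?_
          rw [inv_mul_eq_div, le_div_iff₀ (Real.sqrt_pos.2 hm)]
          refine Real.le_sqrt_of_sq_le ?_
          rw [mul_pow, Real.sq_sqrt hm.le, mul_comm]
          exact hB _
      _ = _ := by rw [Finset.prod_mul_distrib, Finset.prod_const, Finset.card_univ, Fintype.card_fin]
  calc |T v| ≤ ‖T‖ * ∏ i, ‖v i‖ := T.le_opNorm v
    _ ≤ C * ((√m)⁻¹ ^ k * ∏ i, √(B (v i) (v i))) := by gcongr
    _ = _ := by ring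

end NormLE

/-! ### Bounded geometry after rescaling, and the rate of translation-invariant forms -/

section Ends
open Bundle
set_option linter.unusedSectionVars false
variable {n s l : ℕ} {L : Type*} [TopologicalSpace L]
    [ChartedSpace (EuclideanSpace ℝ (Fin (n + 1))) L] [IsManifold (𝓡 (n + 1)) ∞ L]
    {g : Metric (n + 1) L}
    {Lk : Fin s ⊕ Fin l → Type*} [∀ i, TopologicalSpace (Lk i)]
    [∀ i, ChartedSpace (EuclideanSpace ℝ (Fin n)) (Lk i)] [∀ i, IsManifold (𝓡 n) ∞ (Lk i)]
    (X : CSACStructure g Lk)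

namespace CSACStructure

theorem contMDiffOn_shell_scaledChart (i : Fin s ⊕ Fin l) (θ₀ : Lk i) (t : ℝ) :
    ContMDiffOn 𝓘(ℝ, EuclideanSpace ℝ (Fin n) × ℝ) ((𝓡 n).prod 𝓘(ℝ, ℝ)) ∞
      (scaledChart i θ₀ t) (shell (n := n) i θ₀) :=
  (contMDiffOn_scaledChart θ₀ t).mono (prod_mono_right (subset_univ _))

/-- The difference of the rescaled metric and the cone metric. -/
def metricError (i : Fin s ⊕ Fin l) (θ₀ : Lk i) (t : ℝ) (q : EuclideanSpace ℝ (Fin n) × ℝ) :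
    (EuclideanSpace ℝ (Fin n) × ℝ) →L[ℝ] (EuclideanSpace ℝ (Fin n) × ℝ) →L[ℝ] ℝ :=
  X.scaledMetric i θ₀ t q - X.coneChart i θ₀ q

/-- The asymptotics of the metric in rescaled coordinates. -/
theorem eventually_normLE_metricError (i : Fin s ⊕ Fin l) (θ₀ : Lk i) (k : ℕ) :
    ∃ C : ℝ, ∀ᶠ t in endFilter i, ∀ x ∈ (extChartAt (𝓡 n) θ₀).target,
      NormLE (t ^ 2 • X.coneChart i θ₀ (x, 1))
        (iterCov (X.coneChart i θ₀) (t ^ 2 • fun q => tensor2 (X.metricError i θ₀ t q)) k (x, 1))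
        (C * t ^ (X.rate i - k)) := by
  obtain ⟨C, hC⟩ := X.asymptotic i k
  refine ⟨C, ?_⟩
  filter_upwards [hC, openRadii_mem_endFilter (X.b_pos i) i,
    eventually_mul_mem_openRadii (X.b_pos i) i] with t h1 htb ht x hx
  have ht0 : t ≠ 0 := (pos_of_mem_openRadii (X.b_pos i) htb).ne'
  have hp : (x, (1 : ℝ)) ∈ shell i θ₀ := mk_one_mem_shell hx
  have hsub := X.shell_subset_coordDomain θ₀ ht
  -- The point of the end at radius `t` has rescaled radius 1, so evaluating at `(x, 1)` for all `t`
  -- covers the whole end over the chart.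
  set P : Lk i × ℝ := scaledChart i θ₀ t (x, 1) with hP
  have hP1 : P = ((extChartAt (𝓡 n) θ₀).symm x, t) := by
    rw [hP]
    exact Prod.ext rfl (mul_one t)
  have h2 : CovBound (coneMetric (X.linkMetric i)) P
      (fun u => tensor2 (chartBilin
        (pullbackBilin ((𝓡 n).prod 𝓘(ℝ, ℝ)) (𝓡 (n + 1)) (X.φ i) g.inner
          - coneMetric (X.linkMetric i)) P u)) k (C * t ^ (X.rate i - k)) := by
    rw [hP1]
    exact h1 _
  have hP2 : P.2 = t := by rw [hP1]
  -- The chart of `Σ × ℝ` also contains nonpositive radii and radii off the end, where the cone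
  -- metric may degenerate or `φ` is not controlled; `N` excludes them.
  set N : Set (EuclideanSpace ℝ (Fin n) × ℝ) :=
    (extChartAt (𝓡 n) P.1).target ×ˢ openRadii (X.b i) i with hN
  have hNo : IsOpen N := (isOpen_extChartAt_target _).prod (isOpen_openRadii _ i)
  have hNc : N ⊆ X.coordDomain i P.1 1 := fun u hu => ⟨hu.1, by
    change 1 * u.2 ∈ openRadii (X.b i) i
    rw [one_mul]
    exact hu.2⟩
  have hNpos : N ⊆ (extChartAt (𝓡 n) P.1).target ×ˢ Ioi (0 : ℝ) :=
    prod_mono_right fun r hr => pos_of_mem_openRadii (X.b_pos i) hr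
  have hcone : EqOn (chartBilin (coneMetric (X.linkMetric i)) P) (X.coneChart i P.1) N :=
    fun u hu => X.chartBilin_coneMetric hu.1
  have hpull : EqOn (chartBilin
      (pullbackBilin ((𝓡 n).prod 𝓘(ℝ, ℝ)) (𝓡 (n + 1)) (X.φ i) g.inner) P)
      (pullBilin g.inner (X.coord i P.1 1)) N := fun u hu => X.chartBilin_pullbackBilin (hNc hu)
  have hsm1 : ContDiffOn ℝ ∞ (chartBilin (coneMetric (X.linkMetric i)) P) N :=
    ((X.smoothNondeg_coneChart i P.1).smooth.mono hNpos).congr hcone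
  have hsm2 : ContDiffOn ℝ ∞ (chartBilin
      (pullbackBilin ((𝓡 n).prod 𝓘(ℝ, ℝ)) (𝓡 (n + 1)) (X.φ i) g.inner) P) N :=
    ((X.contDiffOn_pullBilin_coord i P.1 1).mono hNc).congr hpull
  -- The conformal factor is `t ^ 2` by homogeneity of the cone, and `φ*g - g̃` pulls back to `t ^
  -- 2` times the rescaled error.
  refine (covBound_iff_of_pullBilin (isOpen_shell i θ₀) (contMDiffOn_shell_scaledChart i θ₀ t)
    (fun q hq => surjective_mfderiv_scaledChart ht0 hq.1)
    (G := X.coneChart i θ₀) ⟨(X.smoothNondeg_coneChart i θ₀).smooth.mono (shell_subset i θ₀),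
      fun q hq => (X.smoothNondeg_coneChart i θ₀).inv q (shell_subset i θ₀ hq)⟩
    (fun q hq v w => X.pullBilin_coneMetric t hq.1 v w) hp (N := N) hNo ?_ ?_ ?_ ?_ ?_ ?_ k _).1 h2
  · rw [extChartAt_link_prod]
    exact ⟨mem_extChartAt_target (I := 𝓡 n) P.1, show P.2 ∈ _ by rwa [hP2]⟩
  · rw [extChartAt_link_prod]
    exact prod_mono_right (subset_univ _)
  · refine ⟨hsm1, fun u hu => ?_⟩
    rw [hcone hu]
    exact (X.smoothNondeg_coneChart i P.1).inv u (hNpos hu)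
  · intro u hu v w
    have e := hcone hu
    change chartBilin (coneMetric (X.linkMetric i)) P u v w =
      chartBilin (coneMetric (X.linkMetric i)) P u w v
    rw [e, X.coneChart_symm]
  · exact (tensor2L (EuclideanSpace ℝ (Fin n) × ℝ)).contDiff.comp_contDiffOn (hsm2.sub hsm1)
  · intro q hq hqs
    ext v
    have hd : MDifferentiableAt 𝓘(ℝ, EuclideanSpace ℝ (Fin n) × ℝ) ((𝓡 n).prod 𝓘(ℝ, ℝ))
        (scaledChart i θ₀ t) q := ((contMDiffOn_shell_scaledChart i θ₀ t).contMDiffAt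
          ((isOpen_shell i θ₀).mem_nhds hq)).mdifferentiableAt (by simp)
    have e := pullBilin_apply_eq (pullbackBilin ((𝓡 n).prod 𝓘(ℝ, ℝ)) (𝓡 (n + 1)) (X.φ i) g.inner
          - coneMetric (X.linkMetric i)) hd hqs (v 0) (v 1)
    refine Eq.trans ?_ e
    change t ^ 2 * (X.scaledMetric i θ₀ t q (v 0) (v 1) - X.coneChart i θ₀ q (v 0) (v 1)) =
      pullBilin (pullbackBilin ((𝓡 n).prod 𝓘(ℝ, ℝ)) (𝓡 (n + 1)) (X.φ i) g.inner)
        (scaledChart i θ₀ t) q (v 0) (v 1) -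
      pullBilin (coneMetric (X.linkMetric i)) (scaledChart i θ₀ t) q (v 0) (v 1)
    rw [X.pullBilin_pullbackBilin (hsub hq), X.pullBilin_coneMetric t hq.1, mul_sub,
      X.sq_mul_scaledMetric ht0]

theorem contDiffOn_metricError {i : Fin s ⊕ Fin l} (θ₀ : Lk i) {t : ℝ} (ht0 : t ≠ 0)
    (ht : ∀ r ∈ Ioo (1 / 2 : ℝ) 2, t * r ∈ openRadii (X.b i) i) :
    ContDiffOn ℝ ∞ (X.metricError i θ₀ t) (shell i θ₀) :=
  ((X.smoothNondeg_scaledMetric i θ₀ ht0).smooth.mono (X.shell_subset_coordDomain θ₀ ht)).sub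
    ((X.smoothNondeg_coneChart i θ₀).smooth.mono (shell_subset i θ₀))

theorem smoothNondeg_shell_coneChart (i : Fin s ⊕ Fin l) (θ₀ : Lk i) :
    SmoothNondeg (X.coneChart i θ₀) (shell i θ₀) :=
  ⟨(X.smoothNondeg_coneChart i θ₀).smooth.mono (shell_subset i θ₀),
    fun q hq => (X.smoothNondeg_coneChart i θ₀).inv q (shell_subset i θ₀ hq)⟩

theorem eventually_normLE_iterCov_metricError (i : Fin s ⊕ Fin l) (θ₀ : Lk i) (k : ℕ) :
    ∃ C : ℝ, 0 ≤ C ∧ ∀ᶠ t in endFilter i, ∀ x ∈ (extChartAt (𝓡 n) θ₀).target,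
      NormLE (X.coneChart i θ₀ (x, 1))
        (iterCov (X.coneChart i θ₀) (fun q => tensor2 (X.metricError i θ₀ t q)) k (x, 1))
        (C * t ^ X.rate i) := by
  obtain ⟨C, hC⟩ := X.eventually_normLE_metricError i θ₀ k
  refine ⟨|C|, abs_nonneg C, ?_⟩
  filter_upwards [hC, openRadii_mem_endFilter (X.b_pos i) i,
    eventually_mul_mem_openRadii (X.b_pos i) i] with t h1 htb ht x hx
  have ht0 : 0 < t := pos_of_mem_openRadii (X.b_pos i) htb
  have h2 := (normLE_smul_iff ht0).1 (h1 x hx)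
  rw [iterCov_smul (T := fun q => tensor2 (X.metricError i θ₀ t q)) (isOpen_shell i θ₀)
    (X.smoothNondeg_shell_coneChart i θ₀)
    ((tensor2L (EuclideanSpace ℝ (Fin n) × ℝ)).contDiff.comp_contDiffOn (X.contDiffOn_metricError θ₀ ht0.ne' ht)) (t ^ 2) k
    (mk_one_mem_shell hx)] at h2
  intro v
  have h3 := h2 v
  set Q := ∏ i_1, √(((X.coneChart i θ₀ (x, 1)) (v i_1)) (v i_1)) with hQ
  have hQ0 : 0 ≤ Q := Finset.prod_nonneg fun _ _ => Real.sqrt_nonneg _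
  change |t ^ 2 * iterCov (X.coneChart i θ₀) (fun q => tensor2 (X.metricError i θ₀ t q)) k (x, 1) v| ≤ _
    at h3
  rw [abs_mul, abs_of_pos (pow_pos ht0 2)] at h3
  -- The error has rank 2 and its `k`-th derivative rank `2 + k`. The powers of `t` combine so that
  -- only `t ^ ν` survives, for every order `k`.
  have h4 : C * t ^ (X.rate i - k) * t ^ (2 + k) = t ^ 2 * (C * t ^ X.rate i) := by
    rw [Real.rpow_sub ht0, Real.rpow_natCast]
    field_simp
    ring
  rw [h4, mul_assoc] at h3
  have h5 := le_of_mul_le_mul_left h3 (pow_pos ht0 2)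
  refine h5.trans ?_
  gcongr
  exact le_abs_self C

section Jets
variable (i : Fin s ⊕ Fin l) (θ₀ : Lk i)

/-- The filter of the coordinates of a point near `θ₀` and of the radii running out along the end. -/
def coordFilter : Filter (EuclideanSpace ℝ (Fin n) × ℝ) :=
  𝓝 (extChartAt (𝓡 n) θ₀ θ₀) ×ˢ endFilter i

theorem eventually_fst_mem_target :
    ∀ᶠ a in coordFilter (n := n) i θ₀, a.1 ∈ (extChartAt (𝓡 n) θ₀).target :=
  Filter.tendsto_fst.eventually (extChartAt_target_mem_nhds θ₀)

theorem eventually_shell : ∀ᶠ a in coordFilter (n := n) i θ₀,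
    IsOpen (shell (n := n) i θ₀) ∧ ((a.1, 1) : EuclideanSpace ℝ (Fin n) × ℝ) ∈ shell i θ₀ := by
  filter_upwards [eventually_fst_mem_target i θ₀] with a ha
  exact ⟨isOpen_shell i θ₀, mk_one_mem_shell ha⟩

theorem eventually_of_radius {P : ℝ → Prop} (h : ∀ᶠ t in endFilter i, P t) :
    ∀ᶠ a in coordFilter (n := n) i θ₀, P a.2 :=
  Filter.tendsto_snd.eventually h

/-- The conditions on the radius that hold eventually. -/
theorem eventually_radius : ∀ᶠ t in endFilter i, 0 < t ∧ shell i θ₀ ⊆ X.coordDomain i θ₀ t := by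
  filter_upwards [openRadii_mem_endFilter (X.b_pos i) i,
    eventually_mul_mem_openRadii (X.b_pos i) i] with t htb ht
  exact ⟨pos_of_mem_openRadii (X.b_pos i) htb, X.shell_subset_coordDomain θ₀ ht⟩

theorem tendsto_coord : Filter.Tendsto (fun a : EuclideanSpace ℝ (Fin n) × ℝ => (a.1, (1 : ℝ)))
    (coordFilter i θ₀) (𝓝 (extChartAt (𝓡 n) θ₀ θ₀, 1)) :=
  Filter.tendsto_fst.prodMk_nhds tendsto_const_nhds

theorem jetsBdd_fixed {V : Type*} [NormedAddCommGroup V] [NormedSpace ℝ V]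
    {F : EuclideanSpace ℝ (Fin n) × ℝ → V} (hF : ContDiffOn ℝ ∞ F (shell i θ₀)) (N : ℕ) :
    JetsBdd (coordFilter i θ₀) (fun _ => shell i θ₀) (fun a => (a.1, 1)) N (fun _ => F) :=
  JetsBdd.fixed (isOpen_shell i θ₀) (mk_one_mem_shell (mem_extChartAt_target θ₀)) hF
    (tendsto_coord i θ₀) (eventually_shell i θ₀) (.of_forall fun _ => subset_rfl)

theorem eventually_smooth_metricError :
    ∀ᶠ a in coordFilter (n := n) i θ₀, ContDiffOn ℝ ∞ (X.metricError i θ₀ a.2) (shell i θ₀) := by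
  refine eventually_of_radius i θ₀ (P := fun t => ContDiffOn ℝ ∞ (X.metricError i θ₀ t) (shell i θ₀)) ?_
  filter_upwards [openRadii_mem_endFilter (X.b_pos i) i,
    eventually_mul_mem_openRadii (X.b_pos i) i] with t htb ht
  exact X.contDiffOn_metricError θ₀ (pos_of_mem_openRadii (X.b_pos i) htb).ne' ht

theorem jetsBdd_coneChart (N : ℕ) :
    JetsBdd (coordFilter i θ₀) (fun _ => shell i θ₀) (fun a => (a.1, 1)) N
      (fun _ => X.coneChart i θ₀) :=
  jetsBdd_fixed i θ₀ (X.smoothNondeg_shell_coneChart i θ₀).smooth N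

/-- Every covariant derivative of the error with respect to the cone metric is at most `C t^ν ≤ C`;
since the Christoffel symbols of the cone do not depend on `t`, these bounds turn into bounds on
ordinary derivatives. -/
theorem jetsBdd_metricError (N : ℕ) :
    JetsBdd (coordFilter i θ₀) (fun _ => shell i θ₀) (fun a => (a.1, 1)) N
      (fun a => X.metricError i θ₀ a.2) := by
  have h1 : ∀ j, JetsBdd (coordFilter i θ₀) (fun _ => shell i θ₀) (fun a => (a.1, 1)) 0
      (fun a => iterCov (X.coneChart i θ₀) (fun q => tensor2 (X.metricError i θ₀ a.2 q)) j) := by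
    intro j
    obtain ⟨C, hC0, hC⟩ := X.eventually_normLE_iterCov_metricError i θ₀ j
    obtain ⟨D, hD⟩ := (X.jetsBdd_coneChart i θ₀ 0).bdd 0 le_rfl
    refine JetsBdd.zero_of_bdd (C := C * √D ^ (2 + j)) (eventually_shell i θ₀) ?_ ?_
    · filter_upwards [X.eventually_smooth_metricError i θ₀] with a ha
      exact contDiffOn_iterCov (isOpen_shell i θ₀) (X.smoothNondeg_shell_coneChart i θ₀)
        ((tensor2L (EuclideanSpace ℝ (Fin n) × ℝ)).contDiff.comp_contDiffOn ha) j
    · filter_upwards [eventually_of_radius i θ₀ hC, eventually_fst_mem_target i θ₀, hD,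
        eventually_of_radius i θ₀ ((X.tendsto_rpow_rate i).eventually (gt_mem_nhds one_pos))]
        with a h1 h2 h3 h4
      rw [norm_iteratedFDeriv_zero] at h3
      refine ((h1 a.1 h2).mono ?_).norm_le hC0 h3
      calc C * a.2 ^ X.rate i ≤ C * 1 := by gcongr
        _ = C := mul_one C
  have h2 := JetsBdd.of_iterCov h1 (jetsBdd_fixed i θ₀
    (contDiffOn_christoffel (isOpen_shell i θ₀) (X.smoothNondeg_shell_coneChart i θ₀))) N
  exact (h2.clm (ofTensor2L _)).congr (.of_forall fun _ _ _ => (ofTensor2L_tensor2 _).symm)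

theorem jetsBdd_scaledMetric (N : ℕ) :
    JetsBdd (coordFilter i θ₀) (fun _ => shell i θ₀) (fun a => (a.1, 1)) N
      (fun a => X.scaledMetric i θ₀ a.2) :=
  ((X.jetsBdd_metricError i θ₀ N).add (X.jetsBdd_coneChart i θ₀ N)).congr
    (.of_forall fun _ _ _ => (sub_add_cancel _ _).symm)

theorem eventually_scaledMetric_coercive :
    ∃ m, 0 < m ∧ ∀ᶠ a in coordFilter (n := n) i θ₀, ∀ v, m * ‖v‖ ^ 2 ≤ X.scaledMetric i θ₀ a.2 (a.1, 1) v v := by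
  obtain ⟨m, hm, h1⟩ := exists_coercive (B := X.coneChart i θ₀ (extChartAt (𝓡 n) θ₀ θ₀, 1))
    fun v hv => X.coneChart_pos (shell_subset i θ₀ (mk_one_mem_shell (mem_extChartAt_target θ₀))) hv
  have hcont : ContinuousAt (X.coneChart i θ₀) (extChartAt (𝓡 n) θ₀ θ₀, 1) :=
    (X.smoothNondeg_shell_coneChart i θ₀).smooth.continuousOn.continuousAt
      ((isOpen_shell i θ₀).mem_nhds (mk_one_mem_shell (mem_extChartAt_target θ₀)))
  have h2 := (hcont.tendsto.comp (tendsto_coord i θ₀)).eventually (eventually_coercive hm h1)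
  obtain ⟨C, hC0, hC⟩ := X.eventually_normLE_iterCov_metricError i θ₀ 0
  have h3 : Filter.Tendsto (fun t => C * t ^ X.rate i) (endFilter i) (𝓝 0) := by
    simpa using (X.tendsto_rpow_rate i).const_mul C
  -- One factor 1/2 is lost in moving from `θ₀` to nearby points. The other is lost because the
  -- error is eventually at most half the cone metric.
  refine ⟨m / 4, by positivity, ?_⟩
  filter_upwards [h2, eventually_of_radius i θ₀ hC, eventually_fst_mem_target i θ₀,
    eventually_of_radius i θ₀ (h3.eventually (gt_mem_nhds one_half_pos))] with a e1 e2 e3 e4 v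
  have e5 := (e2 a.1 e3).mono e4.le (fun _ => v)
  have e6 := e1 v
  simp only [Function.comp] at e6
  set b := X.coneChart i θ₀ (a.1, 1) v v with hb
  have hb0 : 0 ≤ b := le_trans (by positivity) e6
  have e7 : ∏ _i : Fin (2 + 0), √b = b := by
    rw [Finset.prod_const, Finset.card_univ, Fintype.card_fin]
    exact Real.sq_sqrt hb0
  rw [e7] at e5
  change |X.scaledMetric i θ₀ a.2 (a.1, 1) v v - b| ≤ _ at e5
  linarith [neg_le_of_abs_le e5]

/-- The field `T` does not depend on `t`. The jets of the rescaled metrics and the norms of their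
inverses are bounded, hence so are the jets of their Christoffel symbols, and with them all
covariant derivatives of `T`. -/
theorem eventually_normLE_iterCov_scaledMetric {k : ℕ}
    {T : EuclideanSpace ℝ (Fin n) × ℝ → (EuclideanSpace ℝ (Fin n) × ℝ) [×k]→L[ℝ] ℝ}
    (hT : ContDiffOn ℝ ∞ T (shell i θ₀)) (j : ℕ) :
    ∃ K, ∀ᶠ a in coordFilter (n := n) i θ₀,
      NormLE (X.scaledMetric i θ₀ a.2 (a.1, 1)) (iterCov (X.scaledMetric i θ₀ a.2) T j (a.1, 1)) K := by
  obtain ⟨m, hm, h1⟩ := X.eventually_scaledMetric_coercive i θ₀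
  have h2 : ∀ᶠ a in coordFilter (n := n) i θ₀, ∀ y ∈ shell i θ₀, (X.scaledMetric i θ₀ a.2 y).IsInvertible := by
    refine eventually_of_radius i θ₀
      (P := fun t => ∀ y ∈ shell i θ₀, (X.scaledMetric i θ₀ t y).IsInvertible) ?_
    filter_upwards [X.eventually_radius i θ₀] with t ht y hy
    exact (X.smoothNondeg_scaledMetric i θ₀ ht.1.ne').inv y (ht.2 hy)
  have h3 := JetsBdd.christoffel (X.jetsBdd_scaledMetric i θ₀) h2 (C := m⁻¹) (by
    filter_upwards [h1] with a ha using norm_inverse_le_of_coercive hm ha)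
  obtain ⟨K, hK⟩ := (JetsBdd.iterCov (jetsBdd_fixed i θ₀ hT) h3 j 0).bdd 0 le_rfl
  refine ⟨K * (√m)⁻¹ ^ (k + j), ?_⟩
  filter_upwards [h1, hK] with a e1 e2
  rw [norm_iteratedFDeriv_zero] at e2
  exact normLE_of_coercive hm e1 e2

/-- In rescaled coordinates `α` is the representation of `η` in the chart at `θ₀`, the same for all
`t`, so its derivatives are bounded for the rescaled metric. Multiplying that metric by `t²`
contributes `t ^ (-1 - j)` on tensors of rank `1 + j`. -/
theorem eventually_covBound_of_invariant {α : OneForm (𝓡 (n + 1)) L}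
    (hα : α ∈ smoothForms (𝓡 (n + 1)) L) {η : OneForm (𝓡 n) (Lk i)}
    (hη : η ∈ smoothForms (𝓡 n) (Lk i))
    (h : ∀ᶠ r in endFilter i, ∀ θ : Lk i, ∀ w : EuclideanSpace ℝ (Fin n) × ℝ,
      (α (X.φ i (θ, r)) : EuclideanSpace ℝ (Fin (n + 1)) →L[ℝ] ℝ) (X.dφ i (θ, r) w) =
        (η θ : EuclideanSpace ℝ (Fin n) →L[ℝ] ℝ) w.1) (j : ℕ) :
    ∃ K, ∀ᶠ a in coordFilter (n := n) i θ₀, CovBound g.inner (X.coord i θ₀ a.2 (a.1, 1))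
      (fun u => tensor1 (chartForm α (X.coord i θ₀ a.2 (a.1, 1)) u)) j (K * a.2 ^ (-1 - j : ℝ)) := by
  set T : EuclideanSpace ℝ (Fin n) × ℝ → (EuclideanSpace ℝ (Fin n) × ℝ) [×1]→L[ℝ] ℝ := fun q =>
    tensor1 ((chartForm η θ₀ q.1).comp (ContinuousLinearMap.fst ℝ (EuclideanSpace ℝ (Fin n)) ℝ))
    with hTdef
  have hT : ContDiffOn ℝ ∞ T (shell i θ₀) := by
    have h1 : ContDiffOn ℝ ∞ (fun q : EuclideanSpace ℝ (Fin n) × ℝ => chartForm η θ₀ q.1)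
        (shell i θ₀) := (contDiffOn_chartForm hη θ₀).comp contDiffOn_fst fun q hq => hq.1
    exact (continuousMultilinearCurryFin1 ℝ (EuclideanSpace ℝ (Fin n) × ℝ) ℝ).symm.contDiff.comp_contDiffOn
      (h1.clm_comp contDiffOn_const)
  -- Invariance is needed on the whole shell around radius `t`, not only at that radius, because the
  -- form is differentiated.
  obtain ⟨c, hc, hcb, hP⟩ := exists_openRadii_of_eventually (X.b_pos i) h
  obtain ⟨K, hK⟩ := X.eventually_normLE_iterCov_scaledMetric i θ₀ hT j
  refine ⟨K, ?_⟩
  filter_upwards [hK, eventually_fst_mem_target i θ₀, eventually_of_radius i θ₀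
    (X.eventually_radius i θ₀), eventually_of_radius i θ₀ (eventually_mul_mem_openRadii hc i)]
    with a h1 h2 h3 h4
  refine (covBound_iff_of_pullBilin (isOpen_shell i θ₀) ((X.contMDiffOn_coord i θ₀ a.2).mono h3.2)
    (fun q hq => X.surjective_mfderiv_coord h3.1.ne' (h3.2 hq)) (G := X.scaledMetric i θ₀ a.2)
    ⟨(X.smoothNondeg_scaledMetric i θ₀ h3.1.ne').smooth.mono h3.2,
      fun q hq => (X.smoothNondeg_scaledMetric i θ₀ h3.1.ne').inv q (h3.2 hq)⟩
    (fun q _ v w => (X.sq_mul_scaledMetric h3.1.ne' q v w).symm) (mk_one_mem_shell h2)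
    (isOpen_extChartAt_target _) (mem_extChartAt_target _) subset_rfl
    (smoothNondeg_chartBilin g _) (fun u _ v w => g.symm _ _ _)
    (contDiffOn_tensor1_chartForm hα _) (T := T) ?_ j _).2 ?_
  · intro q hq hqs
    have hd : MDifferentiableAt 𝓘(ℝ, EuclideanSpace ℝ (Fin n) × ℝ) (𝓡 (n + 1))
        (X.coord i θ₀ a.2) q := ((X.contMDiffOn_coord i θ₀ a.2).contMDiffAt
          ((X.isOpen_coordDomain i θ₀ a.2).mem_nhds (h3.2 hq))).mdifferentiableAt (by simp)
    ext v
    have e := congrArg (fun A : (EuclideanSpace ℝ (Fin n) × ℝ) →L[ℝ] ℝ => A (v 0))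
      (pullForm_apply_eq α hd hqs)
    refine Eq.trans ?_ e
    have e2 := X.mfderiv_coord (h3.2 hq) (v 0)
    have e3 := hP (a.2 * q.2) (openRadii_subset_closedRadii _ _ (h4 q.2 hq.2))
      ((extChartAt (𝓡 n) θ₀).symm q.1) (chartFrame (𝓡 n) θ₀ q.1 (v 0).1, a.2 * (v 0).2)
    refine e3.symm.trans ?_
    exact congrArg (α (X.coord i θ₀ a.2 q) : EuclideanSpace ℝ (Fin (n + 1)) →L[ℝ] ℝ) e2.symm
  · rw [normLE_smul_iff h3.1]
    have e : K * a.2 ^ (-1 - j : ℝ) * a.2 ^ (1 + j) = K := by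
      rw [mul_assoc, ← Real.rpow_natCast, ← Real.rpow_add h3.1]
      have : (-1 - (j : ℝ)) + ((1 + j : ℕ) : ℝ) = 0 := by push_cast; ring
      rw [this, Real.rpow_zero, mul_one]
    rwa [e]

end Jets

/-- Translation-invariant forms have rate `-1`. -/
theorem formWeight_of_invariant {i : Fin s ⊕ Fin l} [CompactSpace (Lk i)]
    {α : OneForm (𝓡 (n + 1)) L} (hα : α ∈ smoothForms (𝓡 (n + 1)) L) {η : OneForm (𝓡 n) (Lk i)}
    (hη : η ∈ smoothForms (𝓡 n) (Lk i))
    (h : ∀ᶠ r in endFilter i, ∀ θ : Lk i, ∀ w : EuclideanSpace ℝ (Fin n) × ℝ,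
      (α (X.φ i (θ, r)) : EuclideanSpace ℝ (Fin (n + 1)) →L[ℝ] ℝ) (X.dφ i (θ, r) w) =
        (η θ : EuclideanSpace ℝ (Fin n) →L[ℝ] ℝ) w.1) : X.FormWeight i (-1) α := by
  intro j
  suffices ∃ K, ∀ᶠ r in endFilter i, ∀ θ ∈ (univ : Set (Lk i)), CovBound g.inner (X.φ i (θ, r))
      (fun u => tensor1 (chartForm α (X.φ i (θ, r)) u)) j (K * r ^ (-1 - j : ℝ)) by
    simpa using this
  -- Compactness of the link: the uniform bound passes to subsets and to finite unions and holds
  -- near each `θ₀`.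
  refine isCompact_univ.induction_on (p := fun S => ∃ K, ∀ᶠ r in endFilter i, ∀ θ ∈ S,
    CovBound g.inner (X.φ i (θ, r)) (fun u => tensor1 (chartForm α (X.φ i (θ, r)) u)) j
      (K * r ^ (-1 - j : ℝ))) ⟨0, .of_forall fun r θ hθ => hθ.elim⟩ ?_ ?_ ?_
  · rintro S S' hS ⟨K, hK⟩
    exact ⟨K, hK.mono fun r hr θ hθ => hr θ (hS hθ)⟩
  · rintro S S' ⟨K, hK⟩ ⟨K', hK'⟩
    refine ⟨max K K', ?_⟩
    filter_upwards [hK, hK', openRadii_mem_endFilter (X.b_pos i) i] with r h1 h2 hrb θ hθ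
    have hr : 0 ≤ r ^ (-1 - j : ℝ) :=
      Real.rpow_nonneg (pos_of_mem_openRadii (X.b_pos i) hrb).le _
    rcases hθ with hθ | hθ
    · exact NormLE.mono (h1 θ hθ) (mul_le_mul_of_nonneg_right (le_max_left _ _) hr)
    · exact NormLE.mono (h2 θ hθ) (mul_le_mul_of_nonneg_right (le_max_right _ _) hr)
  · intro θ₀ _
    obtain ⟨K, hK⟩ := X.eventually_covBound_of_invariant i θ₀ hα hη h j
    -- The product filter separates into a neighbourhood of `θ₀` and a range of radii, so that one
    -- range of radii serves the whole neighbourhood.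
    obtain ⟨pa, hpa, pb, hpb, hp⟩ := Filter.eventually_prod_iff.1 hK
    refine ⟨_, mem_nhdsWithin_of_mem_nhds (Filter.inter_mem (extChartAt_source_mem_nhds (I := 𝓡 n) θ₀)
      ((continuousAt_extChartAt (I := 𝓡 n) θ₀).eventually hpa)), K, ?_⟩
    filter_upwards [hpb] with r hr θ hθ
    have h1 := hp hθ.2 hr
    have h2 : X.coord i θ₀ r (extChartAt (𝓡 n) θ₀ θ, 1) = X.φ i (θ, r) := by
      unfold coord
      rw [(extChartAt (𝓡 n) θ₀).left_inv hθ.1, mul_one]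
    simp only at h1
    rwa [h2] at h1

theorem FormWeight.mono_atTop {j : Fin l} {β β' : ℝ} {α : OneForm (𝓡 (n + 1)) L}
    (h : X.FormWeight (.inr j) β α) (hβ : β ≤ β') : X.FormWeight (.inr j) β' α := by
  intro k
  obtain ⟨C, hC⟩ := h k
  refine ⟨|C|, ?_⟩
  filter_upwards [hC, (Filter.eventually_ge_atTop (1 : ℝ) : ∀ᶠ r in endFilter (s := s) (.inr j), 1 ≤ r)]
    with r h1 hr θ
  refine NormLE.mono (h1 θ) ?_
  calc C * r ^ (β - k) ≤ |C| * r ^ (β - k) :=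
        mul_le_mul_of_nonneg_right (le_abs_self C) (Real.rpow_nonneg (by linarith) _)
    _ ≤ |C| * r ^ (β' - k) := by gcongr

end CSACStructure
end Ends

/-! ### A finiteness criterion for the first cohomology -/

section FiniteDimension
variable {E : Type*} [NormedAddCommGroup E] [NormedSpace ℝ E] {H : Type*} [TopologicalSpace H]
  {I : ModelWithCorners ℝ E H} {M : Type*} [TopologicalSpace M] [ChartedSpace H M]

theorem IsPrimAt.smul {α : OneForm I M} {F : M → ℝ} {x : M} (h : IsPrimAt α F x) (c : ℝ) :
    IsPrimAt (c • α) (c • F) x := by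
  refine ⟨(contMDiffAt_const (c := c)).mul h.1, ?_⟩
  have h1 : (mfderiv I 𝓘(ℝ, ℝ) (c • F) x : E →L[ℝ] ℝ) = c • (mfderiv I 𝓘(ℝ, ℝ) F x : E →L[ℝ] ℝ) :=
    const_smul_mfderiv h.mdifferentiableAt c
  have h2 : (mfderiv I 𝓘(ℝ, ℝ) F x : E →L[ℝ] ℝ) = α x := h.2
  exact h1.trans (by rw [h2]; rfl)

/-- `A` is a quotient of `P ⧸ ker θ`, which embeds in `B`; the space `P` of auxiliary choices may be
infinite-dimensional. -/
theorem finiteDimensional_of_ker_le {P A B : Type*} [AddCommGroup P] [Module ℝ P] [AddCommGroup A]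
    [Module ℝ A] [AddCommGroup B] [Module ℝ B] [FiniteDimensional ℝ B] (f : P →ₗ[ℝ] A)
    (θ : P →ₗ[ℝ] B) (hf : Function.Surjective f) (h : LinearMap.ker θ ≤ LinearMap.ker f) :
    FiniteDimensional ℝ A := by
  have : FiniteDimensional ℝ (P ⧸ LinearMap.ker θ) := θ.quotKerEquivRange.symm.finiteDimensional
  refine Module.Finite.of_surjective ((LinearMap.ker θ).liftQ f h) fun a => ?_
  obtain ⟨p, rfl⟩ := hf a
  exact ⟨(LinearMap.ker θ).mkQ p, rfl⟩

variable [IsManifold I ∞ M] [I.Boundaryless] [FiniteDimensional ℝ E]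

/-- `H¹` is finite-dimensional if finitely many open sets, on which closed forms are exact, meet in
such a way that primitives differ by constants on the intersections, and if closed forms
that are exact on their union are exact. -/
theorem finiteDimensional_H1 {ι : Type*} [Finite ι] {V : ι → Set M} (hVo : ∀ i, IsOpen (V i))
    (hV : ∀ i, ∀ α ∈ closedForms I M, ∃ F : M → ℝ, ∀ y ∈ V i, IsPrimAt α F y)
    (hVV : ∀ i j, ∀ α ∈ closedForms I M, ∀ F G : M → ℝ, (∀ y ∈ V i, IsPrimAt α F y) →
      (∀ y ∈ V j, IsPrimAt α G y) → ∀ x ∈ V i ∩ V j, ∀ y ∈ V i ∩ V j, F x - G x = F y - G y)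
    (hext : ∀ α ∈ closedForms I M, ∀ F : M → ℝ, (∀ y ∈ ⋃ i, V i, IsPrimAt α F y) →
      α ∈ LinearMap.range (extD I M)) :
    FiniteDimensional ℝ (H1 I M) := by
  classical
  have := Fintype.ofFinite ι
  -- A closed form together with a choice of primitive on each `V i`. Keeping the choices as data
  -- makes the transition constants linear.
  let P : Submodule ℝ (closedForms I M × (ι → M → ℝ)) :=
    { carrier := {p | ∀ i, ∀ y ∈ V i, IsPrimAt (p.1 : OneForm I M) (p.2 i) y}
      zero_mem' := fun i y _ => isPrimAt_const 0 y
      add_mem' := fun ha hb i y hy => (ha i y hy).add (hb i y hy)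
      smul_mem' := fun c a ha i y hy => (ha i y hy).smul c }
  let f : P →ₗ[ℝ] H1 I M := (Submodule.mkQ _).comp ((LinearMap.fst ℝ _ _).comp P.subtype)
  -- One sample point in each nonempty intersection is enough, as the difference of primitives is
  -- constant there; empty intersections contribute 0 to `θ`.
  let pt : ι × ι → Option M := fun k => if h : (V k.1 ∩ V k.2).Nonempty then some h.some else none
  let θ : P →ₗ[ℝ] (ι × ι → ℝ) :=
    { toFun := fun p k => ((pt k).map fun x => p.1.2 k.1 x - p.1.2 k.2 x).getD 0
      map_add' := fun p q => by
        funext k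
        rcases h : pt k with _ | x
        · simp [h]
        · simp [h]; ring
      map_smul' := fun c p => by
        funext k
        rcases h : pt k with _ | x
        · simp [h]
        · simp [h]; ring }
  refine finiteDimensional_of_ker_le f θ ?_ ?_
  · intro a
    obtain ⟨α, rfl⟩ := Submodule.mkQ_surjective _ a
    choose F hF using fun i => hV i α α.2
    exact ⟨⟨(α, F), hF⟩, rfl⟩
  · rintro ⟨⟨α, F⟩, hF⟩ hp
    have hF' : ∀ i, ∀ y ∈ V i, IsPrimAt (α : OneForm I M) (F i) y := hF
    have heq : ∀ i j, ∀ x ∈ V i ∩ V j, F i x = F j x := by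
      intro i j x hx
      have hne : (V i ∩ V j).Nonempty := ⟨x, hx⟩
      have h1 := congrFun (LinearMap.mem_ker.1 hp) (i, j)
      have h2 : pt (i, j) = some hne.some := dif_pos hne
      have h3 : F i hne.some - F j hne.some = 0 := by
        change ((pt (i, j)).map fun x => F i x - F j x).getD 0 = 0 at h1
        rwa [h2] at h1
      have h4 := hVV i j α α.2 (F i) (F j) (hF' i) (hF' j) x hx _ hne.some_mem
      rw [h3] at h4
      exact sub_eq_zero.1 h4
    -- When all transition constants vanish, the local primitives glue on the union of the `V i`;
    -- the value elsewhere is irrelevant.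
    let G : M → ℝ := fun x => if h : ∃ i, x ∈ V i then F h.choose x else 0
    have hG : ∀ i, ∀ x ∈ V i, G x = F i x := fun i x hx => by
      have h : ∃ i, x ∈ V i := ⟨i, hx⟩
      simp only [G, dif_pos h]
      exact heq _ _ x ⟨h.choose_spec, hx⟩
    have h5 : (α : OneForm I M) ∈ LinearMap.range (extD I M) := by
      refine hext α α.2 G fun y hy => ?_
      obtain ⟨i, hi⟩ := mem_iUnion.1 hy
      exact (hF' i y hi).congr (Filter.eventuallyEq_of_mem ((hVo i).mem_nhds hi) (hG i))
    exact (Submodule.Quotient.mk_eq_zero _).2 h5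

end FiniteDimension

/-! ### Finite-dimensionality of the first cohomology -/

section Ends
open Bundle
set_option linter.unusedSectionVars false
variable {n s l : ℕ} {L : Type*} [TopologicalSpace L]
    [ChartedSpace (EuclideanSpace ℝ (Fin (n + 1))) L] [IsManifold (𝓡 (n + 1)) ∞ L]
    {g : Metric (n + 1) L}
    {Lk : Fin s ⊕ Fin l → Type*} [∀ i, TopologicalSpace (Lk i)]
    [∀ i, ChartedSpace (EuclideanSpace ℝ (Fin n)) (Lk i)] [∀ i, IsManifold (𝓡 n) ∞ (Lk i)]
    (X : CSACStructure g Lk)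

namespace CSACStructure

theorem convex_diff_radii {b c : ℝ} {i : Fin s ⊕ Fin l} :
    Convex ℝ (openRadii b i \ openRadii c i) ∨ c ≤ 0 := by
  rcases le_or_gt c 0 with h | h
  · exact Or.inr h
  · left
    cases i with
    | inl i =>
      have : openRadii b (Sum.inl i : Fin s ⊕ Fin l) \ openRadii c (Sum.inl i : Fin s ⊕ Fin l) = Ico c b := by
        ext r
        simp only [openRadii, mem_sdiff, mem_Ioo, mem_Ico, not_and, not_lt]
        exact ⟨fun h => ⟨h.2 h.1.1, h.1.2⟩, fun h' => ⟨⟨h.trans_le h'.1, h'.2⟩, fun _ => h'.1⟩⟩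
      rw [this]
      exact convex_Ico _ _
    | inr i =>
      have : openRadii b (Sum.inr i : Fin s ⊕ Fin l) \ openRadii c (Sum.inr i : Fin s ⊕ Fin l) = Ioc b c := by
        ext r
        simp only [openRadii, mem_sdiff, mem_Ioi, mem_Ioc, not_lt]
      rw [this]
      exact convex_Ioc _ _

theorem mem_closedRadii_self {c : ℝ} (hc : 0 < c) (i : Fin s ⊕ Fin l) : c ∈ closedRadii c i := by
  cases i
  · exact ⟨hc, le_rfl⟩
  · exact le_rfl (a := c)

theorem notMem_openRadii_self (c : ℝ) (i : Fin s ⊕ Fin l) : c ∉ openRadii c i := by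
  cases i
  · exact fun h => lt_irrefl _ h.2
  · exact fun h => lt_irrefl c h

theorem exists_isClosed_inter_eq {b c : ℝ} {i : Fin s ⊕ Fin l} (hc : 0 < c)
    (hcb : closedRadii c i ⊆ openRadii b i) :
    ∃ A, IsClosed A ∧ closedRadii b i ∩ A = closedRadii c i := by
  have h := hcb (mem_closedRadii_self hc i)
  cases i with
  | inl i =>
    refine ⟨Iic c, isClosed_Iic, ?_⟩
    ext r
    exact ⟨fun h' => ⟨h'.1.1, h'.2⟩, fun h' => ⟨⟨h'.1, h'.2.trans h.2.le⟩, h'.2⟩⟩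
  | inr i =>
    refine ⟨Ici c, isClosed_Ici, ?_⟩
    ext r
    exact ⟨fun h' => h'.2, fun h' => ⟨show b ≤ r from le_trans (le_of_lt (show b < c from h)) h', h'⟩⟩

/-- A closed form that is exact near a core is exact. -/
theorem exact_of_exact_core {c : Fin s ⊕ Fin l → ℝ} (hc : ∀ i, 0 < c i)
    (hcb : ∀ i, closedRadii (c i) i ⊆ openRadii (X.b i) i) {α : OneForm (𝓡 (n + 1)) L}
    (hα : α ∈ closedForms (𝓡 (n + 1)) L) {F : L → ℝ} {U : Set L} (hU : IsOpen U)
    (hUK : (⋃ i, X.φ i '' (univ ×ˢ openRadii (c i) i))ᶜ ⊆ U) (hF : ∀ y ∈ U, IsPrimAt α F y) :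
    α ∈ LinearMap.range (extD (𝓡 (n + 1)) L) := by
  classical
  -- The collar between the two sizes of each end belongs to the core, so `F` is a primitive there.
  have hcore : ∀ i, ∀ θ : Lk i, ∀ r ∈ openRadii (X.b i) i, r ∉ openRadii (c i) i →
      X.φ i (θ, r) ∈ U := by
    intro i θ r hr hr'
    refine hUK fun h => ?_
    obtain ⟨k, p, ⟨-, hp⟩, hpe⟩ := mem_iUnion.1 h
    have hpb : p.2 ∈ openRadii (X.b k) k := hcb k (openRadii_subset_closedRadii _ _ hp)
    have hx : X.φ i (θ, r) ∈ X.endSet i := X.φ_mem_endSet (p := (θ, r)) hr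
    by_cases hki : k = i
    · subst hki
      have h1 := congrArg (X.ψ k) hpe
      rw [X.ψ_φ hpb, X.ψ_φ (p := (θ, r)) hr] at h1
      rw [h1] at hp
      exact hr' hp
    · exact X.notMem_endSet hki hx (hpe ▸ X.φ_mem_endSet hpb)
  -- The slice of radius `c i` lies in the core, and `F` is extended from it over the whole end. The
  -- extension agrees with `F` on the collar, because their difference is constant along the collar
  -- part of each ray.
  have hcb' : ∀ i, c i ∈ openRadii (X.b i) i := fun i => hcb i (mem_closedRadii_self (hc i) i)
  choose Fe hFe hFeq using fun i => X.exists_prim_end_of_slice (i := i) hα (hcb' i) (h := F)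
    fun θ => by
      filter_upwards [hU.mem_nhds (hcore i θ _ (hcb' i) (notMem_openRadii_self _ i))] with y hy
        using hF y hy
  have hagree : ∀ i, ∀ θ : Lk i, ∀ r ∈ openRadii (X.b i) i, r ∉ openRadii (c i) i →
      Fe i (X.φ i (θ, r)) = F (X.φ i (θ, r)) := by
    intro i θ r hr hr'
    have hconv : IsPreconnected (openRadii (X.b i) i \ openRadii (c i) i) :=
      ((convex_diff_radii (b := X.b i) (c := c i) (i := i)).resolve_right
        (not_le.2 (hc i))).isPreconnected
    have hcont : ContinuousOn (fun r => X.φ i (θ, r)) (openRadii (X.b i) i \ openRadii (c i) i) :=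
      (X.contMDiffOn_φ i).continuousOn.comp (by fun_prop) fun r hr => ⟨mem_univ _, hr.1⟩
    have h1 := sub_eq_sub_of_isPrimAt (I := 𝓡 (n + 1)) (α := α) (F := Fe i) (G := F)
      (hconv.image _ hcont) (by
        rintro _ ⟨r, hr, rfl⟩
        filter_upwards [(X.isOpen_endSet i).mem_nhds (X.φ_mem_endSet (p := (θ, r)) hr.1)] with y hy
          using hFe i y hy) (by
        rintro _ ⟨r, hr, rfl⟩
        filter_upwards [hU.mem_nhds (hcore i θ r hr.1 hr.2)] with y hy using hF y hy)
      (mem_image_of_mem _ ⟨hr, hr'⟩) (mem_image_of_mem _ ⟨hcb' i, notMem_openRadii_self _ i⟩)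
    rw [hFeq i θ, sub_self] at h1
    exact sub_eq_zero.1 h1
  let G : L → ℝ := fun x => if h : ∃ i, x ∈ X.endSet i then Fe h.choose x else F x
  have hG1 : ∀ i, ∀ x ∈ X.endSet i, G x = Fe i x := by
    intro i x hx
    have h : ∃ i, x ∈ X.endSet i := ⟨i, hx⟩
    have h1 : h.choose = i := by
      by_contra hne
      exact X.notMem_endSet hne hx h.choose_spec
    simp only [G, dif_pos h]
    rw [h1]
  have hG : ∀ x, IsPrimAt α G x := by
    intro x
    by_cases h : ∃ i, x ∈ X.endSet i
    · obtain ⟨i, hi⟩ := h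
      exact (hFe i x hi).congr (Filter.eventuallyEq_of_mem ((X.isOpen_endSet i).mem_nhds hi) (hG1 i))
    -- A point outside all ends has a neighbourhood avoiding the smaller closed ends. Nearby points
    -- on an end lie in its collar, so the glued function is `F` there.
    · have hcl : ∀ i, IsClosed (X.φ i '' (univ ×ˢ closedRadii (c i) i)) := fun i => by
        obtain ⟨A, hA, hAc⟩ := exists_isClosed_inter_eq (hc i) (hcb i)
        rw [← hAc]
        exact X.isClosed_image_φ i hA
      have hxU : x ∈ U := hUK fun h' => by
        obtain ⟨i, p, ⟨-, hp⟩, rfl⟩ := mem_iUnion.1 h'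
        exact h ⟨i, X.φ_mem_endSet (hcb i (openRadii_subset_closedRadii _ _ hp))⟩
      have hxc : ∀ i, x ∉ X.φ i '' (univ ×ˢ closedRadii (c i) i) := fun i h' => by
        obtain ⟨p, ⟨-, hp⟩, rfl⟩ := h'
        exact h ⟨i, X.φ_mem_endSet (hcb i hp)⟩
      have hev : ∀ᶠ y in 𝓝 x, ∀ i, y ∉ X.φ i '' (univ ×ˢ closedRadii (c i) i) :=
        Filter.eventually_all.2 fun i => (hcl i).isOpen_compl.mem_nhds (hxc i)
      refine (hF x hxU).congr ?_
      filter_upwards [hev] with y hy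
      by_cases h' : ∃ i, y ∈ X.endSet i
      · obtain ⟨i, hi⟩ := h'
        rw [hG1 i y hi]
        obtain ⟨⟨θ, r⟩, ⟨-, hp⟩, rfl⟩ := hi
        exact hagree i θ r hp fun h'' => hy i
          (mem_image_of_mem _ ⟨mem_univ _, openRadii_subset_closedRadii _ _ h''⟩)
      · simp only [G, dif_neg h']
  exact ⟨⟨G, fun x => (hG x).1⟩, funext fun x => (hG x).2⟩

/-- Intersections of the covering sets need not be connected. If two of them meet, however, their
union lies in a larger set `W q` on which the form is exact, by a Lebesgue number argument for an
auxiliary metric; each local primitive differs from the one on `W q` by a constant. -/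
theorem finiteDimensional_H1 (X : CSACStructure g Lk) [T2Space L] [SecondCountableTopology L] [∀ i, CompactSpace (Lk i)] :
    FiniteDimensional ℝ (H1 (𝓡 (n + 1)) L) := by
  have : LocallyCompactSpace L := Manifold.locallyCompact_of_finiteDimensional (𝓡 (n + 1))
  have : TopologicalSpace.MetrizableSpace L := TopologicalSpace.metrizableSpace_of_t3_secondCountable L
  let _ : MetricSpace L := TopologicalSpace.metrizableSpaceMetric L
  choose c hc hcb _ using fun i => exists_openRadii_of_eventually (X.b_pos i) (P := fun _ => True)
    (.of_forall fun _ => trivial)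
  have hK := X.isCompact_core hc hcb
  set K := (⋃ i, X.φ i '' (univ ×ˢ openRadii (c i) i))ᶜ
  choose W _ hWo hxW hWp hWe using fun x : L => exists_nhd_exact (I := 𝓡 (n + 1)) x Filter.univ_mem
  obtain ⟨δ, hδ, hleb⟩ := lebesgue_number_lemma_of_metric hK (c := W) hWo
    fun x _ => mem_iUnion.2 ⟨x, hxW x⟩
  -- With radius `δ / 4`, a set meeting `V x` stays within distance `3 δ / 4` of `x`, hence inside
  -- the ball of radius `δ` about `x`.
  choose V hVN hVo hxV hVp hVe using fun x : L =>
    exists_nhd_exact (I := 𝓡 (n + 1)) x (Metric.ball_mem_nhds x (by positivity : 0 < δ / 4))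
  obtain ⟨t, htK, ht⟩ := hK.elim_nhds_subcover V fun x _ => (hVo x).mem_nhds (hxV x)
  refine Conifold.finiteDimensional_H1 (ι := t) (V := fun x => V x) (fun x => hVo x) (fun x => hVe x)
    ?_ ?_
  · intro x y α hα F G hF hG z hz w hw
    obtain ⟨q, hq⟩ := hleb x (htK x x.2)
    obtain ⟨P, hP⟩ := hWe q α hα
    have hVx : V x ⊆ W q := fun a ha => hq (by
      have := hVN _ ha
      rw [Metric.mem_ball] at this ⊢
      linarith)
    have hVy : V y ⊆ W q := fun a ha => hq (by
      have h1 := hVN _ ha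
      have h2 := hVN _ hz.1
      have h3 := hVN _ hz.2
      rw [Metric.mem_ball] at h1 h2 h3 ⊢
      have h4 := dist_triangle4 a (y : L) z (x : L)
      rw [dist_comm (y : L) z] at h4
      linarith)
    have h1 := sub_eq_sub_of_isPrimAt (α := α) (F := F) (G := P) (hVp x)
      (fun a ha => by filter_upwards [(hVo x).mem_nhds ha] with b hb using hF b hb)
      (fun a ha => by filter_upwards [(hVo x).mem_nhds ha] with b hb using hP b (hVx hb)) hz.1 hw.1
    have h2 := sub_eq_sub_of_isPrimAt (α := α) (F := G) (G := P) (hVp y)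
      (fun a ha => by filter_upwards [(hVo y).mem_nhds ha] with b hb using hG b hb)
      (fun a ha => by filter_upwards [(hVo y).mem_nhds ha] with b hb using hP b (hVy hb)) hz.2 hw.2
    linarith
  · intro α hα F hF
    refine X.exact_of_exact_core hc hcb hα (isOpen_iUnion fun x : t => hVo x) (fun x hx => ?_) hF
    obtain ⟨y, hy, hxy⟩ := mem_iUnion₂.1 (ht hx)
    exact mem_iUnion.2 ⟨⟨y, hy⟩, hxy⟩

end CSACStructure
end Ends

/-! ### Internal direct sums of two and three subspaces -/

section Algebra
variable {V : Type*} [AddCommGroup V] [Module ℝ V]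

theorem iSupIndep_of_sum_eq_zero {ι : Type*} [Fintype ι] {p : ι → Submodule ℝ V}
    (h : ∀ v : ι → V, (∀ i, v i ∈ p i) → ∑ i, v i = 0 → ∀ i, v i = 0) : iSupIndep p := by
  classical
  rw [iSupIndep_iff_finsetSum_eq_zero_imp_eq_zero]
  intro t v hv ht i hi
  have h1 := h (fun i => if i ∈ t then v i else 0) (fun i => by
    split_ifs with hi
    · exact hv i hi
    · exact zero_mem _) (by simpa using ht) i
  simpa [hi] using h1

theorem isInternalSum_three {W A B C : Submodule ℝ V} (hA : A ≤ W) (hB : B ≤ W) (hC : C ≤ W)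
    (hex : ∀ w ∈ W, ∃ a ∈ A, ∃ b ∈ B, ∃ c ∈ C, a + b + c = w)
    (hind : ∀ a ∈ A, ∀ b ∈ B, ∀ c ∈ C, a + b + c = 0 → a = 0 ∧ b = 0 ∧ c = 0) :
    IsInternalSum W ![A, B, C] := by
  refine ⟨iSupIndep_of_sum_eq_zero fun v hv hs => ?_, le_antisymm (iSup_le fun i => ?_) ?_⟩
  · rw [Fin.sum_univ_three] at hs
    obtain ⟨h0, h1, h2⟩ := hind _ (hv 0) _ (hv 1) _ (hv 2) hs
    intro i
    fin_cases i <;> assumption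
  · fin_cases i <;> assumption
  · intro w hw
    obtain ⟨a, ha, b, hb, c, hc, rfl⟩ := hex w hw
    exact add_mem (add_mem (Submodule.mem_iSup_of_mem 0 ha) (Submodule.mem_iSup_of_mem 1 hb))
      (Submodule.mem_iSup_of_mem 2 hc)

theorem isInternalSum_two {W A B : Submodule ℝ V} (hA : A ≤ W) (hB : B ≤ W)
    (hex : ∀ w ∈ W, ∃ a ∈ A, ∃ b ∈ B, a + b = w)
    (hind : ∀ a ∈ A, ∀ b ∈ B, a + b = 0 → a = 0 ∧ b = 0) :
    IsInternalSum W ![A, B] := by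
  refine ⟨iSupIndep_of_sum_eq_zero fun v hv hs => ?_, le_antisymm (iSup_le fun i => ?_) ?_⟩
  · rw [Fin.sum_univ_two] at hs
    obtain ⟨h0, h1⟩ := hind _ (hv 0) _ (hv 1) hs
    intro i
    fin_cases i <;> assumption
  · fin_cases i <;> assumption
  · intro w hw
    obtain ⟨a, ha, b, hb, rfl⟩ := hex w hw
    exact add_mem (Submodule.mem_iSup_of_mem 0 ha) (Submodule.mem_iSup_of_mem 1 hb)

end Algebra

/-! ### Representatives of cohomology classes -/

section Cohomology
variable {E : Type*} [NormedAddCommGroup E] [NormedSpace ℝ E] {H : Type*} [TopologicalSpace H]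
  {I : ModelWithCorners ℝ E H} {M : Type*} [TopologicalSpace M] [ChartedSpace H M]
  [IsManifold I ∞ M] [I.Boundaryless] [FiniteDimensional ℝ E]
  {V : Submodule ℝ (OneForm I M)} {F : Filter M}

theorem Represents.eq_zero (h : Represents V F) {v : OneForm I M} (hv : v ∈ V) {f : C^∞⟮I, M; ℝ⟯}
    (hf : extD I M f = v) : v = 0 := by
  obtain ⟨hV, hinj, -⟩ := h
  have h1 : (⟨v, hv⟩ : V) = 0 := by
    apply hinj
    rw [map_zero]
    exact (Submodule.Quotient.mk_eq_zero _).2 ⟨f, hf⟩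
  exact congrArg Subtype.val h1

/-- The classes agree only in `H¹(M)`, so no support condition on `f` is available. -/
theorem Represents.exists_eq (h : Represents V F) {α : OneForm I M} (hα : α ∈ closedVanishing I F) :
    ∃ v ∈ V, ∃ f : C^∞⟮I, M; ℝ⟯, v + extD I M f = α := by
  obtain ⟨hV, -, hran⟩ := h
  have h1 : (Submodule.mkQ _ ⟨α, hα.1⟩ : H1 I M) ∈ LinearMap.range (gamma I F) :=
    ⟨Submodule.mkQ _ ⟨α, hα⟩, rfl⟩
  rw [← hran] at h1
  obtain ⟨v, hv⟩ := h1
  have h2 := (Submodule.Quotient.eq _).1 hv.symm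
  obtain ⟨f, hf⟩ := h2
  refine ⟨v, v.2, f, ?_⟩
  rw [hf]
  change (v : OneForm I M) + (α - (v : OneForm I M)) = α
  abel

theorem Represents.finiteDimensional [FiniteDimensional ℝ (H1 I M)] (h : Represents V F) :
    FiniteDimensional ℝ V := by
  obtain ⟨hV, hinj, -⟩ := h
  exact FiniteDimensional.of_injective _ hinj

theorem eq_of_extD_eq_zero [ConnectedSpace M] {f : C^∞⟮I, M; ℝ⟯} (hf : extD I M f = 0) (x y : M) :
    f x = f y := by
  have h := sub_eq_sub_of_isPrimAt (I := I) (α := (0 : OneForm I M)) (F := f) (G := fun _ => 0)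
    isPreconnected_univ (fun x _ => .of_forall fun y => hf ▸ isPrimAt_extD f y)
    (fun x _ => .of_forall fun y => isPrimAt_const 0 y) (mem_univ x) (mem_univ y)
  simpa using h

end Cohomology

/-! ### Primitives and constants near the ends -/

section Ends
open Bundle
set_option linter.unusedSectionVars false
variable {n s l : ℕ} {L : Type*} [TopologicalSpace L]
    [ChartedSpace (EuclideanSpace ℝ (Fin (n + 1))) L] [IsManifold (𝓡 (n + 1)) ∞ L]
    {g : Metric (n + 1) L}
    {Lk : Fin s ⊕ Fin l → Type*} [∀ i, TopologicalSpace (Lk i)]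
    [∀ i, ChartedSpace (EuclideanSpace ℝ (Fin n)) (Lk i)] [∀ i, IsManifold (𝓡 n) ∞ (Lk i)]
    (X : CSACStructure g Lk)

namespace CSACStructure

theorem smoothFunction_sum_apply {ι : Type*} (t : Finset ι) (f : ι → C^∞⟮𝓡 (n + 1), L; ℝ⟯) (x : L) :
    (∑ i ∈ t, f i) x = ∑ i ∈ t, f i x := by
  have h := congrFun (map_sum (ContMDiffMap.coeFnLinearMap (𝕜 := ℝ) (I := 𝓡 (n + 1)) (N := L)
    (n := ∞) (V := ℝ)) f t) x
  rw [Finset.sum_apply] at h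
  exact h

theorem extD_eq_of_eventuallyEq {f : C^∞⟮𝓡 (n + 1), L; ℝ⟯} {α : OneForm (𝓡 (n + 1)) L} {F : L → ℝ}
    {x : L} (hF : IsPrimAt α F x) (h : ∀ᶠ y in 𝓝 x, f y = F y) : extD (𝓡 (n + 1)) L f x = α x :=
  (hF.congr h).2

theorem extD_eq_zero_of_const {f : C^∞⟮𝓡 (n + 1), L; ℝ⟯} {i : Fin s ⊕ Fin l} {a : ℝ}
    (h : ∀ x ∈ X.endSet i, f x = a) {x : L} (hx : x ∈ X.endSet i) : extD (𝓡 (n + 1)) L f x = 0 :=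
  extD_eq_of_eventuallyEq (isPrimAt_const (I := 𝓡 (n + 1)) a x)
    (Filter.eventually_of_mem ((X.isOpen_endSet i).mem_nhds hx) h)

theorem eventually_mem_endSet (i : Fin s ⊕ Fin l) :
    ∀ᶠ r in endFilter i, ∀ θ, X.φ i (θ, r) ∈ X.endSet i := by
  filter_upwards [openRadii_mem_endFilter (X.b_pos i) i] with r hr θ
    using X.φ_mem_endSet (p := (θ, r)) hr

/-- Decaying closed forms are exact near the ends. -/
theorem exists_decaying_primitive {α : OneForm (𝓡 (n + 1)) L} (hα : α ∈ closedForms (𝓡 (n + 1)) L)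
    {β : Fin s ⊕ Fin l → ℝ} (S : Finset (Fin s ⊕ Fin l)) (hb : ∀ i ∈ S, X.FormBound α i (β i))
    (hβ0 : ∀ i ∈ S, β i ≠ 0)
    (hβ : ∀ i ∈ S, Filter.Tendsto (fun r : ℝ => r ^ β i) (endFilter i) (𝓝 0)) :
    ∃ G : C^∞⟮𝓡 (n + 1), L; ℝ⟯,
      (∀ i ∈ S, (∃ K, ∀ᶠ r in endFilter i, ∀ θ, |G (X.φ i (θ, r))| ≤ K * r ^ β i) ∧
        ∀ᶠ r in endFilter i, ∀ θ, extD (𝓡 (n + 1)) L G (X.φ i (θ, r)) = α (X.φ i (θ, r))) ∧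
      ∀ i ∉ S, ∀ x ∈ X.endSet i, G x = 0 := by
  classical
  have h1 : ∀ i, ∃ G : C^∞⟮𝓡 (n + 1), L; ℝ⟯, (i ∈ S →
      (∃ K, ∀ᶠ r in endFilter i, ∀ θ, |G (X.φ i (θ, r))| ≤ K * r ^ β i) ∧
        ∀ᶠ r in endFilter i, ∀ θ, extD (𝓡 (n + 1)) L G (X.φ i (θ, r)) = α (X.φ i (θ, r))) ∧
      ∀ k ≠ i, ∀ x ∈ X.endSet k, G x = 0 := by
    intro i
    by_cases hi : i ∈ S
    · obtain ⟨F, hF, K, hK⟩ := X.exists_prim_end_of_decay hα (hb i hi) (hβ0 i hi) (hβ i hi)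
      obtain ⟨G, hG, hG0⟩ := X.exists_extension i fun x hx => (hF x hx).1
      refine ⟨G, fun _ => ⟨⟨K, ?_⟩, ?_⟩, hG0⟩
      · filter_upwards [hG, hK] with r h1 h2 θ
        rw [h1]
        exact h2 θ
      · filter_upwards [X.eventually_nhds_of_eventually (P := fun x => G x = F x) hG,
          X.eventually_mem_endSet i] with r h1 h2 θ
        exact extD_eq_of_eventuallyEq (hF _ (h2 θ)) (h1 θ)
    · exact ⟨0, fun h => absurd h hi, fun _ _ _ _ => rfl⟩
  choose G hG hG0 using h1
  -- Each cut-off primitive vanishes on the other ends, so the sum restricts to a single summand on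
  -- each end.
  have hsum : ∀ i ∈ S, ∀ x ∈ X.endSet i, (∑ k ∈ S, G k) x = G i x := fun i hi x hx => by
    rw [smoothFunction_sum_apply, Finset.sum_eq_single_of_mem i hi fun k _ hki => hG0 k i hki.symm x hx]
  refine ⟨∑ i ∈ S, G i, fun i hi => ?_, fun i hi x hx => ?_⟩
  · obtain ⟨⟨K, hK⟩, hd⟩ := hG i hi
    refine ⟨⟨K, ?_⟩, ?_⟩
    · filter_upwards [hK, X.eventually_mem_endSet i] with r h1 h2 θ
      rw [hsum i hi _ (h2 θ)]
      exact h1 θ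
    · filter_upwards [hd, X.eventually_mem_endSet i] with r h1 h2 θ
      rw [← h1 θ]
      exact extD_eq_of_eventuallyEq (isPrimAt_extD (G i) _)
        (Filter.eventually_of_mem ((X.isOpen_endSet i).mem_nhds (h2 θ)) (hsum i hi))
  · rw [smoothFunction_sum_apply]
    exact Finset.sum_eq_zero fun k hk => hG0 k i (fun h => hi (h ▸ hk)) x hx

/-- Functions with vanishing differential near the end are constant near the end. -/
theorem eventually_const [∀ i, ConnectedSpace (Lk i)] {i : Fin s ⊕ Fin l}
    {f : C^∞⟮𝓡 (n + 1), L; ℝ⟯}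
    (hf : ∀ᶠ r in endFilter i, ∀ θ, extD (𝓡 (n + 1)) L f (X.φ i (θ, r)) = 0) :
    ∃ a, ∀ᶠ r in endFilter i, ∀ θ, f (X.φ i (θ, r)) = a := by
  obtain ⟨c, hc, hcb, hP⟩ := exists_openRadii_of_eventually (X.b_pos i) hf
  have hcJ : openRadii c i ⊆ openRadii (X.b i) i := (openRadii_subset_closedRadii c i).trans hcb
  obtain ⟨r₀, hr₀⟩ := (endFilter i).nonempty_of_mem (openRadii_mem_endFilter hc i)
  let θ₀ : Lk i := Classical.arbitrary _
  have hpre : IsPreconnected (X.φ i '' (univ ×ˢ openRadii c i)) :=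
    (isPreconnected_univ.prod (convex_openRadii c i).isPreconnected).image _
      ((X.contMDiffOn_φ i).continuousOn.mono (prod_mono_right hcJ))
  have hopen : IsOpen (X.φ i '' (univ ×ˢ openRadii c i)) :=
    X.isOpen_image_φ (isOpen_domain i c) (prod_mono_right hcJ)
  refine ⟨f (X.φ i (θ₀, r₀)), ?_⟩
  filter_upwards [openRadii_mem_endFilter hc i] with r hr θ
  have h := sub_eq_sub_of_isPrimAt (I := 𝓡 (n + 1)) (α := (0 : OneForm (𝓡 (n + 1)) L)) (F := f)
    (G := fun _ => 0) hpre (by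
      intro x hx
      filter_upwards [hopen.mem_nhds hx]
      rintro _ ⟨p, ⟨-, hp⟩, rfl⟩
      exact ⟨f.contMDiff.contMDiffAt, hP _ (openRadii_subset_closedRadii _ _ hp) p.1⟩)
    (fun x _ => .of_forall fun y => isPrimAt_const 0 y)
    (mem_image_of_mem (X.φ i) (show ((θ, r) : Lk i × ℝ) ∈ univ ×ˢ openRadii c i from ⟨mem_univ _, hr⟩))
    (mem_image_of_mem (X.φ i)
      (show ((θ₀, r₀) : Lk i × ℝ) ∈ univ ×ˢ openRadii c i from ⟨mem_univ _, hr₀⟩))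
  simpa using h

theorem extD_mem_weightedForms_of_const {β : Fin s ⊕ Fin l → ℝ} {f : C^∞⟮𝓡 (n + 1), L; ℝ⟯}
    {a : Fin s ⊕ Fin l → ℝ} (h : ∀ i, ∀ x ∈ X.endSet i, f x = a i) :
    extD (𝓡 (n + 1)) L f ∈ X.weightedForms β := by
  refine X.mem_weightedForms_iff.2 ⟨(extD_mem_closedForms f).1, fun i =>
    X.formWeight_of_eventually_zero ?_⟩
  filter_upwards [X.eventually_mem_endSet i] with r hr θ using X.extD_eq_zero_of_const (h i) (hr θ)

theorem extD_mem_weightedForms {β : Fin s ⊕ Fin l → ℝ} {f : C^∞⟮𝓡 (n + 1), L; ℝ⟯}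
    (h : f ∈ X.weightedFunctions β) : extD (𝓡 (n + 1)) L f ∈ X.weightedForms fun i => β i - 1 :=
  X.mem_weightedForms_iff.2 ⟨(extD_mem_closedForms f).1,
    fun i => (X.mem_weightedFunctions_iff.1 h i).2⟩

theorem tendsto_zero_of_bound {β : ℝ} {i : Fin s ⊕ Fin l}
    (hβ : Filter.Tendsto (fun r : ℝ => r ^ β) (endFilter i) (𝓝 0)) {f : L → ℝ} {K : ℝ}
    (hf : ∀ᶠ r in endFilter i, ∀ θ, |f (X.φ i (θ, r))| ≤ K * r ^ β) (θ : Lk i) :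
    Filter.Tendsto (fun r => f (X.φ i (θ, r))) (endFilter i) (𝓝 0) := by
  have h1 : Filter.Tendsto (fun r : ℝ => K * r ^ β) (endFilter i) (𝓝 0) := by
    simpa using hβ.const_mul K
  exact squeeze_zero_norm' (by filter_upwards [hf] with r hr using hr θ) h1

theorem eq_zero_of_const_of_bound [∀ i, ConnectedSpace (Lk i)] {β : ℝ} {i : Fin s ⊕ Fin l}
    (hβ : Filter.Tendsto (fun r : ℝ => r ^ β) (endFilter i) (𝓝 0)) {f : L → ℝ} {K a : ℝ}
    (hf : ∀ᶠ r in endFilter i, ∀ θ, |f (X.φ i (θ, r))| ≤ K * r ^ β)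
    (ha : ∀ᶠ r in endFilter i, ∀ θ, f (X.φ i (θ, r)) = a) : a = 0 := by
  let θ : Lk i := Classical.arbitrary _
  refine tendsto_nhds_unique ?_ (X.tendsto_zero_of_bound hβ hf θ)
  exact tendsto_const_nhds.congr' (by filter_upwards [ha] with r hr using (hr θ).symm)

/-- On AC ends, functions are bounded according to the growth of their differential. -/
theorem bound_of_formBound [∀ i, CompactSpace (Lk i)] {j : Fin l} {β : ℝ} (hβ : 0 < β)
    {f : C^∞⟮𝓡 (n + 1), L; ℝ⟯} (hf : X.FormBound (extD (𝓡 (n + 1)) L f) (.inr j) β) :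
    ∃ K, ∀ᶠ r in endFilter (.inr j : Fin s ⊕ Fin l), ∀ θ, |f (X.φ (.inr j) (θ, r))| ≤ K * r ^ β := by
  obtain ⟨c, hc, hcb, K, hK⟩ := hf.abs_sub_le X hβ.ne'
  obtain ⟨r₀, hr₀⟩ := (endFilter (.inr j : Fin s ⊕ Fin l)).nonempty_of_mem
    (openRadii_mem_endFilter hc (.inr j))
  have hr₀b : r₀ ∈ openRadii (X.b (.inr j)) (.inr j : Fin s ⊕ Fin l) :=
    hcb (openRadii_subset_closedRadii _ _ hr₀)
  have hcont : Continuous fun θ : Lk (.inr j) => f (X.φ (.inr j) (θ, r₀)) :=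
    f.contMDiff.continuous.comp ((X.contMDiffOn_φ (.inr j)).continuousOn.comp_continuous
      (by fun_prop) fun θ => ⟨mem_univ _, hr₀b⟩)
  obtain ⟨D, hD⟩ := isCompact_univ.exists_bound_of_continuousOn hcont.continuousOn
  -- `D` bounds `f` on the compact slice of radius `r₀`. Since `r ^ β ≥ 1` for `r ≥ 1`, the
  -- constants `r₀ ^ β` and `D` are absorbed into multiples of `r ^ β`.
  refine ⟨|K| * (1 + r₀ ^ β) + |D|, ?_⟩
  filter_upwards [openRadii_mem_endFilter hc (.inr j), (Filter.eventually_ge_atTop (1 : ℝ) :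
    ∀ᶠ r in endFilter (.inr j : Fin s ⊕ Fin l), 1 ≤ r)] with r hr hr1 θ
  have h1 := hK f θ (fun r _ => isPrimAt_extD f _) r hr r₀ hr₀
  have h2 : |f (X.φ (.inr j) (θ, r₀))| ≤ D := hD θ (mem_univ _)
  have h3 : 1 ≤ r ^ β := Real.one_le_rpow hr1 hβ.le
  have h4 : 0 ≤ r₀ ^ β := Real.rpow_nonneg (pos_of_mem_openRadii hc hr₀).le _
  have h5 : |r ^ β - r₀ ^ β| ≤ r ^ β * (1 + r₀ ^ β) := by
    rw [abs_le]
    constructor <;> nlinarith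
  have h6 : |f (X.φ (.inr j) (θ, r))| ≤
      |f (X.φ (.inr j) (θ, r)) - f (X.φ (.inr j) (θ, r₀))| + |f (X.φ (.inr j) (θ, r₀))| := by
    simpa using abs_add_le (f (X.φ (.inr j) (θ, r)) - f (X.φ (.inr j) (θ, r₀)))
      (f (X.φ (.inr j) (θ, r₀)))
  calc _ ≤ |K| * (r ^ β * (1 + r₀ ^ β)) + |D| * r ^ β := by
        refine h6.trans (add_le_add (h1.trans ?_) (h2.trans ?_))
        · exact mul_le_mul (le_abs_self K) h5 (abs_nonneg _) (abs_nonneg _)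
        · nlinarith [le_abs_self D, abs_nonneg D]
    _ = _ := by ring

theorem tendsto_rpow_elim {μ : Fin s → ℝ} {lam : Fin l → ℝ} (hμ : ∀ i, 0 < μ i) (i : Fin s) :
    Filter.Tendsto (fun r : ℝ => r ^ (Sum.elim μ lam (.inl i)))
      (endFilter (.inl i : Fin s ⊕ Fin l)) (𝓝 0) := by
  have h := (Real.continuousAt_rpow_const 0 (μ i) (Or.inr (hμ i).le)).tendsto
  rw [Real.zero_rpow (hμ i).ne'] at h
  exact h.mono_left nhdsWithin_le_nhds

end CSACStructure
end Ends

/-! ### The two decompositions -/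

section Ends
open Bundle
set_option linter.unusedSectionVars false
variable {n s l : ℕ} {L : Type*} [TopologicalSpace L] [T2Space L] [SecondCountableTopology L]
    [ConnectedSpace L]
    [ChartedSpace (EuclideanSpace ℝ (Fin (n + 1))) L] [IsManifold (𝓡 (n + 1)) ∞ L]
    {g : Metric (n + 1) L}
    {Lk : Fin s ⊕ Fin l → Type*} [∀ i, TopologicalSpace (Lk i)]
    [∀ i, CompactSpace (Lk i)] [∀ i, ConnectedSpace (Lk i)]
    [∀ i, ChartedSpace (EuclideanSpace ℝ (Fin n)) (Lk i)] [∀ i, IsManifold (𝓡 n) ∞ (Lk i)]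
    (X : CSACStructure g Lk)

namespace CSACStructure

/-- The decomposition of closed forms that decay along all ends. -/
theorem isInternalSum_of_decay {Ht : Submodule ℝ (OneForm (𝓡 (n + 1)) L)}
    {f : Fin s ⊕ Fin l → C^∞⟮𝓡 (n + 1), L; ℝ⟯}
    (hHt : Ht ≤ closedVanishing (𝓡 (n + 1)) (Filter.cocompact L))
    (hrep : Represents Ht (Filter.cocompact L)) (hf : ∀ i, X.IsEndFunction i (f i))
    (hf1 : ∑ i, f i = 1) {β : Fin s ⊕ Fin l → ℝ} (hβ0 : ∀ i, β i ≠ 0)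
    (hβ : ∀ i, Filter.Tendsto (fun r : ℝ => r ^ β i) (endFilter i) (𝓝 0)) :
    IsInternalSum (closedForms (𝓡 (n + 1)) L ⊓ X.weightedForms fun i => β i - 1)
      ![Ht, (Submodule.span ℝ (range f)).map (extD (𝓡 (n + 1)) L),
        (X.weightedFunctions β).map (extD (𝓡 (n + 1)) L)] := by
  have hval : ∀ c : Fin s ⊕ Fin l → ℝ, ∀ i, ∀ x ∈ X.endSet i, (∑ k, c k • f k) x = c i := by
    intro c i x hx
    rw [smoothFunction_sum_apply, Finset.sum_eq_single_of_mem i (Finset.mem_univ i)]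
    · change c i * f i x = c i
      rw [(hf i).1 x hx, mul_one]
    · intro k _ hk
      change c k * f k x = 0
      rw [(hf k).2 i hk.symm x hx, mul_zero]
  have hHw : Ht ≤ closedForms (𝓡 (n + 1)) L ⊓ X.weightedForms fun i => β i - 1 := fun a ha =>
    ⟨(hHt ha).1, X.mem_weightedForms_iff.2 ⟨(hHt ha).1.1, fun i =>
      X.formWeight_of_eventually_zero (X.eventually_cocompact_iff.1 (hHt ha).2 i)⟩⟩
  refine isInternalSum_three hHw ?_ ?_ ?_ ?_
  · rintro _ ⟨e, he, rfl⟩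
    obtain ⟨c, rfl⟩ := (Submodule.mem_span_range_iff_exists_fun ℝ).1 he
    exact ⟨extD_mem_closedForms _, X.extD_mem_weightedForms_of_const (hval c)⟩
  · rintro _ ⟨w, hw, rfl⟩
    exact ⟨extD_mem_closedForms _, X.extD_mem_weightedForms hw⟩
  · rintro α ⟨hα, hαw⟩
    have hαW := X.mem_weightedForms_iff.1 hαw
    obtain ⟨G, hG, -⟩ := X.exists_decaying_primitive hα Finset.univ
      (fun i _ => (hαW.2 i).formBound X) (fun i _ => hβ0 i) (fun i _ => hβ i)
    -- Subtracting the cut-off primitive leaves a compactly supported form, whose class is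
    -- represented in `Ht`.
    have hγ : α - extD (𝓡 (n + 1)) L G ∈ closedVanishing (𝓡 (n + 1)) (Filter.cocompact L) := by
      refine ⟨sub_mem hα (extD_mem_closedForms G), ?_⟩
      change ∀ᶠ x in Filter.cocompact L, (α - extD (𝓡 (n + 1)) L G) x = 0
      refine X.eventually_cocompact_iff.2 fun i => ?_
      filter_upwards [(hG i (Finset.mem_univ i)).2] with r hr θ
      exact sub_eq_zero.2 (hr θ).symm
    obtain ⟨v, hv, h, hh⟩ := hrep.exists_eq hγ
    have hdh : ∀ i, ∀ᶠ r in endFilter i, ∀ θ, extD (𝓡 (n + 1)) L h (X.φ i (θ, r)) = 0 := by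
      intro i
      filter_upwards [X.eventually_cocompact_iff.1 hγ.2 i, X.eventually_cocompact_iff.1 (hHt hv).2 i]
        with r h1 h2 θ
      have h3 := congrFun hh (X.φ i (θ, r))
      rw [h1 θ] at h3
      change v _ + extD (𝓡 (n + 1)) L h _ = 0 at h3
      rwa [h2 θ, zero_add] at h3
    -- `h` need not have compact support: it is constant far along each end, and these constants are
    -- the coefficients of the component in `E_{0,∞}`.
    choose a ha using fun i => X.eventually_const (hdh i)
    set e := ∑ k, a k • f k with he
    have hespan : e ∈ Submodule.span ℝ (range f) :=
      (Submodule.mem_span_range_iff_exists_fun ℝ).2 ⟨a, rfl⟩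
    have hdw : v + extD (𝓡 (n + 1)) L e + extD (𝓡 (n + 1)) L (h - e + G) = α := by
      rw [map_add, map_sub]
      have : v + extD (𝓡 (n + 1)) L h + extD (𝓡 (n + 1)) L G = α := by rw [hh]; abel
      rw [← this]
      abel
    refine ⟨v, hv, _, ⟨e, hespan, rfl⟩, _, ⟨h - e + G, ?_, rfl⟩, hdw⟩
    refine X.mem_weightedFunctions_iff.2 fun i => ⟨?_, ?_⟩
    · obtain ⟨K, hK⟩ := (hG i (Finset.mem_univ i)).1
      refine ⟨K, ?_⟩
      filter_upwards [hK, ha i, X.eventually_mem_endSet i] with r h1 h2 h3 θ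
      have h4 : (h - e + G) (X.φ i (θ, r)) = G (X.φ i (θ, r)) := by
        change h _ - e _ + G _ = _
        rw [h2 θ, he, hval a i _ (h3 θ), sub_self, zero_add]
      rw [h4]
      exact h1 θ
    -- The differential is `α - v - de`, a combination of forms already known to have the right
    -- weight, so derivatives of `G` are never estimated.
    · have h1 : extD (𝓡 (n + 1)) L (h - e + G) ∈ X.weightedForms fun i => β i - 1 := by
        rw [← eq_sub_iff_add_eq'] at hdw
        rw [hdw]
        exact sub_mem hαw (add_mem (hHw hv).2 (X.extD_mem_weightedForms_of_const (hval a)))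
      exact (X.mem_weightedForms_iff.1 h1).2 i
  · rintro v hv _ ⟨e, he, rfl⟩ _ ⟨w, hw, rfl⟩ h0
    obtain ⟨c, rfl⟩ := (Submodule.mem_span_range_iff_exists_fun ℝ).1 he
    set e := ∑ k, c k • f k with hedef
    have hv0 : v = 0 := hrep.eq_zero hv (f := -(e + w)) (by
      rw [map_neg, map_add]
      rw [add_assoc] at h0
      exact (eq_neg_of_add_eq_zero_left h0).symm)
    rw [hv0, zero_add, ← map_add] at h0
    obtain ⟨x₀⟩ : Nonempty L := inferInstance
    have hconst := eq_of_extD_eq_zero h0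
    -- `e + w` is constant and `w` decays on every end, so every coefficient of `e` equals that
    -- constant. Hence `e` is a multiple of `∑ f_i = 1`.
    have hc : ∀ i, (e + w) x₀ - c i = 0 := by
      intro i
      obtain ⟨K, hK⟩ := (X.mem_weightedFunctions_iff.1 hw i).1
      refine X.eq_zero_of_const_of_bound (hβ i) hK (a := (e + w) x₀ - c i) ?_
      filter_upwards [X.eventually_mem_endSet i] with r hr θ
      rw [hconst x₀ (X.φ i (θ, r))]
      change _ = e _ + w _ - c i
      rw [hedef, hval c i _ (hr θ)]
      ring
    have he1 : e = ((e + w) x₀) • (1 : C^∞⟮𝓡 (n + 1), L; ℝ⟯) := by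
      rw [← hf1, Finset.smul_sum, hedef]
      refine Finset.sum_congr rfl fun i _ => ?_
      rw [← hedef, sub_eq_zero.1 (hc i)]
    have hde : extD (𝓡 (n + 1)) L e = 0 := by
      have h1 : extD (𝓡 (n + 1)) L (1 : C^∞⟮𝓡 (n + 1), L; ℝ⟯) = 0 :=
        funext fun x => (isPrimAt_const (I := 𝓡 (n + 1)) (1 : ℝ) x).2
      rw [he1, map_smul, h1, smul_zero]
    refine ⟨hv0, hde, ?_⟩
    rw [map_add, hde, zero_add] at h0
    exact h0

theorem formWeight_of_translationInvariant {α : OneForm (𝓡 (n + 1)) L}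
    (hα : α ∈ smoothForms (𝓡 (n + 1)) L) (h : X.TranslationInvariant α) (i : Fin s ⊕ Fin l) :
    X.FormWeight i (-1) α := by
  obtain ⟨η, hη, hη'⟩ := h i
  refine X.formWeight_of_invariant hα hη ?_
  filter_upwards [hη'] with r hr θ w
  have h1 := congrArg (fun A : (EuclideanSpace ℝ (Fin n) × ℝ) →L[ℝ] ℝ => A w) (hr θ)
  have h2 := congrArg (fun A : (EuclideanSpace ℝ (Fin n) × ℝ) →L[ℝ] EuclideanSpace ℝ (Fin n) => A w)
    (mfderiv_fst (I := 𝓡 n) (I' := 𝓘(ℝ, ℝ)) (x := ((θ, r) : Lk i × ℝ)))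
  exact h1.trans (congrArg (η θ : EuclideanSpace ℝ (Fin n) →L[ℝ] ℝ) h2)

/-- The decomposition of closed forms that decay along the CS ends and grow along the AC ends. -/
theorem isInternalSum_of_growth {Ht : Submodule ℝ (OneForm (𝓡 (n + 1)) L)}
    {f : Fin s → C^∞⟮𝓡 (n + 1), L; ℝ⟯}
    (hHt : Ht ≤ closedVanishing (𝓡 (n + 1)) X.nearSingularities)
    (hinv : ∀ α ∈ Ht, X.TranslationInvariant α)
    (hrep : Represents Ht X.nearSingularities) (hf : ∀ i, X.IsEndFunction (.inl i) (f i))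
    {μ : Fin s → ℝ} {lam : Fin l → ℝ} (hμ : ∀ i, 0 < μ i) (hlam : ∀ j, 0 < lam j) :
    Disjoint (Submodule.span ℝ (range f)) (X.weightedFunctions (Sum.elim μ lam)) ∧
    IsInternalSum (closedForms (𝓡 (n + 1)) L ⊓ X.weightedForms fun i => Sum.elim μ lam i - 1)
      ![Ht, (Submodule.span ℝ (range f) ⊔ X.weightedFunctions (Sum.elim μ lam)).map
        (extD (𝓡 (n + 1)) L)] := by
  set β : Fin s ⊕ Fin l → ℝ := Sum.elim μ lam with hβdef
  have hβ : ∀ i : Fin s, Filter.Tendsto (fun r : ℝ => r ^ β (.inl i))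
      (endFilter (.inl i : Fin s ⊕ Fin l)) (𝓝 0) := tendsto_rpow_elim hμ
  have hval : ∀ c : Fin s → ℝ, ∀ i, ∀ x ∈ X.endSet i,
      (∑ k, c k • f k) x = (Sum.elim c 0 : Fin s ⊕ Fin l → ℝ) i := by
    rintro c (i | j) x hx
    · rw [smoothFunction_sum_apply, Finset.sum_eq_single_of_mem i (Finset.mem_univ i)]
      · change c i * f i x = c i
        rw [(hf i).1 x hx, mul_one]
      · intro k _ hk
        change c k * f k x = 0
        rw [(hf k).2 (.inl i) (fun h => hk (Sum.inl_injective h).symm) x hx, mul_zero]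
    · rw [smoothFunction_sum_apply]
      refine Finset.sum_eq_zero fun k _ => ?_
      change c k * f k x = 0
      rw [(hf k).2 (.inr j) Sum.inr_ne_inl x hx, mul_zero]
  have hHw : Ht ≤ closedForms (𝓡 (n + 1)) L ⊓ X.weightedForms fun i => β i - 1 := by
    refine fun a ha => ⟨(hHt ha).1, X.mem_weightedForms_iff.2 ⟨(hHt ha).1.1, ?_⟩⟩
    rintro (i | j)
    · exact X.formWeight_of_eventually_zero (X.eventually_nearSingularities_iff.1 (hHt ha).2 i)
    -- The rate `-1` is at most `λ - 1` because `λ > 0`.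
    · refine (X.formWeight_of_translationInvariant (hHt ha).1.1 (hinv a ha) _).mono_atTop X ?_
      change -1 ≤ lam j - 1
      linarith [hlam j]
  refine ⟨?_, isInternalSum_two hHw ?_ ?_ ?_⟩
  · rw [Submodule.disjoint_def]
    intro e he hew
    obtain ⟨c, rfl⟩ := (Submodule.mem_span_range_iff_exists_fun ℝ).1 he
    -- An element of the intersection tends to zero along each CS end, where it equals its
    -- coefficient.
    refine Finset.sum_eq_zero fun i _ => ?_
    obtain ⟨K, hK⟩ := (X.mem_weightedFunctions_iff.1 hew (.inl i)).1
    have h1 : c i = 0 := X.eq_zero_of_const_of_bound (hβ i) hK (by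
      filter_upwards [X.eventually_mem_endSet (.inl i)] with r hr θ
      exact hval c (.inl i) _ (hr θ))
    rw [h1, zero_smul]
  · rintro _ ⟨u, hu, rfl⟩
    refine ⟨extD_mem_closedForms _, ?_⟩
    obtain ⟨e, he, w, hw, rfl⟩ := Submodule.mem_sup.1 hu
    obtain ⟨c, rfl⟩ := (Submodule.mem_span_range_iff_exists_fun ℝ).1 he
    rw [map_add]
    exact add_mem (X.extD_mem_weightedForms_of_const (hval c)) (X.extD_mem_weightedForms hw)
  · rintro α ⟨hα, hαw⟩
    have hαW := X.mem_weightedForms_iff.1 hαw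
    -- Decaying primitives are subtracted on the CS ends only.
    let S : Finset (Fin s ⊕ Fin l) := Finset.univ.map Function.Embedding.inl
    have hS : ∀ i ∈ S, ∃ k, Sum.inl k = i := fun i hi => by
      obtain ⟨k, -, hk⟩ := Finset.mem_map.1 hi
      exact ⟨k, hk⟩
    have hiS : ∀ i : Fin s, Sum.inl i ∈ S := fun i =>
      Finset.mem_map_of_mem Function.Embedding.inl (Finset.mem_univ i)
    have hjS : ∀ j : Fin l, Sum.inr j ∉ S := fun j hj => by
      obtain ⟨k, hk⟩ := hS _ hj
      cases hk
    obtain ⟨G, hG, hG0⟩ := X.exists_decaying_primitive hα S (β := β)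
      (fun i _ => (hαW.2 i).formBound X)
      (fun i hi => by
        obtain ⟨k, rfl⟩ := hS i hi
        exact (hμ k).ne')
      (fun i hi => by
        obtain ⟨k, rfl⟩ := hS i hi
        exact hβ k)
    have hγ : α - extD (𝓡 (n + 1)) L G ∈ closedVanishing (𝓡 (n + 1)) X.nearSingularities := by
      refine ⟨sub_mem hα (extD_mem_closedForms G), ?_⟩
      change ∀ᶠ x in X.nearSingularities, (α - extD (𝓡 (n + 1)) L G) x = 0
      refine X.eventually_nearSingularities_iff.2 fun i => ?_
      filter_upwards [(hG (.inl i) (hiS i)).2] with r hr θ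
      exact sub_eq_zero.2 (hr θ).symm
    obtain ⟨v, hv, h, hh⟩ := hrep.exists_eq hγ
    have hdh : ∀ i : Fin s, ∀ᶠ r in endFilter (.inl i : Fin s ⊕ Fin l), ∀ θ,
        extD (𝓡 (n + 1)) L h (X.φ (.inl i) (θ, r)) = 0 := by
      intro i
      filter_upwards [X.eventually_nearSingularities_iff.1 hγ.2 i,
        X.eventually_nearSingularities_iff.1 (hHt hv).2 i] with r h1 h2 θ
      have h3 := congrFun hh (X.φ (.inl i) (θ, r))
      rw [h1 θ] at h3
      change v _ + extD (𝓡 (n + 1)) L h _ = 0 at h3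
      rwa [h2 θ, zero_add] at h3
    choose a ha using fun i => X.eventually_const (hdh i)
    set e := ∑ k, a k • f k with he
    have hespan : e ∈ Submodule.span ℝ (range f) :=
      (Submodule.mem_span_range_iff_exists_fun ℝ).2 ⟨a, rfl⟩
    set w := h - e + G with hw
    have hdw : v + extD (𝓡 (n + 1)) L e + extD (𝓡 (n + 1)) L w = α := by
      rw [hw, map_add, map_sub]
      have : v + extD (𝓡 (n + 1)) L h + extD (𝓡 (n + 1)) L G = α := by rw [hh]; abel
      rw [← this]
      abel
    have hww : extD (𝓡 (n + 1)) L w ∈ X.weightedForms fun i => β i - 1 := by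
      rw [← eq_sub_iff_add_eq'] at hdw
      rw [hdw]
      exact sub_mem hαw (add_mem (hHw hv).2 (X.extD_mem_weightedForms_of_const (hval a)))
    refine ⟨v, hv, _, ⟨e + w, Submodule.add_mem_sup hespan ?_, rfl⟩, by
      rw [map_add, ← add_assoc, hdw]⟩
    refine X.mem_weightedFunctions_iff.2 fun i => ⟨?_, (X.mem_weightedForms_iff.1 hww).2 i⟩
    -- On CS ends `w` coincides with the decaying primitive `G`. On AC ends its growth follows by
    -- integrating the bound on `dw` outwards.
    rcases i with i | j
    · obtain ⟨K, hK⟩ := (hG (.inl i) (hiS i)).1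
      refine ⟨K, ?_⟩
      filter_upwards [hK, ha i, X.eventually_mem_endSet (.inl i)] with r h1 h2 h3 θ
      have h4 : w (X.φ (.inl i) (θ, r)) = G (X.φ (.inl i) (θ, r)) := by
        change h _ - e _ + G _ = _
        rw [h2 θ, he, hval a (.inl i) _ (h3 θ)]
        simp
      rw [h4]
      exact h1 θ
    · exact X.bound_of_formBound (hlam j)
        (((X.mem_weightedForms_iff.1 hww).2 (.inr j)).formBound X)
  · rintro v hv _ ⟨u, hu, rfl⟩ h0
    -- The relation exhibits the representative `v` as exact.
    have hv0 : v = 0 := hrep.eq_zero hv (f := -u) (by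
      rw [map_neg]
      exact (eq_neg_of_add_eq_zero_left h0).symm)
    exact ⟨hv0, by rwa [hv0, zero_add] at h0⟩

end CSACStructure
end Ends

end Conifold
end

/-! ### The theorem -/

theorem mainTheorem3 {n s l : ℕ} (hn : 2 ≤ n)
    {L : Type*} [TopologicalSpace L] [T2Space L] [SecondCountableTopology L] [ConnectedSpace L]
    [ChartedSpace (EuclideanSpace ℝ (Fin (n + 1))) L] [IsManifold (𝓡 (n + 1)) ∞ L]
    (g : Metric (n + 1) L)
    {Lk : Fin s ⊕ Fin l → Type*} [∀ i, TopologicalSpace (Lk i)] [∀ i, T2Space (Lk i)]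
    [∀ i, CompactSpace (Lk i)] [∀ i, ConnectedSpace (Lk i)]
    [∀ i, ChartedSpace (EuclideanSpace ℝ (Fin n)) (Lk i)] [∀ i, IsManifold (𝓡 n) ∞ (Lk i)]
    (X : CSACStructure g Lk) :
    -- the case `μ > 0`, `λ < 0`
    (∀ (Ht : Submodule ℝ (OneForm (𝓡 (n + 1)) L))
        (f : Fin s ⊕ Fin l → C^∞⟮𝓡 (n + 1), L; ℝ⟯),
      Ht ≤ closedVanishing (𝓡 (n + 1)) (Filter.cocompact L) →
      Represents Ht (Filter.cocompact L) →
      (∀ i, X.IsEndFunction i (f i)) →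
      ∑ i, f i = 1 →
      FiniteDimensional ℝ Ht ∧
      ∀ (μ : Fin s → ℝ) (lam : Fin l → ℝ), (∀ i, 0 < μ i) → (∀ j, lam j < 0) →
        IsInternalSum
          (closedForms (𝓡 (n + 1)) L ⊓
            X.weightedForms (Sum.elim (fun i => μ i - 1) (fun j => lam j - 1)))
          ![Ht,
            (Submodule.span ℝ (range f)).map (extD (𝓡 (n + 1)) L),
            (X.weightedFunctions (Sum.elim μ lam)).map (extD (𝓡 (n + 1)) L)]) ∧
    -- the case `μ > 0`, `λ > 0`
    (∀ (Ht : Submodule ℝ (OneForm (𝓡 (n + 1)) L))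
        (f : Fin s → C^∞⟮𝓡 (n + 1), L; ℝ⟯),
      Ht ≤ closedVanishing (𝓡 (n + 1)) X.nearSingularities →
      (∀ α ∈ Ht, X.TranslationInvariant α) →
      Represents Ht X.nearSingularities →
      (∀ i, X.IsEndFunction (.inl i) (f i)) →
      FiniteDimensional ℝ Ht ∧
      ∀ (μ : Fin s → ℝ) (lam : Fin l → ℝ), (∀ i, 0 < μ i) → (∀ j, 0 < lam j) →
        Disjoint (Submodule.span ℝ (range f)) (X.weightedFunctions (Sum.elim μ lam)) ∧
        IsInternalSum
          (closedForms (𝓡 (n + 1)) L ⊓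
            X.weightedForms (Sum.elim (fun i => μ i - 1) (fun j => lam j - 1)))
          ![Ht,
            (Submodule.span ℝ (range f) ⊔ X.weightedFunctions (Sum.elim μ lam)).map
              (extD (𝓡 (n + 1)) L)]) := by
  have hfin := X.finiteDimensional_H1
  have hsub : ∀ (μ : Fin s → ℝ) (lam : Fin l → ℝ),
      (Sum.elim (fun i => μ i - 1) (fun j => lam j - 1) : Fin s ⊕ Fin l → ℝ) =
        fun i => Sum.elim μ lam i - 1 := fun μ lam => by
    funext i
    cases i <;> rfl
  refine ⟨fun Ht f hHt hrep hf hf1 => ⟨hrep.finiteDimensional, fun μ lam hμ hlam => ?_⟩,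
    fun Ht f hHt hinv hrep hf => ⟨hrep.finiteDimensional, fun μ lam hμ hlam => ?_⟩⟩
  · rw [hsub]
    refine X.isInternalSum_of_decay hHt hrep hf hf1 ?_ ?_
    · rintro (i | j)
      · exact (hμ i).ne'
      · exact (hlam j).ne
    · rintro (i | j)
      · exact CSACStructure.tendsto_rpow_elim hμ i
      · have h := tendsto_rpow_neg_atTop (neg_pos.2 (hlam j))
        rwa [neg_neg] at h
  · rw [hsub]
    exact X.isInternalSum_of_growth hHt hinv hrep hf hμ hlam
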